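/- Let $k\in\mathbb N$ and $\beta\in[0,1/2)$. There is a constant $C>0$, depending only on $k$ and $\beta$, with the following property. Let $a,h>0$ and $R=(0,h)\times(0,a)$. Let $\Gamma_1=\{0\}$ or $\Gamma_1=\{a\}$ be one of the two endpoints of $(0,a)$, let $\delta(x,y)=\operatorname{dist}((x,y),(0,h)\times\Gamma_1)$ (so $\delta(x,y)=y$, respectively $\delta(x,y)=a-y$, on $R$), and let $$w=c_1\delta^{\alpha_1}+\dots+c_k\delta^{\alpha_k},\qquad c_i\ge 0,\quad \alpha_i\in[0,\beta],\quad i=1,\dots,k.$$ Let $U=(u,v)\in H^1(R,\mathbb R^2)$ satisfy $u(x,0)=u(x,a)$ for $x\in(0,h)$ in the sense of traces, and let $e(U)=\frac12(\nabla U+\nabla U^T)$. Then $$\|w\nabla U\|_{L^2(R)}^2\le C\left(\frac{\|wu\|_{L^2(R)}\,\|we(U)\|_{L^2(R)}}{h}+\|we(U)\|_{L^2(R)}^2\right),$$ where matrices carry the Euclidean (Frobenius) norm. In particular $C$ does not depend on $h$, $a$, the coefficients $c_i$ or $U$. -/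

import Mathlib

open MeasureTheory Set Filter Topology
open scoped ContDiff

/-- The open rectangle `(0,h) × (0,a)`. -/
def rect (h a : ℝ) : Set (ℝ × ℝ) := Ioo 0 h ×ˢ Ioo 0 a

/-- `g` is the weak derivative of `u` in the direction `e` on the open set `Ω`. -/
def IsWeakDeriv (Ω : Set (ℝ × ℝ)) (e : ℝ × ℝ) (u g : ℝ × ℝ → ℝ) : Prop :=
  ∀ φ : ℝ × ℝ → ℝ, ContDiff ℝ ∞ φ → HasCompactSupport φ → tsupport φ ⊆ Ω →
    ∫ p in Ω, u p * fderiv ℝ φ p e = -∫ p in Ω, g p * φ p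

/-- `u ∈ H¹(Ω)`, with weak partial derivatives `ux` and `uy`. -/
structure IsSobolevH1 (Ω : Set (ℝ × ℝ)) (u ux uy : ℝ × ℝ → ℝ) : Prop where
  memLp : MemLp u 2 (volume.restrict Ω)
  memLp_dx : MemLp ux 2 (volume.restrict Ω)
  memLp_dy : MemLp uy 2 (volume.restrict Ω)
  weak_dx : IsWeakDeriv Ω (1, 0) u ux
  weak_dy : IsWeakDeriv Ω (0, 1) u uy

/-- `g ∈ L²(0,h)` is the trace, on the horizontal side `(0,h) × {s}` of `(0,h) × (0,a)`
(`s = 0` or `s = a`), of the `H¹` function `u` with weak partial derivatives `ux`, `uy`: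
the limit in `L²` of the restrictions of functions that are smooth up to the boundary and
converge to `u` in `H¹`. -/
def HasTraceOnSide (h a s : ℝ) (u ux uy : ℝ × ℝ → ℝ) (g : ℝ → ℝ) : Prop :=
  MemLp g 2 (volume.restrict (Ioo 0 h)) ∧
  ∃ φ : ℕ → ℝ × ℝ → ℝ, (∀ n, ContDiff ℝ ∞ (φ n)) ∧
    Tendsto (fun n => eLpNorm (fun p => φ n p - u p) 2 (volume.restrict (rect h a)))
      atTop (𝓝 0) ∧
    Tendsto (fun n => eLpNorm (fun p => fderiv ℝ (φ n) p (1, 0) - ux p) 2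
      (volume.restrict (rect h a))) atTop (𝓝 0) ∧
    Tendsto (fun n => eLpNorm (fun p => fderiv ℝ (φ n) p (0, 1) - uy p) 2
      (volume.restrict (rect h a))) atTop (𝓝 0) ∧
    Tendsto (fun n => eLpNorm (fun x => φ n (x, s) - g x) 2 (volume.restrict (Ioo 0 h)))
      atTop (𝓝 0)

noncomputable section

/-- The Euclidean distance from `p` to the segment `(0,h) × {s}`. -/
def sideDist (h s : ℝ) (p : ℝ × ℝ) : ℝ :=
  Metric.infDist (WithLp.toLp 2 p) (WithLp.toLp 2 '' (Ioo 0 h ×ˢ {s} : Set (ℝ × ℝ)))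

/-- The weight `w = ∑ᵢ cᵢ δ ^ αᵢ`, with `δ` the distance to `(0,h) × {s}`. -/
def sideWeight {k : ℕ} (h s : ℝ) (c α : Fin k → ℝ) (p : ℝ × ℝ) : ℝ :=
  ∑ i, c i * sideDist h s p ^ α i

/-- The `L²(Ω)` norm of a real function. -/
def l2norm (Ω : Set (ℝ × ℝ)) (f : ℝ × ℝ → ℝ) : ℝ := √(∫ p in Ω, f p ^ 2)

/-- The Frobenius (Euclidean) norm of a `2 × 2` matrix. -/
def frob (A : Matrix (Fin 2) (Fin 2) ℝ) : ℝ := √(∑ i, ∑ j, A i j ^ 2)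

/-- The gradient matrix of a displacement `(u, v)` with the given partial derivatives. -/
def gradMat (ux uy vx vy : ℝ × ℝ → ℝ) (p : ℝ × ℝ) : Matrix (Fin 2) (Fin 2) ℝ :=
  !![ux p, uy p; vx p, vy p]

/-- The symmetric part of a matrix. -/
def symPart (A : Matrix (Fin 2) (Fin 2) ℝ) : Matrix (Fin 2) (Fin 2) ℝ :=
  (1 / 2 : ℝ) • (A + A.transpose)

end

/-! Write `W = w²`, `D = u_y + v_x`, `F = v_x`, `G = v_y`. Since `v_x = D - u_y`, it is enough to
bound `∫ W u_y²` by the mixed term plus `∫ W (u_x² + D² + G²)`. The component `v` enters only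
through the fact that `(F, G)` is curl free, so `u` alone has to be approximated by smooth
functions.

Suppose first that `u` vanishes on both horizontal sides and that `V` is a smooth concave weight.
Test the curl equation with `m V u`, where `m = m(x)` is a cutoff, and substitute `F = D - u_y`.
Integrating `V' u u_y` by parts turns it into `-V'' u² / 2`, whose sign is favourable, and this term
absorbs `V' u D` as soon as `V'² ≤ K V (-V'')`. The derivative `m'`, of order `1/h`, produces the
mixed term (`energy_le`). To avoid a cutoff near `x = 0`, the argument is applied to `(u(x,y) - 2
u(2x,y), v(x,y) - v(2x,y))`, whose second component vanishes there. The function `2 u_y(2x,y)` has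
large enough norm to recover `u_y` itself from the difference (`exists_korn_left`). Reflection in
`x` covers the other side (`exists_korn_dirichlet`).

When `u` only takes equal values on the two sides, combinations of vertical rescalings of `u` that
do vanish there are used (`exists_korn_combination`). Folding along `y = ζ a` compares `u_y` below
the fold with `u_y` above it. The folds `ζ = 1/2` and `ζ = 2/3` together bound the weighted norm on
the lower two thirds by `θ` times itself, up to a factor near one and error terms, where `W(2y) ≤ 2
θ W(y)`. Here `θ = 2^(2β) / 2 < 1` precisely because `β < 1/2`, so the term can be absorbed
(`exists_lower_le`). Above `a / 3` the weight is comparable to a constant, and a combination of four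
rescalings with values in `(a / 3, a)` transports the bound from the middle third upwards
(`exists_upper_le`).

The condition `β < 1/2` also makes `(∑ cᵢ r^αᵢ)²` concave, with `K = 1 / (1 - 2β)`
(`concaveWeight_powSum`). Replacing `r` by `r + ε` makes the weight smooth up to the side without
changing `K` or `θ`, so `ε` can tend to zero at the end. Equality of traces yields smooth
approximations with equal boundary values, by a correction in a thin strip
(`exists_periodic_approx`). The constant obtained depends on `β` only. -/

/-! ### Partial derivatives and curl free fields -/

/-- The classical partial derivative with respect to the first variable. -/
noncomputable abbrev pdx (f : ℝ × ℝ → ℝ) (p : ℝ × ℝ) : ℝ := fderiv ℝ f p (1, 0)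

/-- The classical partial derivative with respect to the second variable. -/
noncomputable abbrev pdy (f : ℝ × ℝ → ℝ) (p : ℝ × ℝ) : ℝ := fderiv ℝ f p (0, 1)

/-- The field `(F, G)` is curl free on `Ω` in the sense of distributions. -/
def CurlFree (Ω : Set (ℝ × ℝ)) (F G : ℝ × ℝ → ℝ) : Prop :=
  ∀ ψ : ℝ × ℝ → ℝ, ContDiff ℝ ∞ ψ → HasCompactSupport ψ → tsupport ψ ⊆ Ω →
    ∫ p in Ω, F p * pdy ψ p = ∫ p in Ω, G p * pdx ψ p

theorem contDiff_fderiv_apply {ψ : ℝ × ℝ → ℝ} (hψ : ContDiff ℝ ∞ ψ) (e : ℝ × ℝ) :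
    ContDiff ℝ ∞ (fun p => fderiv ℝ ψ p e) :=
  (hψ.fderiv_right (m := ∞) (by simp)).clm_apply contDiff_const

theorem pdx_pdy_comm {ψ : ℝ × ℝ → ℝ} (hψ : ContDiff ℝ ∞ ψ) (p : ℝ × ℝ) :
    pdx (pdy ψ) p = pdy (pdx ψ) p := by
  have hs : IsSymmSndFDerivAt ℝ ψ p := hψ.contDiffAt.isSymmSndFDerivAt (by
    rw [minSmoothness_of_isRCLikeNormedField]
    exact WithTop.coe_le_coe.2 (le_top : (2 : ℕ∞) ≤ ⊤))
  have hd : DifferentiableAt ℝ (fderiv ℝ ψ) p :=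
    ((hψ.fderiv_right (m := ∞) (by simp)).differentiable (by simp)) p
  have key : ∀ e e' : ℝ × ℝ, fderiv ℝ (fun q => fderiv ℝ ψ q e) p e' =
      fderiv ℝ (fderiv ℝ ψ) p e' e := by
    intro e e'
    rw [fderiv_clm_apply hd (differentiableAt_const _)]
    simp
  simp only [pdx, pdy]
  rw [key, key]
  exact hs _ _

/-- A weak gradient is curl free. -/
theorem IsSobolevH1.curlFree {Ω : Set (ℝ × ℝ)} {v vx vy : ℝ × ℝ → ℝ}
    (hv : IsSobolevH1 Ω v vx vy) : CurlFree Ω vx vy := by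
  intro ψ hψ hc hs
  have cs : ∀ e : ℝ × ℝ, HasCompactSupport (fun p => fderiv ℝ ψ p e) := fun e =>
    hc.of_isClosed_subset (isClosed_tsupport _) (tsupport_fderiv_apply_subset ℝ e)
  have h1 := hv.weak_dx (pdy ψ) (contDiff_fderiv_apply hψ _) (cs _)
    ((tsupport_fderiv_apply_subset ℝ _).trans hs)
  have h2 := hv.weak_dy (pdx ψ) (contDiff_fderiv_apply hψ _) (cs _)
    ((tsupport_fderiv_apply_subset ℝ _).trans hs)
  have h3 : ∀ p, fderiv ℝ (pdy ψ) p (1, 0) = fderiv ℝ (pdx ψ) p (0, 1) := pdx_pdy_comm hψ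
  simp only [h3] at h1
  rw [h2] at h1
  exact (neg_injective h1).symm

/-! ### Smooth cutoffs on an interval -/

theorem contDiff_smoothTransition : ContDiff ℝ ∞ Real.smoothTransition :=
  Real.smoothTransition.contDiff

theorem deriv_smoothTransition_of_neg {t : ℝ} (ht : t < 0) :
    deriv Real.smoothTransition t = 0 := by
  have : Real.smoothTransition =ᶠ[𝓝 t] fun _ => 0 := by
    filter_upwards [Iio_mem_nhds ht] with s hs
    exact Real.smoothTransition.zero_of_nonpos (le_of_lt hs)
  rw [this.deriv_eq]; simp

theorem deriv_smoothTransition_of_one_lt {t : ℝ} (ht : 1 < t) :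
    deriv Real.smoothTransition t = 0 := by
  have : Real.smoothTransition =ᶠ[𝓝 t] fun _ => 1 := by
    filter_upwards [Ioi_mem_nhds ht] with s hs
    exact Real.smoothTransition.one_of_one_le (le_of_lt hs)
  rw [this.deriv_eq]; simp

theorem exists_bound_deriv_smoothTransition :
    ∃ M : ℝ, 0 < M ∧ ∀ t, |deriv Real.smoothTransition t| ≤ M := by
  have hc : Continuous (deriv Real.smoothTransition) :=
    contDiff_smoothTransition.continuous_deriv (by simp)
  obtain ⟨C, hC⟩ := (isCompact_Icc (a := (0 : ℝ)) (b := 1)).exists_bound_of_continuousOn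
    hc.continuousOn
  refine ⟨max C 1, by positivity, fun t => ?_⟩
  rcases lt_or_ge t 0 with h | h
  · rw [deriv_smoothTransition_of_neg h]; simp
  rcases lt_or_ge 1 t with h' | h'
  · rw [deriv_smoothTransition_of_one_lt h']; simp
  · exact (hC t ⟨h, h'⟩).trans (le_max_left _ _)

/-- Smooth cutoffs exhausting an interval, with derivatives controlled by the distance to its
ends. -/
theorem exists_cutoff_seq {L : ℝ} (hL : 0 < L) :
    ∃ (C : ℝ) (κ : ℕ → ℝ → ℝ), 0 ≤ C ∧ (∀ n, ContDiff ℝ ∞ (κ n)) ∧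
      (∀ n x, 0 ≤ κ n x ∧ κ n x ≤ 1) ∧ (∀ n, tsupport (κ n) ⊆ Ioo 0 L) ∧
      (∀ x ∈ Ioo 0 L, Tendsto (fun n => κ n x) atTop (𝓝 1)) ∧
      (∀ x ∈ Ioo 0 L, Tendsto (fun n => deriv (κ n) x) atTop (𝓝 0)) ∧
      ∀ n, ∀ x ∈ Ioo 0 L, |deriv (κ n) x| * (x * (L - x)) ≤ C := by
  obtain ⟨M, hM0, hM⟩ := exists_bound_deriv_smoothTransition
  -- The cutoff is `0` where `(n + 1) x (L - x) ≤ 1` and `1` where it is at least `2`. Its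
  -- derivative therefore lives where `n + 1` is at most `2 / (x (L - x))`, which gives the uniform
  -- bound.
  let κ : ℕ → ℝ → ℝ := fun n x => Real.smoothTransition ((n + 1 : ℝ) * (x * (L - x)) - 1)
  have hder : ∀ n x, deriv (κ n) x =
      deriv Real.smoothTransition ((n + 1 : ℝ) * (x * (L - x)) - 1) *
        ((n + 1 : ℝ) * (L - 2 * x)) := by
    intro n x
    have h1 : HasDerivAt (fun x : ℝ => (n + 1 : ℝ) * (x * (L - x)) - 1)
        ((n + 1 : ℝ) * (L - 2 * x)) x := by
      have := (((hasDerivAt_id x).mul ((hasDerivAt_const x L).sub (hasDerivAt_id x))).const_mul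
        (n + 1 : ℝ)).sub_const 1
      refine this.congr_deriv ?_
      simp only [Pi.sub_apply, id]; ring
    exact ((contDiff_smoothTransition.differentiable (by simp) _).hasDerivAt.comp x h1).deriv
  have hlarge : ∀ x ∈ Ioo 0 L, ∀ᶠ n : ℕ in atTop, 1 < (n + 1 : ℝ) * (x * (L - x)) - 1 := by
    intro x hx
    have hd : 0 < x * (L - x) := mul_pos hx.1 (sub_pos.2 hx.2)
    have : Tendsto (fun n : ℕ => ((n : ℝ) + 1) * (x * (L - x)) - 1) atTop atTop := by
      refine tendsto_atTop_add_const_right _ _ ?_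
      exact (tendsto_atTop_add_const_right _ _ tendsto_natCast_atTop_atTop).atTop_mul_const hd
    exact this.eventually_gt_atTop 1
  refine ⟨2 * M * L, κ, by positivity, fun n => ?_, fun n x =>
    ⟨Real.smoothTransition.nonneg _, Real.smoothTransition.le_one _⟩, fun n => ?_, fun x hx => ?_,
    fun x hx => ?_, fun n x hx => ?_⟩
  · exact contDiff_smoothTransition.comp (by fun_prop)
  · have hcl : IsClosed {x : ℝ | 1 ≤ (n + 1 : ℝ) * (x * (L - x))} :=
      isClosed_le continuous_const (by fun_prop)
    refine (closure_minimal (fun x hx => ?_) hcl).trans (fun x hx => ?_)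
    · by_contra h
      exact hx (Real.smoothTransition.zero_of_nonpos (by
        rw [mem_ofPred_eq, not_le] at h; linarith))
    · have hx' : 1 ≤ (n + 1 : ℝ) * (x * (L - x)) := hx
      have : 0 < x * (L - x) := by
        by_contra h
        have : (n + 1 : ℝ) * (x * (L - x)) ≤ 0 := mul_nonpos_of_nonneg_of_nonpos (by positivity) (not_lt.1 h)
        linarith
      rcases mul_pos_iff.1 this with h | h
      · exact ⟨h.1, by linarith [h.2]⟩
      · linarith [h.1, h.2]
  · refine tendsto_const_nhds.congr' ?_
    filter_upwards [hlarge x hx] with n hn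
    exact (Real.smoothTransition.one_of_one_le hn.le).symm
  · refine tendsto_const_nhds.congr' ?_
    filter_upwards [hlarge x hx] with n hn
    rw [hder, deriv_smoothTransition_of_one_lt hn, zero_mul]
  · have hd : 0 < x * (L - x) := mul_pos hx.1 (sub_pos.2 hx.2)
    rw [hder]
    rcases lt_or_ge 1 ((n + 1 : ℝ) * (x * (L - x)) - 1) with h | h
    · rw [deriv_smoothTransition_of_one_lt h]; simp; positivity
    · rw [abs_mul, abs_mul, abs_of_pos (by positivity : (0 : ℝ) < n + 1)]
      have h1 : |L - 2 * x| ≤ L := by rw [abs_le]; constructor <;> linarith [hx.1, hx.2]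
      calc _ = |deriv Real.smoothTransition ((n + 1 : ℝ) * (x * (L - x)) - 1)| * |L - 2 * x| *
            ((n + 1 : ℝ) * (x * (L - x))) := by ring
        _ ≤ M * L * 2 := by
            gcongr
            · exact hM _
            · linarith
        _ = 2 * M * L := by ring

/-! ### Test functions that merely vanish on the boundary -/

/-- A smooth function on the closed rectangle that vanishes on the boundary can be used as a test
function. -/
theorem CurlFree.integral_eq_of_boundary_zero {h a : ℝ} (hh : 0 < h) (ha : 0 < a)
    {F G ψ : ℝ × ℝ → ℝ} (hc : CurlFree (rect h a) F G)
    (hF : IntegrableOn F (rect h a)) (hG : IntegrableOn G (rect h a))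
    (hψ : ∀ p ∈ Icc 0 h ×ˢ Icc 0 a, ContDiffAt ℝ ∞ ψ p)
    (hleft : ∀ y ∈ Icc 0 a, ψ (0, y) = 0) (hright : ∀ y ∈ Icc 0 a, ψ (h, y) = 0)
    (hbot : ∀ x ∈ Icc 0 h, ψ (x, 0) = 0) (htop : ∀ x ∈ Icc 0 h, ψ (x, a) = 0) :
    ∫ p in rect h a, F p * pdy ψ p = ∫ p in rect h a, G p * pdx ψ p := by
  obtain ⟨C₁, κ, hC₁, hκ, hκ01, hκs, hκ1, hκd, hκb⟩ := exists_cutoff_seq hh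
  obtain ⟨C₂, l, hC₂, hl, hl01, hls, hl1, hld, hlb⟩ := exists_cutoff_seq ha
  have hsub : rect h a ⊆ Icc 0 h ×ˢ Icc 0 a := prod_mono Ioo_subset_Icc_self Ioo_subset_Icc_self
  have hcomp : IsCompact (Icc (0 : ℝ) h ×ˢ Icc (0 : ℝ) a) := isCompact_Icc.prod isCompact_Icc
  have hconv : Convex ℝ (Icc (0 : ℝ) h ×ˢ Icc (0 : ℝ) a) := (convex_Icc _ _).prod (convex_Icc _ _)
  have hfc : ContinuousOn (fderiv ℝ ψ) (Icc 0 h ×ˢ Icc 0 a) := fun p hp =>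
    ((hψ p hp).fderiv_right (m := 0) (by simp)).continuousAt.continuousWithinAt
  obtain ⟨M, hM⟩ := hcomp.exists_bound_of_continuousOn hfc
  have hM0 : 0 ≤ M := (norm_nonneg _).trans (hM (0, 0) ⟨by simp [hh.le], by simp [ha.le]⟩)
  have hlip : ∀ p ∈ Icc 0 h ×ˢ Icc 0 a, ∀ q ∈ Icc 0 h ×ˢ Icc 0 a, ψ p = 0 →
      |ψ q| ≤ M * ‖q - p‖ := by
    intro p hp q hq h0
    have := hconv.norm_image_sub_le_of_norm_fderiv_le
      (fun z hz => (hψ z hz).differentiableAt (by simp)) hM hp hq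
    simpa [h0] using this
  -- Multiply the two bounds by `L - t` and `t` respectively and add.
  have hdist : ∀ L t b : ℝ, 0 < L → t ∈ Ioo 0 L → b ≤ M * t → b ≤ M * (L - t) →
      b ≤ 2 * M / L * (t * (L - t)) := by
    intro L t b hL ht h1 h2
    rw [div_mul_eq_mul_div, le_div_iff₀ hL]
    have h3 : 0 < L - t := sub_pos.2 ht.2
    have h4 := ht.1
    nlinarith [mul_le_mul_of_nonneg_right h1 h3.le, mul_le_mul_of_nonneg_right h2 h4.le]
  have hψx : ∀ p ∈ rect h a, |ψ p| ≤ 2 * M / h * (p.1 * (h - p.1)) := by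
    rintro ⟨x, y⟩ hp
    have hy := (hsub hp).2
    refine hdist h x _ hh hp.1 ?_ ?_
    · have := hlip (0, y) ⟨by simp [hh.le], hy⟩ (x, y) (hsub hp) (hleft y hy)
      simpa [Prod.norm_def, abs_of_pos hp.1.1, hp.1.1.le] using this
    · have := hlip (h, y) ⟨by simp [hh.le], hy⟩ (x, y) (hsub hp) (hright y hy)
      have h' : |x - h| = h - x := by rw [abs_sub_comm]; exact abs_of_pos (sub_pos.2 hp.1.2)
      simpa [Prod.norm_def, h', hp.1.2.le] using this
  have hψy : ∀ p ∈ rect h a, |ψ p| ≤ 2 * M / a * (p.2 * (a - p.2)) := by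
    rintro ⟨x, y⟩ hp
    have hx := (hsub hp).1
    refine hdist a y _ ha hp.2 ?_ ?_
    · have := hlip (x, 0) ⟨hx, by simp [ha.le]⟩ (x, y) (hsub hp) (hbot x hx)
      simpa [Prod.norm_def, abs_of_pos hp.2.1, hp.2.1.le] using this
    · have := hlip (x, a) ⟨hx, by simp [ha.le]⟩ (x, y) (hsub hp) (htop x hx)
      have h' : |y - a| = a - y := by rw [abs_sub_comm]; exact abs_of_pos (sub_pos.2 hp.2.2)
      simpa [Prod.norm_def, h', hp.2.2.le] using this
  let Ψ : ℕ → ℝ × ℝ → ℝ := fun n p => κ n p.1 * l n p.2 * ψ p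
  have hbox : ∀ n, tsupport (κ n) ×ˢ tsupport (l n) ⊆ rect h a := fun n => prod_mono (hκs n) (hls n)
  have hts : ∀ n, tsupport (Ψ n) ⊆ tsupport (κ n) ×ˢ tsupport (l n) := by
    intro n
    refine closure_minimal (fun p hp => ?_) ((isClosed_tsupport _).prod (isClosed_tsupport _))
    have : κ n p.1 ≠ 0 ∧ l n p.2 ≠ 0 := by
      constructor <;> intro h0 <;> apply hp <;> simp [Ψ, h0]
    exact ⟨subset_tsupport _ this.1, subset_tsupport _ this.2⟩
  have hcs : ∀ n, HasCompactSupport (Ψ n) := by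
    intro n
    refine IsCompact.of_isClosed_subset hcomp (isClosed_tsupport _) ?_
    exact (hts n).trans ((hbox n).trans hsub)
  have hsm : ∀ n, ContDiff ℝ ∞ (Ψ n) := by
    intro n
    rw [contDiff_iff_contDiffAt]
    intro p
    by_cases hp : p ∈ tsupport (Ψ n)
    · have hp' := hsub (hbox n (hts n hp))
      exact (((hκ n).comp contDiff_fst).contDiffAt.mul ((hl n).comp contDiff_snd).contDiffAt).mul
        (hψ p hp')
    · have : Ψ n =ᶠ[𝓝 p] fun _ => 0 := notMem_tsupport_iff_eventuallyEq.1 hp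
      exact contDiffAt_const.congr_of_eventuallyEq this
  have hfd : ∀ n, ∀ p ∈ rect h a, HasFDerivAt (Ψ n)
      ((κ n p.1 * l n p.2) • fderiv ℝ ψ p + ψ p • (κ n p.1 •
        (deriv (l n) p.2 • ContinuousLinearMap.snd ℝ ℝ ℝ) + l n p.2 •
          (deriv (κ n) p.1 • ContinuousLinearMap.fst ℝ ℝ ℝ))) p := by
    intro n p hp
    have h1 : HasFDerivAt (fun p : ℝ × ℝ => κ n p.1)
        (deriv (κ n) p.1 • ContinuousLinearMap.fst ℝ ℝ ℝ) p :=
      (((hκ n).differentiable (by simp)) p.1).hasDerivAt.comp_hasFDerivAt p hasFDerivAt_fst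
    have h2 : HasFDerivAt (fun p : ℝ × ℝ => l n p.2)
        (deriv (l n) p.2 • ContinuousLinearMap.snd ℝ ℝ ℝ) p :=
      (((hl n).differentiable (by simp)) p.2).hasDerivAt.comp_hasFDerivAt p hasFDerivAt_snd
    exact (h1.mul h2).mul ((hψ p (hsub hp)).differentiableAt (by simp)).hasFDerivAt
  have hdy : ∀ n, ∀ p ∈ rect h a, pdy (Ψ n) p =
      κ n p.1 * l n p.2 * pdy ψ p + κ n p.1 * (deriv (l n) p.2 * ψ p) := by
    intro n p hp
    simp only [pdy, (hfd n p hp).fderiv]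
    simp; ring
  have hdx : ∀ n, ∀ p ∈ rect h a, pdx (Ψ n) p =
      κ n p.1 * l n p.2 * pdx ψ p + l n p.2 * (deriv (κ n) p.1 * ψ p) := by
    intro n p hp
    simp only [pdx, (hfd n p hp).fderiv]
    simp; ring
  have hme : MeasurableSet (rect h a) := measurableSet_Ioo.prod measurableSet_Ioo
  have hop : ∀ e : ℝ × ℝ, ‖e‖ ≤ 1 → ∀ p ∈ rect h a, |fderiv ℝ ψ p e| ≤ M := by
    intro e he p hp
    calc |fderiv ℝ ψ p e| ≤ ‖fderiv ℝ ψ p‖ * ‖e‖ := (fderiv ℝ ψ p).le_opNorm e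
      _ ≤ M * 1 := by gcongr; exact hM p (hsub hp)
      _ = M := mul_one _
  -- The derivative of the cutoff blows up at most like the inverse distance to the sides, while `ψ`
  -- vanishes linearly there. The extra term `d n` is thus bounded and tends to zero pointwise, so
  -- dominated convergence applies.
  have limit : ∀ (H : ℝ × ℝ → ℝ) (e : ℝ × ℝ) (K : ℝ) (d : ℕ → ℝ × ℝ → ℝ), ‖e‖ ≤ 1 →
      IntegrableOn H (rect h a) →
      (∀ n, ∀ p ∈ rect h a, fderiv ℝ (Ψ n) p e = κ n p.1 * l n p.2 * fderiv ℝ ψ p e + d n p) →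
      (∀ n, ∀ p ∈ rect h a, |d n p| ≤ K) →
      (∀ p ∈ rect h a, Tendsto (fun n => d n p) atTop (𝓝 0)) →
      Tendsto (fun n => ∫ p in rect h a, H p * fderiv ℝ (Ψ n) p e) atTop
        (𝓝 (∫ p in rect h a, H p * fderiv ℝ ψ p e)) := by
    intro H e K d he hH hd hdK hd0
    refine tendsto_integral_of_dominated_convergence (fun p => |H p| * (M + K)) (fun n => ?_)
      (hH.abs.mul_const _) (fun n => ?_) ?_
    · exact hH.aestronglyMeasurable.mul
        ((contDiff_fderiv_apply (hsm n) e).continuous.aestronglyMeasurable)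
    · refine (ae_restrict_iff' hme).2 (Eventually.of_forall fun p hp => ?_)
      rw [Real.norm_eq_abs, abs_mul]
      gcongr
      rw [hd n p hp]
      refine (abs_add_le _ _).trans (add_le_add ?_ (hdK n p hp))
      rw [abs_mul, abs_of_nonneg (mul_nonneg (hκ01 n p.1).1 (hl01 n p.2).1)]
      have h1 : κ n p.1 * l n p.2 ≤ 1 := mul_le_one₀ (hκ01 n p.1).2 (hl01 n p.2).1 (hl01 n p.2).2
      calc _ ≤ 1 * |fderiv ℝ ψ p e| := by gcongr
        _ ≤ M := by rw [one_mul]; exact hop e he p hp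
    · refine (ae_restrict_iff' hme).2 (Eventually.of_forall fun p hp => ?_)
      have h1 := (((hκ1 p.1 hp.1).mul (hl1 p.2 hp.2)).mul_const (fderiv ℝ ψ p e)).add (hd0 p hp)
      have h2 := h1.const_mul (H p)
      simp only [one_mul, add_zero] at h2
      refine h2.congr fun n => ?_
      rw [hd n p hp]
  have hy := limit F (0, 1) (C₂ * (2 * M / a)) _ (by simp [Prod.norm_def]) hF hdy (fun n p hp => by
      have h1 := hψy p hp
      have h2 := hlb n p.2 hp.2
      rw [abs_mul, abs_of_nonneg (hκ01 n p.1).1, abs_mul]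
      calc _ ≤ 1 * (|deriv (l n) p.2| * (2 * M / a * (p.2 * (a - p.2)))) := by
            gcongr; exact (hκ01 n p.1).2
        _ = |deriv (l n) p.2| * (p.2 * (a - p.2)) * (2 * M / a) := by ring
        _ ≤ _ := by gcongr) (fun p hp => by
      simpa using (hκ1 p.1 hp.1).mul ((hld p.2 hp.2).mul_const (ψ p)))
  have hx := limit G (1, 0) (C₁ * (2 * M / h)) _ (by simp [Prod.norm_def]) hG hdx (fun n p hp => by
      have h1 := hψx p hp
      have h2 := hκb n p.1 hp.1
      rw [abs_mul, abs_of_nonneg (hl01 n p.2).1, abs_mul]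
      calc _ ≤ 1 * (|deriv (κ n) p.1| * (2 * M / h * (p.1 * (h - p.1)))) := by
            gcongr; exact (hl01 n p.2).2
        _ = |deriv (κ n) p.1| * (p.1 * (h - p.1)) * (2 * M / h) := by ring
        _ ≤ _ := by gcongr) (fun p hp => by
      simpa using (hl1 p.2 hp.2).mul ((hκd p.1 hp.1).mul_const (ψ p)))
  refine tendsto_nhds_unique hy (hx.congr fun n => ?_)
  exact (hc (Ψ n) (hsm n) (hcs n) ((hts n).trans (hbox n))).symm

/-! ### Diagonal affine changes of variables -/

/-- The map `(x, y) ↦ (σ x + τ, t y + s)`. -/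
def diagAffine (σ τ t s : ℝ) (p : ℝ × ℝ) : ℝ × ℝ := (σ * p.1 + τ, t * p.2 + s)

theorem measurableSet_rect (h a : ℝ) : MeasurableSet (rect h a) :=
  measurableSet_Ioo.prod measurableSet_Ioo

theorem contDiff_diagAffine (σ τ t s : ℝ) : ContDiff ℝ ∞ (diagAffine σ τ t s) := by
  unfold diagAffine; fun_prop

theorem hasFDerivAt_diagAffine (σ τ t s : ℝ) (p : ℝ × ℝ) :
    HasFDerivAt (diagAffine σ τ t s)
      ((σ • ContinuousLinearMap.fst ℝ ℝ ℝ).prod (t • ContinuousLinearMap.snd ℝ ℝ ℝ)) p :=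
  ((hasFDerivAt_fst.const_mul σ).add_const τ).prodMk ((hasFDerivAt_snd.const_mul t).add_const s)

theorem pdx_comp_diagAffine {f : ℝ × ℝ → ℝ} {σ τ t s : ℝ} {p : ℝ × ℝ}
    (hf : DifferentiableAt ℝ f (diagAffine σ τ t s p)) :
    pdx (fun q => f (diagAffine σ τ t s q)) p = σ * pdx f (diagAffine σ τ t s p) := by
  have := (hf.hasFDerivAt.comp p (hasFDerivAt_diagAffine σ τ t s p)).fderiv
  simp only [pdx]
  rw [show (fun q => f (diagAffine σ τ t s q)) = f ∘ diagAffine σ τ t s from rfl, this]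
  have e : ((σ • ContinuousLinearMap.fst ℝ ℝ ℝ).prod (t • ContinuousLinearMap.snd ℝ ℝ ℝ)) (1, 0) =
      σ • ((1, 0) : ℝ × ℝ) := by simp
  rw [ContinuousLinearMap.comp_apply, e, map_smul, smul_eq_mul]

theorem pdy_comp_diagAffine {f : ℝ × ℝ → ℝ} {σ τ t s : ℝ} {p : ℝ × ℝ}
    (hf : DifferentiableAt ℝ f (diagAffine σ τ t s p)) :
    pdy (fun q => f (diagAffine σ τ t s q)) p = t * pdy f (diagAffine σ τ t s p) := by
  have := (hf.hasFDerivAt.comp p (hasFDerivAt_diagAffine σ τ t s p)).fderiv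
  simp only [pdy]
  rw [show (fun q => f (diagAffine σ τ t s q)) = f ∘ diagAffine σ τ t s from rfl, this]
  have e : ((σ • ContinuousLinearMap.fst ℝ ℝ ℝ).prod (t • ContinuousLinearMap.snd ℝ ℝ ℝ)) (0, 1) =
      t • ((0, 1) : ℝ × ℝ) := by simp
  rw [ContinuousLinearMap.comp_apply, e, map_smul, smul_eq_mul]

theorem diagAffine_inv_left {σ t : ℝ} (hσ : σ ≠ 0) (ht : t ≠ 0) (τ s : ℝ) (p : ℝ × ℝ) :
    diagAffine σ⁻¹ (-σ⁻¹ * τ) t⁻¹ (-t⁻¹ * s) (diagAffine σ τ t s p) = p := by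
  ext <;> simp [diagAffine] <;> field_simp <;> ring

theorem diagAffine_inv_right {σ t : ℝ} (hσ : σ ≠ 0) (ht : t ≠ 0) (τ s : ℝ) (p : ℝ × ℝ) :
    diagAffine σ τ t s (diagAffine σ⁻¹ (-σ⁻¹ * τ) t⁻¹ (-t⁻¹ * s) p) = p := by
  ext <;> simp [diagAffine] <;> field_simp <;> ring

/-- `diagAffine` as a homeomorphism of the plane. -/
noncomputable def diagAffineHomeomorph {σ t : ℝ} (hσ : σ ≠ 0) (ht : t ≠ 0) (τ s : ℝ) : (ℝ × ℝ) ≃ₜ (ℝ × ℝ) where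
  toFun := diagAffine σ τ t s
  invFun := diagAffine σ⁻¹ (-σ⁻¹ * τ) t⁻¹ (-t⁻¹ * s)
  left_inv := diagAffine_inv_left hσ ht τ s
  right_inv := diagAffine_inv_right hσ ht τ s
  continuous_toFun := (contDiff_diagAffine σ τ t s).continuous
  continuous_invFun := (contDiff_diagAffine _ _ _ _).continuous

theorem measurableEmbedding_diagAffine {σ t : ℝ} (hσ : σ ≠ 0) (ht : t ≠ 0) (τ s : ℝ) :
    MeasurableEmbedding (diagAffine σ τ t s) :=
  (diagAffineHomeomorph hσ ht τ s).measurableEmbedding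

theorem map_volume_affine {σ : ℝ} (hσ : σ ≠ 0) (τ : ℝ) :
    Measure.map (fun x : ℝ => σ * x + τ) volume = ENNReal.ofReal |σ⁻¹| • volume := by
  have : (fun x : ℝ => σ * x + τ) = (fun x => x + τ) ∘ (fun x => σ * x) := rfl
  rw [this, ← Measure.map_map (by fun_prop) (by fun_prop), Real.map_volume_mul_left hσ,
    Measure.map_smul, map_add_right_eq_self]

theorem map_volume_diagAffine {σ t : ℝ} (hσ : σ ≠ 0) (ht : t ≠ 0) (τ s : ℝ) :
    Measure.map (diagAffine σ τ t s) volume = ENNReal.ofReal |(σ * t)⁻¹| • volume := by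
  have : diagAffine σ τ t s = Prod.map (fun x => σ * x + τ) (fun y => t * y + s) := rfl
  rw [this, Measure.volume_eq_prod, ← Measure.map_prod_map _ _ (by fun_prop) (by fun_prop),
    map_volume_affine hσ, map_volume_affine ht, Measure.prod_smul_left, Measure.prod_smul_right,
    smul_smul, ← ENNReal.ofReal_mul (abs_nonneg _), ← abs_mul, mul_inv]

theorem setIntegral_comp_diagAffine {σ t : ℝ} (hσ : σ ≠ 0) (ht : t ≠ 0) (τ s : ℝ)
    (f : ℝ × ℝ → ℝ) (S : Set (ℝ × ℝ)) :
    ∫ p in diagAffine σ τ t s ⁻¹' S, f (diagAffine σ τ t s p) = |(σ * t)⁻¹| * ∫ p in S, f p := by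
  rw [← (measurableEmbedding_diagAffine hσ ht τ s).setIntegral_map, map_volume_diagAffine hσ ht,
    Measure.restrict_smul, integral_smul_measure, ENNReal.toReal_ofReal (abs_nonneg _), smul_eq_mul]

theorem integral_comp_diagAffine {σ t : ℝ} (hσ : σ ≠ 0) (ht : t ≠ 0) (τ s : ℝ)
    (f : ℝ × ℝ → ℝ) :
    ∫ p, f (diagAffine σ τ t s p) = |(σ * t)⁻¹| * ∫ p, f p := by
  simpa using setIntegral_comp_diagAffine hσ ht τ s f univ

theorem memLp_comp_diagAffine {σ t : ℝ} (hσ : σ ≠ 0) (ht : t ≠ 0) (τ s : ℝ) {q : ENNReal}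
    {f : ℝ × ℝ → ℝ} {S Q : Set (ℝ × ℝ)}
    (hf : MemLp f q (volume.restrict S)) (hQ : MapsTo (diagAffine σ τ t s) Q S) :
    MemLp (fun p => f (diagAffine σ τ t s p)) q (volume.restrict Q) := by
  have he := measurableEmbedding_diagAffine hσ ht τ s
  have h1 : MemLp f q ((Measure.map (diagAffine σ τ t s) volume).restrict S) := by
    rw [map_volume_diagAffine hσ ht, Measure.restrict_smul]
    exact hf.smul_measure ENNReal.ofReal_ne_top
  rw [he.restrict_map, he.memLp_map_measure_iff] at h1
  exact h1.mono_measure (Measure.restrict_mono hQ le_rfl)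

theorem integrableOn_comp_diagAffine {σ t : ℝ} (hσ : σ ≠ 0) (ht : t ≠ 0) (τ s : ℝ)
    {f : ℝ × ℝ → ℝ} {S Q : Set (ℝ × ℝ)}
    (hf : IntegrableOn f S) (hQ : MapsTo (diagAffine σ τ t s) Q S) :
    IntegrableOn (fun p => f (diagAffine σ τ t s p)) Q :=
  memLp_one_iff_integrable.1
    (memLp_comp_diagAffine hσ ht τ s (memLp_one_iff_integrable.2 hf) hQ)

theorem setIntegral_comp_diagAffine_le {σ t : ℝ} (hσ : σ ≠ 0) (ht : t ≠ 0) (τ s : ℝ)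
    {f : ℝ × ℝ → ℝ} {S Q : Set (ℝ × ℝ)} (hS : MeasurableSet S)
    (hf : IntegrableOn f S) (hf0 : ∀ p ∈ S, 0 ≤ f p) (hQ : MapsTo (diagAffine σ τ t s) Q S) :
    ∫ p in Q, f (diagAffine σ τ t s p) ≤ |(σ * t)⁻¹| * ∫ p in S, f p := by
  rw [← setIntegral_comp_diagAffine hσ ht τ s f S]
  have hm : MeasurableSet (diagAffine σ τ t s ⁻¹' S) :=
    (contDiff_diagAffine σ τ t s).continuous.measurable hS
  refine setIntegral_mono_set (integrableOn_comp_diagAffine hσ ht τ s hf fun _ h => h) ?_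
    (Eventually.of_forall hQ)
  exact (ae_restrict_iff' hm).2 (Eventually.of_forall fun p hp => hf0 _ hp)

theorem setIntegral_mul_of_tsupport_subset {Ω : Set (ℝ × ℝ)} (F ψ : ℝ × ℝ → ℝ) (e : ℝ × ℝ)
    (hs : tsupport ψ ⊆ Ω) : ∫ p in Ω, F p * fderiv ℝ ψ p e = ∫ p, F p * fderiv ℝ ψ p e := by
  refine setIntegral_eq_integral_of_forall_compl_eq_zero fun p hp => ?_
  have : p ∉ tsupport (fun p => fderiv ℝ ψ p e) := fun h' =>
    hp (hs (tsupport_fderiv_apply_subset ℝ e h'))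
  have h0 : fderiv ℝ ψ p e = 0 := by
    by_contra hne
    exact this (subset_tsupport (fun p => fderiv ℝ ψ p e) hne)
  rw [h0, mul_zero]

/-- Diagonal affine changes of variables preserve curl free fields. -/
theorem CurlFree.comp_diagAffine {Ω Ω' : Set (ℝ × ℝ)} {F G : ℝ × ℝ → ℝ} (hc : CurlFree Ω F G)
    {σ t : ℝ} (hσ : σ ≠ 0) (ht : t ≠ 0) (τ s : ℝ) (hΩ : MapsTo (diagAffine σ τ t s) Ω' Ω) :
    CurlFree Ω' (fun p => t * F (diagAffine σ τ t s p))
      (fun p => t ^ 2 / σ * G (diagAffine σ τ t s p)) := by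
  -- If `(F, G)` is the gradient of `v`, the new field is formally the gradient of `(t / σ) v ∘ Φ`.
  -- This normalisation makes the shear of the pair with first component `u ∘ Φ` equal to `t` times
  -- the old shear composed with `Φ`.
  intro ψ hψ hcs hsub
  set Φ := diagAffine σ τ t s with hΦ
  set Θ := diagAffine σ⁻¹ (-σ⁻¹ * τ) t⁻¹ (-t⁻¹ * s) with hΘ
  have hΘΦ : ∀ p, Θ (Φ p) = p := diagAffine_inv_left hσ ht τ s
  have hχ : ContDiff ℝ ∞ (fun p => ψ (Θ p)) := hψ.comp (contDiff_diagAffine _ _ _ _)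
  have hts : tsupport (fun p => ψ (Θ p)) ⊆ Θ ⁻¹' tsupport ψ := by
    refine closure_minimal (fun p hp => subset_tsupport _ hp) ?_
    exact (isClosed_tsupport ψ).preimage (contDiff_diagAffine _ _ _ _).continuous
  have hcs' : HasCompactSupport (fun p => ψ (Θ p)) :=
    hcs.comp_homeomorph (diagAffineHomeomorph hσ ht τ s).symm
  have hsub' : tsupport (fun p => ψ (Θ p)) ⊆ Ω := by
    intro p hp
    have := hΩ (hsub (hts hp))
    rwa [show Φ (Θ p) = p from diagAffine_inv_right hσ ht τ s p] at this
  have key := hc _ hχ hcs' hsub'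
  simp only [pdx, pdy] at key ⊢
  rw [setIntegral_mul_of_tsupport_subset _ _ _ hsub',
    setIntegral_mul_of_tsupport_subset _ _ _ hsub'] at key
  rw [setIntegral_mul_of_tsupport_subset _ _ _ hsub, setIntegral_mul_of_tsupport_subset _ _ _ hsub]
  have hy : ∀ p, fderiv ℝ ψ p (0, 1) = t * fderiv ℝ (fun p => ψ (Θ p)) (Φ p) (0, 1) := by
    intro p
    have := pdy_comp_diagAffine (p := p) (σ := σ) (τ := τ) (t := t) (s := s)
      ((hχ.differentiable (by simp)) (Φ p))
    simp only [pdy, ← hΦ, hΘΦ] at this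
    exact this
  have hx : ∀ p, fderiv ℝ ψ p (1, 0) = σ * fderiv ℝ (fun p => ψ (Θ p)) (Φ p) (1, 0) := by
    intro p
    have := pdx_comp_diagAffine (p := p) (σ := σ) (τ := τ) (t := t) (s := s)
      ((hχ.differentiable (by simp)) (Φ p))
    simp only [pdx, ← hΦ, hΘΦ] at this
    exact this
  have e1 : ∀ p, t * F (Φ p) * fderiv ℝ ψ p (0, 1) =
      t ^ 2 * (F (Φ p) * fderiv ℝ (fun p => ψ (Θ p)) (Φ p) (0, 1)) := by
    intro p; rw [hy]; ring
  have e2 : ∀ p, t ^ 2 / σ * G (Φ p) * fderiv ℝ ψ p (1, 0) =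
      t ^ 2 * (G (Φ p) * fderiv ℝ (fun p => ψ (Θ p)) (Φ p) (1, 0)) := by
    intro p; rw [hx]; field_simp
  simp only [e1, e2]
  rw [integral_const_mul, integral_const_mul,
    integral_comp_diagAffine hσ ht τ s (fun q => F q * fderiv ℝ (fun p => ψ (Θ p)) q (0, 1)),
    integral_comp_diagAffine hσ ht τ s (fun q => G q * fderiv ℝ (fun p => ψ (Θ p)) q (1, 0)), key]

theorem integrableOn_mul_fderiv {Ω : Set (ℝ × ℝ)} {F ψ : ℝ × ℝ → ℝ} (hF : IntegrableOn F Ω)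
    (hψ : ContDiff ℝ ∞ ψ) (hcs : HasCompactSupport ψ) (e : ℝ × ℝ) :
    IntegrableOn (fun p => F p * fderiv ℝ ψ p e) Ω := by
  have hc := (contDiff_fderiv_apply hψ e).continuous
  have hk : HasCompactSupport (fun p => fderiv ℝ ψ p e) :=
    hcs.of_isClosed_subset (isClosed_tsupport _) (tsupport_fderiv_apply_subset ℝ e)
  obtain ⟨C, hC⟩ := hk.exists_bound_of_continuous hc
  exact Integrable.mul_bdd hF hc.aestronglyMeasurable (Eventually.of_forall hC)

theorem CurlFree.sum {Ω : Set (ℝ × ℝ)} {ι : Type*} (I : Finset ι) {F G : ι → ℝ × ℝ → ℝ} (μ : ι → ℝ)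
    (hF : ∀ i ∈ I, IntegrableOn (F i) Ω) (hG : ∀ i ∈ I, IntegrableOn (G i) Ω)
    (hc : ∀ i ∈ I, CurlFree Ω (F i) (G i)) :
    CurlFree Ω (fun p => ∑ i ∈ I, μ i * F i p) (fun p => ∑ i ∈ I, μ i * G i p) := by
  intro ψ hψ hcs hsub
  simp only [Finset.sum_mul, mul_assoc]
  rw [integral_finsetSum I fun i hi => (integrableOn_mul_fderiv (hF i hi) hψ hcs _).const_mul _,
    integral_finsetSum I fun i hi => (integrableOn_mul_fderiv (hG i hi) hψ hcs _).const_mul _]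
  refine Finset.sum_congr rfl fun i hi => ?_
  rw [integral_const_mul, integral_const_mul, hc i hi ψ hψ hcs hsub]

/-! ### Concave weights and integration on rectangles -/

/-- A nonnegative concave weight on `[0, a]` with derivatives `V₁`, `V₂`, whose logarithmic
derivative is controlled by its concavity. -/
structure ConcaveWeight (a K : ℝ) (V V₁ V₂ : ℝ → ℝ) : Prop where
  smooth : ∀ y ∈ Icc 0 a, ContDiffAt ℝ ∞ V y
  hasDerivAt : ∀ y ∈ Icc 0 a, HasDerivAt V (V₁ y) y
  hasDerivAt₁ : ∀ y ∈ Icc 0 a, HasDerivAt V₁ (V₂ y) y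
  continuousOn₂ : ContinuousOn V₂ (Icc 0 a)
  nonneg : ∀ y ∈ Icc 0 a, 0 ≤ V y
  nonpos₂ : ∀ y ∈ Icc 0 a, V₂ y ≤ 0
  sq_le : ∀ y ∈ Icc 0 a, V₁ y ^ 2 ≤ K * V y * (-V₂ y)

theorem ConcaveWeight.continuousOn {a K : ℝ} {V V₁ V₂ : ℝ → ℝ} (hV : ConcaveWeight a K V V₁ V₂) :
    ContinuousOn V (Icc 0 a) := fun y hy => (hV.smooth y hy).continuousAt.continuousWithinAt

theorem ConcaveWeight.continuousOn₁ {a K : ℝ} {V V₁ V₂ : ℝ → ℝ} (hV : ConcaveWeight a K V V₁ V₂) :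
    ContinuousOn V₁ (Icc 0 a) := fun y hy => (hV.hasDerivAt₁ y hy).continuousAt.continuousWithinAt

theorem rect_subset_Icc (h a : ℝ) : rect h a ⊆ Icc 0 h ×ˢ Icc 0 a :=
  prod_mono Ioo_subset_Icc_self Ioo_subset_Icc_self

theorem rect_mono {h h' a : ℝ} (hh : h ≤ h') : rect h a ⊆ rect h' a :=
  prod_mono (Ioo_subset_Ioo_right hh) subset_rfl

instance isFiniteMeasure_restrict_rect (h a : ℝ) : IsFiniteMeasure (volume.restrict (rect h a)) := by
  constructor
  rw [Measure.restrict_apply_univ]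
  exact (measure_mono (rect_subset_Icc h a)).trans_lt
    (isCompact_Icc.prod isCompact_Icc).measure_lt_top

theorem aestronglyMeasurable_rect {h a : ℝ} {g : ℝ × ℝ → ℝ}
    (hg : ContinuousOn g (Icc 0 h ×ˢ Icc 0 a)) :
    AEStronglyMeasurable g (volume.restrict (rect h a)) :=
  (hg.mono (rect_subset_Icc h a)).aestronglyMeasurable (measurableSet_rect h a)

theorem exists_ae_bound_rect {h a : ℝ} {g : ℝ × ℝ → ℝ}
    (hg : ContinuousOn g (Icc 0 h ×ˢ Icc 0 a)) :
    ∃ C : ℝ, ∀ᵐ p ∂(volume.restrict (rect h a)), ‖g p‖ ≤ C := by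
  obtain ⟨C, hC⟩ := (isCompact_Icc.prod isCompact_Icc).exists_bound_of_continuousOn hg
  exact ⟨C, (ae_restrict_iff' (measurableSet_rect h a)).2
    (Eventually.of_forall fun p hp => hC p (rect_subset_Icc h a hp))⟩

theorem integrableOn_rect_continuousOn_mul {h a : ℝ} {f g : ℝ × ℝ → ℝ}
    (hg : ContinuousOn g (Icc 0 h ×ˢ Icc 0 a)) (hf : IntegrableOn f (rect h a)) :
    IntegrableOn (fun p => g p * f p) (rect h a) := by
  obtain ⟨C, hC⟩ := exists_ae_bound_rect hg
  exact Integrable.bdd_mul hf (aestronglyMeasurable_rect hg) hC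

theorem memLp_rect_of_continuousOn {h a : ℝ} {q : ENNReal} {g : ℝ × ℝ → ℝ}
    (hg : ContinuousOn g (Icc 0 h ×ˢ Icc 0 a)) : MemLp g q (volume.restrict (rect h a)) := by
  obtain ⟨C, hC⟩ := exists_ae_bound_rect hg
  exact MemLp.of_bound (aestronglyMeasurable_rect hg) C hC

theorem integrableOn_rect_of_continuousOn {h a : ℝ} {g : ℝ × ℝ → ℝ}
    (hg : ContinuousOn g (Icc 0 h ×ˢ Icc 0 a)) : IntegrableOn g (rect h a) :=
  memLp_one_iff_integrable.1 (memLp_rect_of_continuousOn hg)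

theorem memLp_rect_continuousOn_mul {h a : ℝ} {f g : ℝ × ℝ → ℝ}
    (hg : ContinuousOn g (Icc 0 h ×ˢ Icc 0 a)) (hf : MemLp f 2 (volume.restrict (rect h a))) :
    MemLp (fun p => g p * f p) 2 (volume.restrict (rect h a)) := by
  obtain ⟨C, hC⟩ := exists_ae_bound_rect hg
  refine MemLp.of_le_mul (c := C) hf ((aestronglyMeasurable_rect hg).mul hf.1) ?_
  filter_upwards [hC] with p hp
  rw [norm_mul]; gcongr

theorem continuousOn_comp_snd {h a : ℝ} {V : ℝ → ℝ} (hV : ContinuousOn V (Icc 0 a)) :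
    ContinuousOn (fun p : ℝ × ℝ => V p.2) (Icc 0 h ×ˢ Icc 0 a) :=
  hV.comp continuousOn_snd fun _ hp => hp.2

theorem integral_mul_le_sqrt_mul_sqrt {α : Type*} [MeasurableSpace α] {μ : Measure α} {f g : α → ℝ}
    (hf : MemLp f 2 μ) (hg : MemLp g 2 μ) :
    ∫ x, |f x| * |g x| ∂μ ≤ √(∫ x, f x ^ 2 ∂μ) * √(∫ x, g x ^ 2 ∂μ) := by
  have h2 : ENNReal.ofReal 2 = 2 := by norm_num
  have := integral_mul_le_Lp_mul_Lq_of_nonneg (μ := μ) Real.HolderConjugate.two_two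
    (Eventually.of_forall fun x => abs_nonneg (f x))
    (Eventually.of_forall fun x => abs_nonneg (g x)) (by rw [h2]; exact hf.abs)
    (by rw [h2]; exact hg.abs)
  simpa [Real.sqrt_eq_rpow] using this

/-- Weighted Cauchy–Schwarz inequality on a rectangle. -/
theorem integral_weight_mul_le {h a : ℝ} {V : ℝ → ℝ} (hV : ContinuousOn V (Icc 0 a))
    (hV0 : ∀ y ∈ Icc 0 a, 0 ≤ V y) {f g : ℝ × ℝ → ℝ}
    (hf : MemLp f 2 (volume.restrict (rect h a))) (hg : MemLp g 2 (volume.restrict (rect h a))) :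
    ∫ p in rect h a, V p.2 * (|f p| * |g p|) ≤
      √(∫ p in rect h a, V p.2 * f p ^ 2) * √(∫ p in rect h a, V p.2 * g p ^ 2) := by
  have hs : ContinuousOn (fun p : ℝ × ℝ => √(V p.2)) (Icc 0 h ×ˢ Icc 0 a) :=
    (continuousOn_comp_snd hV).sqrt
  have := integral_mul_le_sqrt_mul_sqrt (memLp_rect_continuousOn_mul hs hf)
    (memLp_rect_continuousOn_mul hs hg)
  have hp0 : ∀ p ∈ rect h a, 0 ≤ V p.2 := fun p hp => hV0 _ (rect_subset_Icc h a hp).2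
  have e1 : ∫ p in rect h a, |√(V p.2) * f p| * |√(V p.2) * g p| =
      ∫ p in rect h a, V p.2 * (|f p| * |g p|) := by
    refine setIntegral_congr_fun (measurableSet_rect h a) fun p hp => ?_
    simp only [abs_mul, abs_of_nonneg (Real.sqrt_nonneg _)]
    nth_rewrite 3 [← Real.mul_self_sqrt (hp0 p hp)]
    ring
  have e2 : ∀ f : ℝ × ℝ → ℝ, ∫ p in rect h a, (√(V p.2) * f p) ^ 2 =
      ∫ p in rect h a, V p.2 * f p ^ 2 := by
    intro f
    refine setIntegral_congr_fun (measurableSet_rect h a) fun p hp => ?_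
    simp only [mul_pow, Real.sq_sqrt (hp0 p hp)]
  rwa [e1, e2, e2] at this

theorem hasDerivAt_slice_snd {f : ℝ × ℝ → ℝ} {x y : ℝ} (hf : DifferentiableAt ℝ f (x, y)) :
    HasDerivAt (fun y => f (x, y)) (pdy f (x, y)) y := by
  have h1 : HasDerivAt (fun y : ℝ => (x, y)) ((0, 1) : ℝ × ℝ) y :=
    (hasDerivAt_const y x).prodMk (hasDerivAt_id y)
  exact hf.hasFDerivAt.comp_hasDerivAt y h1

/-- Fubini and the fundamental theorem of calculus on each vertical slice. Only equal to zero at the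
two ends is needed, so no regularity in `x` is asked of `g`. -/
theorem setIntegral_rect_deriv_eq_zero {L a : ℝ} (ha : 0 < a) {g g' : ℝ × ℝ → ℝ}
    (hd : ∀ x ∈ Ioo 0 L, ∀ y ∈ Icc 0 a, HasDerivAt (fun y => g (x, y)) (g' (x, y)) y)
    (hc : ContinuousOn g' (Icc 0 L ×ˢ Icc 0 a))
    (h0 : ∀ x ∈ Ioo 0 L, g (x, 0) = 0) (h1 : ∀ x ∈ Ioo 0 L, g (x, a) = 0) :
    ∫ p in rect L a, g' p = 0 := by
  have hi := integrableOn_rect_of_continuousOn hc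
  unfold rect at hi ⊢
  rw [Measure.volume_eq_prod] at hi ⊢
  rw [setIntegral_prod _ hi]
  refine setIntegral_eq_zero_of_forall_eq_zero fun x hx => ?_
  have hcx : ContinuousOn (fun y => g' (x, y)) (Icc 0 a) :=
    hc.comp (by fun_prop) fun y hy => ⟨Ioo_subset_Icc_self hx, hy⟩
  rw [← integral_Ioc_eq_integral_Ioo, ← intervalIntegral.integral_of_le ha.le,
    intervalIntegral.integral_eq_sub_of_hasDerivAt (f := fun y => g (x, y)), h0 x hx, h1 x hx,
    sub_zero]
  · intro y hy
    rw [uIcc_of_le ha.le] at hy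
    exact hd x hx y hy
  · apply ContinuousOn.intervalIntegrable
    rwa [uIcc_of_le ha.le]

theorem setIntegral_union_le {S T : Set (ℝ × ℝ)} {f : ℝ × ℝ → ℝ} (hS : MeasurableSet S)
    (hT : MeasurableSet T) (hfS : IntegrableOn f S) (hfT : IntegrableOn f T)
    (h0 : ∀ p ∈ T, 0 ≤ f p) : ∫ p in S ∪ T, f p ≤ (∫ p in S, f p) + ∫ p in T, f p := by
  rw [← union_sdiff_self, setIntegral_union disjoint_sdiff_right (hT.diff hS) hfS
    (hfT.mono_set sdiff_subset)]
  refine add_le_add le_rfl ?_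
  refine setIntegral_mono_set hfT ?_ (Eventually.of_forall fun p hp => hp.1)
  exact (ae_restrict_iff' hT).2 (Eventually.of_forall h0)

theorem setIntegral_mono_subset {S T : Set (ℝ × ℝ)} {f : ℝ × ℝ → ℝ} (hST : S ⊆ T)
    (hT : MeasurableSet T) (hf : IntegrableOn f T) (h0 : ∀ p ∈ T, 0 ≤ f p) :
    ∫ p in S, f p ≤ ∫ p in T, f p :=
  setIntegral_mono_set hf ((ae_restrict_iff' hT).2 (Eventually.of_forall h0))
    (Eventually.of_forall hST)

theorem continuousOn_pdx_pdy {S : Set (ℝ × ℝ)} {ψ : ℝ × ℝ → ℝ} (hψ : ∀ p ∈ S, ContDiffAt ℝ ∞ ψ p)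
    (e : ℝ × ℝ) : ContinuousOn (fun p => fderiv ℝ ψ p e) S := fun p hp =>
  (((hψ p hp).fderiv_right (m := 0) (by simp)).continuousAt.clm_apply
    continuousAt_const).continuousWithinAt

/-! ### The doubling identity and the energy inequality -/

/-- Testing a curl free field with `ψ(x, y) - ψ(x / 2, y)`, where `ψ` need not vanish on the side
`x = 0`. -/
theorem CurlFree.integral_doubling_eq {h a c : ℝ} (hh : 0 < h) (ha : 0 < a) (hch : c < h / 2)
    {F G ψ : ℝ × ℝ → ℝ} (hc : CurlFree (rect h a) F G)
    (hF : IntegrableOn F (rect h a)) (hG : IntegrableOn G (rect h a))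
    (hψ : ∀ p ∈ Icc 0 h ×ˢ Icc 0 a, ContDiffAt ℝ ∞ ψ p)
    (hright : ∀ p : ℝ × ℝ, c ≤ p.1 → ψ p = 0)
    (hbot : ∀ x, ψ (x, 0) = 0) (htop : ∀ x, ψ (x, a) = 0) :
    ∫ p in rect (h / 2) a, (F p - 2 * F (diagAffine 2 0 1 0 p)) * pdy ψ p =
      ∫ p in rect (h / 2) a, (G p - G (diagAffine 2 0 1 0 p)) * pdx ψ p := by
  set dbl := diagAffine 2 0 1 0 with hdbl
  set hlf := diagAffine (1 / 2) 0 1 0 with hhlf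
  have hdh : ∀ p, hlf (dbl p) = p := by
    intro p; ext <;> simp [hdbl, hhlf, diagAffine]
  have hmap : ∀ p ∈ Icc 0 h ×ˢ Icc 0 a, hlf p ∈ Icc 0 h ×ˢ Icc 0 a := by
    intro p hp
    have h1 := hp.1.1
    have h2 := hp.1.2
    simp only [hhlf, diagAffine, mem_prod, mem_Icc, one_mul, add_zero]
    exact ⟨⟨by linarith, by linarith⟩, hp.2⟩
  have hψ' : ∀ p ∈ Icc 0 h ×ˢ Icc 0 a, ContDiffAt ℝ ∞ (fun q => ψ (hlf q)) p := fun p hp =>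
    (hψ _ (hmap p hp)).comp p (contDiff_diagAffine _ _ _ _).contDiffAt
  -- At `x = 0` the function and its dilation cancel. At `x = h` both vanish, because `c < h / 2`
  -- puts even `h / 2` beyond the support.
  have key := hc.integral_eq_of_boundary_zero hh ha hF hG (ψ := fun p => ψ p - ψ (hlf p))
    (fun p hp => (hψ p hp).sub (hψ' p hp)) (fun y hy => by simp [hhlf, diagAffine])
    (fun y hy => by
      rw [hright (h, y) (by simp only; linarith), hright _ (by simp [hhlf, diagAffine]; linarith)]
      simp)
    (fun x hx => by simp [hhlf, diagAffine, hbot]) (fun x hx => by simp [hhlf, diagAffine, htop])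
  have hsub := rect_subset_Icc h a
  have hpre : dbl ⁻¹' rect h a = rect (h / 2) a := by
    ext p
    simp only [hdbl, diagAffine, rect, mem_preimage, mem_prod, mem_Ioo, one_mul, add_zero]
    constructor
    · rintro ⟨⟨h1, h2⟩, h3⟩; exact ⟨⟨by linarith, by linarith⟩, h3⟩
    · rintro ⟨⟨h1, h2⟩, h3⟩; exact ⟨⟨by linarith, by linarith⟩, h3⟩
  have hle : rect (h / 2) a ⊆ rect h a := rect_mono (by linarith)
  have hvan : ∀ e : ℝ × ℝ, ∀ p ∈ rect h a \ rect (h / 2) a, fderiv ℝ ψ p e = 0 := by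
    intro e p hp
    have h1 : c < p.1 := by
      by_contra hcon
      exact hp.2 ⟨⟨hp.1.1.1, by linarith [not_lt.1 hcon]⟩, hp.1.2⟩
    have : ψ =ᶠ[𝓝 p] fun _ => 0 := by
      filter_upwards [(isOpen_lt continuous_const continuous_fst).mem_nhds h1] with q hq
      exact hright q (le_of_lt hq)
    rw [this.fderiv_eq]; simp
  -- The substitution `x ↦ 2x` in the dilated part contributes a Jacobian `2`, and the chain rule a
  -- factor `r`, which is `1` for the vertical and `1 / 2` for the horizontal derivative. This is
  -- why `F` acquires the coefficient `2` and `G` the coefficient `1`.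
  have main : ∀ (H : ℝ × ℝ → ℝ) (e : ℝ × ℝ) (r : ℝ), IntegrableOn H (rect h a) →
      (∀ p ∈ rect h a, fderiv ℝ (fun q => ψ (hlf q)) p e = r * fderiv ℝ ψ (hlf p) e) →
      ∫ p in rect h a, H p * fderiv ℝ (fun p => ψ p - ψ (hlf p)) p e =
        ∫ p in rect (h / 2) a, (H p - 2 * r * H (dbl p)) * fderiv ℝ ψ p e := by
    intro H e r hH hr
    have i1 : IntegrableOn (fun p => H p * fderiv ℝ ψ p e) (rect h a) := by
      simpa only [mul_comm] using
        integrableOn_rect_continuousOn_mul (continuousOn_pdx_pdy hψ e) hH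
    have i2 : IntegrableOn (fun p => H p * fderiv ℝ (fun q => ψ (hlf q)) p e) (rect h a) := by
      simpa only [mul_comm] using
        integrableOn_rect_continuousOn_mul (continuousOn_pdx_pdy hψ' e) hH
    have e1 : ∫ p in rect h a, H p * fderiv ℝ (fun p => ψ p - ψ (hlf p)) p e =
        ∫ p in rect h a, (H p * fderiv ℝ ψ p e - H p * fderiv ℝ (fun q => ψ (hlf q)) p e) := by
      refine setIntegral_congr_fun (measurableSet_rect h a) fun p hp => ?_
      have := fderiv_fun_sub ((hψ p (hsub hp)).differentiableAt (by simp))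
        ((hψ' p (hsub hp)).differentiableAt (by simp))
      simp only [this, _root_.sub_apply]
      ring
    have e2 : ∫ p in rect h a, H p * fderiv ℝ ψ p e =
        ∫ p in rect (h / 2) a, H p * fderiv ℝ ψ p e :=
      setIntegral_eq_of_subset_of_forall_sdiff_eq_zero (measurableSet_rect h a) hle
        fun p hp => by rw [hvan e p hp, mul_zero]
    have e3 : ∫ p in rect h a, H p * fderiv ℝ (fun q => ψ (hlf q)) p e =
        ∫ p in rect (h / 2) a, 2 * r * H (dbl p) * fderiv ℝ ψ p e := by
      have := setIntegral_comp_diagAffine (σ := 2) (t := 1) (by norm_num) (by norm_num) 0 0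
        (fun p => H p * fderiv ℝ (fun q => ψ (hlf q)) p e) (rect h a)
      rw [← hdbl, hpre] at this
      have h2 : ∫ p in rect (h / 2) a, 2 * r * H (dbl p) * fderiv ℝ ψ p e =
          2 * ∫ p in rect (h / 2) a, H (dbl p) * fderiv ℝ (fun q => ψ (hlf q)) (dbl p) e := by
        rw [← integral_const_mul]
        refine setIntegral_congr_fun (measurableSet_rect _ a) fun p hp => ?_
        have hp' : dbl p ∈ rect h a := by rw [← hpre] at hp; exact hp
        simp only [hr _ hp', hdh]
        ring
      rw [h2, this]; norm_num; ring
    have i3 : IntegrableOn (fun p => 2 * r * H (dbl p) * fderiv ℝ ψ p e) (rect (h / 2) a) := by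
      have h1 : IntegrableOn (fun p => H (dbl p)) (rect (h / 2) a) :=
        integrableOn_comp_diagAffine (by norm_num) (by norm_num) 0 0 hH
          (fun p hp => by rw [← hpre] at hp; exact hp)
      have h2 := integrableOn_rect_continuousOn_mul
        ((continuousOn_pdx_pdy hψ e).mono (prod_mono (Icc_subset_Icc_right
          (by linarith : h / 2 ≤ h)) subset_rfl)) (h1.const_mul (2 * r))
      simpa only [mul_comm] using h2
    rw [e1, integral_sub i1 i2, e2, e3, ← integral_sub (i1.mono_set hle) i3]
    refine setIntegral_congr_fun (measurableSet_rect _ a) fun p hp => ?_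
    ring
  have hdiff : ∀ p ∈ rect h a, DifferentiableAt ℝ ψ (hlf p) := fun p hp =>
    (hψ _ (hmap p (hsub hp))).differentiableAt (by simp)
  have hy := main F (0, 1) 1 hF fun p hp => pdy_comp_diagAffine (hdiff p hp)
  have hx := main G (1, 0) (1 / 2) hG fun p hp => pdx_comp_diagAffine (hdiff p hp)
  simp only [pdx, pdy] at key ⊢
  rw [hy, hx] at key
  simpa using key

/-- With `f = D - Uy` the products `w₁ u Uy` cancel. The remaining term `w₁ u D` is absorbed by the
nonpositive `w₂ u²`, at the price of `K w D²`; everything else is Young's inequality with `0 ≤ μ ≤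
1`. -/
theorem energy_pointwise {K N μ m' w w₁ w₂ u Ux Uy f g : ℝ} (hK : 0 ≤ K) (m0 : 0 ≤ μ) (m1 : μ ≤ 1)
    (v0 : 0 ≤ w) (v2 : w₂ ≤ 0) (vs : w₁ ^ 2 ≤ K * w * (-w₂)) (hm' : |m'| ≤ N) :
    μ * (w * Uy ^ 2) + 2 * ((μ * (w₁ * u + w * Uy)) * f) - 2 * ((m' * w * u + μ * w * Ux) * g) +
      μ * (w₂ * u ^ 2 + w₁ * (2 * u * Uy)) ≤
      (K + 1) * (w * (Uy + f) ^ 2) + w * g ^ 2 + w * Ux ^ 2 + 2 * N * (w * (|g| * |u|)) := by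
  obtain ⟨D, rfl⟩ : ∃ D, f = D - Uy := ⟨Uy + f, by ring⟩
  rw [add_sub_cancel]
  have t1 : 2 * (w₁ * u * D) ≤ K * w * D ^ 2 + (-w₂) * u ^ 2 := by
    have h1 : (w₁ * u * D) ^ 2 ≤ (K * w * D ^ 2) * ((-w₂) * u ^ 2) := by
      have := mul_le_mul_of_nonneg_right vs (by positivity : 0 ≤ u ^ 2 * D ^ 2)
      calc _ = w₁ ^ 2 * (u ^ 2 * D ^ 2) := by ring
        _ ≤ _ := this
        _ = _ := by ring
    have hA : 0 ≤ K * w * D ^ 2 := by positivity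
    have hB : 0 ≤ (-w₂) * u ^ 2 := mul_nonneg (by linarith) (by positivity)
    exact (abs_le_of_sq_le_sq' (by nlinarith [sq_nonneg (K * w * D ^ 2 - (-w₂) * u ^ 2)])
      (by positivity)).2
  have t2 : -(m' * w * u * g) ≤ N * (w * (|g| * |u|)) := by
    have h1 : -(m' * w * u * g) ≤ |m'| * w * (|u| * |g|) := by
      have := neg_abs_le (m' * w * u * g)
      rw [abs_mul, abs_mul, abs_mul, abs_of_nonneg v0] at this
      nlinarith
    calc _ ≤ |m'| * w * (|u| * |g|) := h1
      _ ≤ N * w * (|u| * |g|) := by gcongr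
      _ = _ := by ring
  have t3 : 2 * (μ * w * D * Uy) ≤ μ * w * D ^ 2 + μ * w * Uy ^ 2 := by
    nlinarith [mul_nonneg (mul_nonneg m0 v0) (sq_nonneg (D - Uy))]
  have t4 : -(2 * (μ * w * Ux * g)) ≤ μ * w * Ux ^ 2 + μ * w * g ^ 2 := by
    nlinarith [mul_nonneg (mul_nonneg m0 v0) (sq_nonneg (Ux + g))]
  have s1 := mul_le_mul_of_nonneg_left t1 m0
  have l1 : ∀ z : ℝ, 0 ≤ z → μ * z ≤ z := fun z hz => mul_le_of_le_one_left hz m1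
  have q1 := l1 (w * D ^ 2) (by positivity)
  have q2 := l1 (w * Ux ^ 2) (by positivity)
  have q3 := l1 (w * g ^ 2) (by positivity)
  have q4 := l1 (K * w * D ^ 2) (by positivity)
  linarith

/-- The energy inequality behind the weighted Korn inequality: it combines the test function
`m V U` with the concavity of the weight `V`. -/
theorem energy_le {L a K N : ℝ} (ha : 0 < a) {V V₁ V₂ : ℝ → ℝ}
    (hV : ConcaveWeight a K V V₁ V₂) (hK : 0 ≤ K) {m : ℝ → ℝ} (hm : ContDiff ℝ ∞ m)
    (hm01 : ∀ x, 0 ≤ m x ∧ m x ≤ 1) (hmd : ∀ x, |deriv m x| ≤ N)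
    {U F G : ℝ × ℝ → ℝ} (hU : ContDiff ℝ ∞ U) (hbot : ∀ x, U (x, 0) = 0) (htop : ∀ x, U (x, a) = 0)
    (hF : MemLp F 2 (volume.restrict (rect L a))) (hG : MemLp G 2 (volume.restrict (rect L a)))
    (htest : ∫ p in rect L a, F p * pdy (fun p => m p.1 * V p.2 * U p) p =
      ∫ p in rect L a, G p * pdx (fun p => m p.1 * V p.2 * U p) p) :
    ∫ p in rect L a, m p.1 * (V p.2 * pdy U p ^ 2) ≤
      (K + 1) * (∫ p in rect L a, V p.2 * (pdy U p + F p) ^ 2) +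
        (∫ p in rect L a, V p.2 * G p ^ 2) + (∫ p in rect L a, V p.2 * pdx U p ^ 2) +
        2 * N * ∫ p in rect L a, V p.2 * (|G p| * |U p|) := by
  have hN : 0 ≤ N := (abs_nonneg _).trans (hmd 0)
  have hsub := rect_subset_Icc L a
  have cm : Continuous (fun p : ℝ × ℝ => m p.1) := hm.continuous.comp continuous_fst
  have cm' : Continuous (fun p : ℝ × ℝ => deriv m p.1) :=
    (hm.continuous_deriv (by simp)).comp continuous_fst
  have cU : Continuous U := hU.continuous
  have cUx : Continuous (pdx U) := (contDiff_fderiv_apply hU _).continuous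
  have cUy : Continuous (pdy U) := (contDiff_fderiv_apply hU _).continuous
  have cV : ContinuousOn (fun p : ℝ × ℝ => V p.2) (Icc 0 L ×ˢ Icc 0 a) :=
    continuousOn_comp_snd hV.continuousOn
  have cV₁ : ContinuousOn (fun p : ℝ × ℝ => V₁ p.2) (Icc 0 L ×ˢ Icc 0 a) :=
    continuousOn_comp_snd hV.continuousOn₁
  have cV₂ : ContinuousOn (fun p : ℝ × ℝ => V₂ p.2) (Icc 0 L ×ˢ Icc 0 a) :=
    continuousOn_comp_snd hV.continuousOn₂
  have hfd : ∀ p ∈ rect L a, HasFDerivAt (fun p : ℝ × ℝ => m p.1 * V p.2 * U p)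
      ((m p.1 * V p.2) • fderiv ℝ U p + U p • (m p.1 •
        (V₁ p.2 • ContinuousLinearMap.snd ℝ ℝ ℝ) + V p.2 •
          (deriv m p.1 • ContinuousLinearMap.fst ℝ ℝ ℝ))) p := by
    intro p hp
    have h1 : HasFDerivAt (fun p : ℝ × ℝ => m p.1)
        (deriv m p.1 • ContinuousLinearMap.fst ℝ ℝ ℝ) p :=
      ((hm.differentiable (by simp)) p.1).hasDerivAt.comp_hasFDerivAt p hasFDerivAt_fst
    have h2 : HasFDerivAt (fun p : ℝ × ℝ => V p.2)
        (V₁ p.2 • ContinuousLinearMap.snd ℝ ℝ ℝ) p :=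
      (hV.hasDerivAt p.2 (hsub hp).2).comp_hasFDerivAt p hasFDerivAt_snd
    exact (h1.mul h2).mul (hU.differentiable (by simp) p).hasFDerivAt
  have e1 : ∫ p in rect L a, F p * pdy (fun p => m p.1 * V p.2 * U p) p =
      ∫ p in rect L a, (m p.1 * (V₁ p.2 * U p + V p.2 * pdy U p)) * F p := by
    refine setIntegral_congr_fun (measurableSet_rect L a) fun p hp => ?_
    simp only [pdy, (hfd p hp).fderiv]
    simp; ring
  have e2 : ∫ p in rect L a, G p * pdx (fun p => m p.1 * V p.2 * U p) p =
      ∫ p in rect L a, (deriv m p.1 * V p.2 * U p + m p.1 * V p.2 * pdx U p) * G p := by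
    refine setIntegral_congr_fun (measurableSet_rect L a) fun p hp => ?_
    simp only [pdx, (hfd p hp).fderiv]
    simp; ring
  rw [e1, e2] at htest
  -- The integrand is the vertical derivative of `m V₁ U²`, which vanishes on both horizontal sides.
  -- Adding this zero trades `V₁ U ∂_y U` for `V₂ U²`.
  have e3 : ∫ p in rect L a, m p.1 * (V₂ p.2 * U p ^ 2 + V₁ p.2 * (2 * U p * pdy U p)) = 0 := by
    refine setIntegral_rect_deriv_eq_zero ha (g := fun p => m p.1 * (V₁ p.2 * U p ^ 2))
      (fun x hx y hy => ?_) ?_ (fun x hx => by simp [hbot]) (fun x hx => by simp [htop])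
    · have := (((hV.hasDerivAt₁ y hy).mul
        ((hasDerivAt_slice_snd (hU.differentiable (by simp) (x, y))).pow 2)).const_mul (m x))
      refine this.congr_deriv ?_
      simp
    · exact cm.continuousOn.mul ((cV₂.mul (cU.pow 2).continuousOn).add
        (cV₁.mul ((continuous_const.mul cU).mul cUy).continuousOn))
  have iF := hF.integrable (by norm_num)
  have iG := hG.integrable (by norm_num)
  have c1 : ContinuousOn (fun p : ℝ × ℝ => m p.1 * (V₁ p.2 * U p + V p.2 * pdy U p))
      (Icc 0 L ×ˢ Icc 0 a) :=
    cm.continuousOn.mul ((cV₁.mul cU.continuousOn).add (cV.mul cUy.continuousOn))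
  have c2 : ContinuousOn (fun p : ℝ × ℝ => deriv m p.1 * V p.2 * U p + m p.1 * V p.2 * pdx U p)
      (Icc 0 L ×ˢ Icc 0 a) :=
    ((cm'.continuousOn.mul cV).mul cU.continuousOn).add
      ((cm.continuousOn.mul cV).mul cUx.continuousOn)
  have c3 : ContinuousOn (fun p : ℝ × ℝ => m p.1 * (V₂ p.2 * U p ^ 2 +
      V₁ p.2 * (2 * U p * pdy U p))) (Icc 0 L ×ˢ Icc 0 a) :=
    cm.continuousOn.mul ((cV₂.mul (cU.pow 2).continuousOn).add
        (cV₁.mul ((continuous_const.mul cU).mul cUy).continuousOn))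
  have c4 : ContinuousOn (fun p : ℝ × ℝ => m p.1 * (V p.2 * pdy U p ^ 2))
      (Icc 0 L ×ˢ Icc 0 a) := cm.continuousOn.mul (cV.mul (cUy.pow 2).continuousOn)
  have i1 := integrableOn_rect_continuousOn_mul c1 iF
  have i2 := integrableOn_rect_continuousOn_mul c2 iG
  have i3 := integrableOn_rect_of_continuousOn c3
  have i4 := integrableOn_rect_of_continuousOn c4
  have mU : MemLp U 2 (volume.restrict (rect L a)) := memLp_rect_of_continuousOn cU.continuousOn
  have mUy : MemLp (pdy U) 2 (volume.restrict (rect L a)) :=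
    memLp_rect_of_continuousOn cUy.continuousOn
  have j1 : IntegrableOn (fun p => V p.2 * (pdy U p + F p) ^ 2) (rect L a) :=
    integrableOn_rect_continuousOn_mul cV (mUy.add hF).integrable_sq
  have j2 : IntegrableOn (fun p => V p.2 * G p ^ 2) (rect L a) :=
    integrableOn_rect_continuousOn_mul cV hG.integrable_sq
  have j3 : IntegrableOn (fun p => V p.2 * pdx U p ^ 2) (rect L a) :=
    integrableOn_rect_of_continuousOn (cV.mul (cUx.pow 2).continuousOn)
  have j4 : IntegrableOn (fun p => V p.2 * (|G p| * |U p|)) (rect L a) := by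
    refine integrableOn_rect_continuousOn_mul cV ?_
    have := (hG.integrable_mul mU).abs
    simp only [Pi.mul_apply, abs_mul] at this
    exact this
  have hpt : ∀ p ∈ rect L a, m p.1 * (V p.2 * pdy U p ^ 2) +
      2 * ((m p.1 * (V₁ p.2 * U p + V p.2 * pdy U p)) * F p) -
      2 * ((deriv m p.1 * V p.2 * U p + m p.1 * V p.2 * pdx U p) * G p) +
      m p.1 * (V₂ p.2 * U p ^ 2 + V₁ p.2 * (2 * U p * pdy U p)) ≤
      (K + 1) * (V p.2 * (pdy U p + F p) ^ 2) + V p.2 * G p ^ 2 + V p.2 * pdx U p ^ 2 +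
        2 * N * (V p.2 * (|G p| * |U p|)) := by
    intro p hp
    have hy := (hsub hp).2
    obtain ⟨m0, m1⟩ := hm01 p.1
    have v0 := hV.nonneg _ hy
    have v2 := hV.nonpos₂ _ hy
    have vs := hV.sq_le _ hy
    exact energy_pointwise hK m0 m1 v0 v2 vs (hmd p.1)
  -- After integration the terms with `F` and `G` on the left cancel by the tested equation and the
  -- last one vanishes by `e3`, so only the desired left-hand side survives.
  have hint := setIntegral_mono_on (((i4.add (i1.const_mul 2)).sub (i2.const_mul 2)).add i3)
    ((((j1.const_mul (K + 1)).add j2).add j3).add (j4.const_mul (2 * N)))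
    (measurableSet_rect L a) hpt
  rw [integral_add' ((i4.add (i1.const_mul 2)).sub (i2.const_mul 2)) i3,
    integral_sub' (i4.add (i1.const_mul 2)) (i2.const_mul 2), integral_add' i4 (i1.const_mul 2),
    integral_add' (((j1.const_mul (K + 1)).add j2).add j3) (j4.const_mul (2 * N)),
    integral_add' ((j1.const_mul (K + 1)).add j2) j3, integral_add' (j1.const_mul (K + 1)) j2] at hint
  simp only [integral_const_mul] at hint
  rw [e3, htest] at hint
  linarith

/-! ### Weighted norms and the Korn inequality with vanishing boundary values -/

/-- The weighted square norm `∫ V(y) f(x, y)²` over `(0,h) × (0,a)`. -/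
noncomputable def wsq (h a : ℝ) (V : ℝ → ℝ) (f : ℝ × ℝ → ℝ) : ℝ :=
  ∫ p in rect h a, V p.2 * f p ^ 2

/-- The right-hand side of the weighted Korn inequality, for a displacement with first component
`u`, diagonal strains `A`, `B` and doubled shear strain `D`. -/
noncomputable def kornBound (h a : ℝ) (V : ℝ → ℝ) (u A D B : ℝ × ℝ → ℝ) : ℝ :=
  √(wsq h a V u) * √(wsq h a V B) / h + (wsq h a V A + wsq h a V D + wsq h a V B)

theorem wsq_nonneg {h a : ℝ} {V : ℝ → ℝ} (hV0 : ∀ y ∈ Icc 0 a, 0 ≤ V y) (f : ℝ × ℝ → ℝ) :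
    0 ≤ wsq h a V f :=
  setIntegral_nonneg (measurableSet_rect h a) fun _ hp =>
    mul_nonneg (hV0 _ (rect_subset_Icc h a hp).2) (sq_nonneg _)

theorem integrableOn_wsq {h a : ℝ} {V : ℝ → ℝ} (hV : ContinuousOn V (Icc 0 a)) {f : ℝ × ℝ → ℝ}
    (hf : MemLp f 2 (volume.restrict (rect h a))) :
    IntegrableOn (fun p => V p.2 * f p ^ 2) (rect h a) :=
  integrableOn_rect_continuousOn_mul (continuousOn_comp_snd hV) hf.integrable_sq

theorem wsq_comp_diagAffine_le {h L a κ σ τ t s : ℝ} (hσ : σ ≠ 0) (ht : t ≠ 0) {V W : ℝ → ℝ}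
    (hW : ContinuousOn W (Icc 0 a)) (hW0 : ∀ y ∈ Icc 0 a, 0 ≤ W y) (hV : ContinuousOn V (Icc 0 a))
    (hVW : ∀ y ∈ Ioo 0 a, V y ≤ κ * W (t * y + s)) (hκ : 0 ≤ κ)
    (hm : MapsTo (diagAffine σ τ t s) (rect L a) (rect h a)) {f : ℝ × ℝ → ℝ}
    (hf : MemLp f 2 (volume.restrict (rect h a))) :
    wsq L a V (fun p => f (diagAffine σ τ t s p)) ≤ κ * |(σ * t)⁻¹| * wsq h a W f := by
  have i1 := integrableOn_wsq hW hf
  have h1 := setIntegral_comp_diagAffine_le hσ ht τ s (measurableSet_rect h a) i1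
    (fun p hp => mul_nonneg (hW0 _ (rect_subset_Icc h a hp).2) (sq_nonneg _)) hm
  have i2 := integrableOn_comp_diagAffine hσ ht τ s i1 hm
  calc wsq L a V (fun p => f (diagAffine σ τ t s p))
      ≤ ∫ p in rect L a, κ * (W (diagAffine σ τ t s p).2 * f (diagAffine σ τ t s p) ^ 2) := by
        refine setIntegral_mono_on (integrableOn_wsq hV (memLp_comp_diagAffine hσ ht τ s hf hm))
          (i2.const_mul κ) (measurableSet_rect L a) fun p hp => ?_
        rw [← mul_assoc]
        exact mul_le_mul_of_nonneg_right (hVW p.2 hp.2) (sq_nonneg _)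
    _ = κ * ∫ p in rect L a, W (diagAffine σ τ t s p).2 * f (diagAffine σ τ t s p) ^ 2 := by
        rw [integral_const_mul]
    _ ≤ κ * (|(σ * t)⁻¹| * wsq h a W f) := by gcongr; exact h1
    _ = _ := by ring

theorem wsq_mono_width {h L a : ℝ} (hL : L ≤ h) {V : ℝ → ℝ} (hV : ContinuousOn V (Icc 0 a))
    (hV0 : ∀ y ∈ Icc 0 a, 0 ≤ V y) {f : ℝ × ℝ → ℝ} (hf : MemLp f 2 (volume.restrict (rect h a))) :
    wsq L a V f ≤ wsq h a V f :=
  setIntegral_mono_subset (rect_mono hL) (measurableSet_rect h a) (integrableOn_wsq hV hf)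
    fun _ hp => mul_nonneg (hV0 _ (rect_subset_Icc h a hp).2) (sq_nonneg _)

theorem wsq_le_add {h a c₁ c₂ : ℝ} {V : ℝ → ℝ} (hV : ContinuousOn V (Icc 0 a))
    (hV0 : ∀ y ∈ Icc 0 a, 0 ≤ V y) {f g k : ℝ × ℝ → ℝ}
    (hf : MemLp f 2 (volume.restrict (rect h a))) (hg : MemLp g 2 (volume.restrict (rect h a)))
    (hk : MemLp k 2 (volume.restrict (rect h a)))
    (hle : ∀ p ∈ rect h a, f p ^ 2 ≤ c₁ * g p ^ 2 + c₂ * k p ^ 2) :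
    wsq h a V f ≤ c₁ * wsq h a V g + c₂ * wsq h a V k := by
  have hg' := (integrableOn_wsq hV hg).const_mul c₁
  have hk' := (integrableOn_wsq hV hk).const_mul c₂
  unfold wsq
  rw [← integral_const_mul, ← integral_const_mul, ← integral_add hg' hk']
  refine setIntegral_mono_on (integrableOn_wsq hV hf) (hg'.add hk') (measurableSet_rect h a)
    fun p hp => ?_
  have := mul_le_mul_of_nonneg_left (hle p hp) (hV0 _ (rect_subset_Icc h a hp).2)
  linarith

theorem mapsTo_doubling (h a : ℝ) : MapsTo (diagAffine 2 0 1 0) (rect (h / 2) a) (rect h a) := by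
  rintro p ⟨⟨h1, h2⟩, h3⟩
  simp only [diagAffine, rect, mem_prod, mem_Ioo, one_mul, add_zero]
  exact ⟨⟨by linarith, by linarith⟩, h3⟩

theorem memLp_rect_mono {h L a : ℝ} (hL : L ≤ h) {f : ℝ × ℝ → ℝ}
    (hf : MemLp f 2 (volume.restrict (rect h a))) : MemLp f 2 (volume.restrict (rect L a)) :=
  hf.mono_measure (Measure.restrict_mono (rect_mono hL) le_rfl)

theorem memLp_doubling {h a : ℝ} {f : ℝ × ℝ → ℝ} (hf : MemLp f 2 (volume.restrict (rect h a))) :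
    MemLp (fun p => f (diagAffine 2 0 1 0 p)) 2 (volume.restrict (rect (h / 2) a)) :=
  memLp_comp_diagAffine (by norm_num) (by norm_num) 0 0 hf (mapsTo_doubling h a)

theorem memLp_sub_doubling {h a c : ℝ} (hh : 0 < h) {f : ℝ × ℝ → ℝ}
    (hf : MemLp f 2 (volume.restrict (rect h a))) :
    MemLp (fun p => f p - c * f (diagAffine 2 0 1 0 p)) 2 (volume.restrict (rect (h / 2) a)) :=
  (memLp_rect_mono (by linarith) hf).sub ((memLp_doubling hf).const_mul c)

/-- Young's inequality costs `2` and `2 c²`; the dilation has Jacobian `1 / 2`, which halves the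
second constant. -/
theorem wsq_sub_doubling_le {h a c : ℝ} (hh : 0 < h) {V : ℝ → ℝ} (hV : ContinuousOn V (Icc 0 a))
    (hV0 : ∀ y ∈ Icc 0 a, 0 ≤ V y) {f : ℝ × ℝ → ℝ} (hf : MemLp f 2 (volume.restrict (rect h a))) :
    wsq (h / 2) a V (fun p => f p - c * f (diagAffine 2 0 1 0 p)) ≤ (2 + c ^ 2) * wsq h a V f := by
  have h1 := wsq_le_add (c₁ := 2) (c₂ := 2 * c ^ 2) hV hV0 (memLp_sub_doubling (c := c) hh hf)
    (memLp_rect_mono (by linarith) hf) (memLp_doubling hf)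
    (fun p _ => by nlinarith [sq_nonneg (f p + c * f (diagAffine 2 0 1 0 p))])
  have h2 := wsq_comp_diagAffine_le (κ := 1) (σ := 2) (t := 1) (by norm_num) (by norm_num) hV hV0 hV
    (fun y _ => by simp) zero_le_one (mapsTo_doubling h a) hf
  have h3 := wsq_mono_width (by linarith : h / 2 ≤ h) hV hV0 hf
  have h4 : |((2 : ℝ) * 1)⁻¹| = 1 / 2 := by norm_num
  rw [h4] at h2
  nlinarith [sq_nonneg c]

/-- Weighted Korn inequality for displacements whose first component vanishes on the horizontal
sides, away from the right side. -/
theorem exists_korn_left {K : ℝ} (hK : 0 ≤ K) : ∃ C : ℝ, 0 < C ∧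
    ∀ {h a : ℝ} {V V₁ V₂ : ℝ → ℝ} {u F G : ℝ × ℝ → ℝ}, 0 < h → 0 < a →
      ConcaveWeight a K V V₁ V₂ → ContDiff ℝ ∞ u → (∀ x, u (x, 0) = 0) → (∀ x, u (x, a) = 0) →
      CurlFree (rect h a) F G → MemLp F 2 (volume.restrict (rect h a)) →
      MemLp G 2 (volume.restrict (rect h a)) →
      wsq (3 * h / 5) a V (pdy u) ≤ C * kornBound h a V u (pdx u) (fun p => pdy u p + F p) G := by
  obtain ⟨M, hM0, hM⟩ := exists_bound_deriv_smoothTransition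
  -- The outer `6` comes from the absorption in `habs`. Inside, `6` and `18` are the factors `2 +
  -- c²` for `c = 2` and `c = 4`, and `100 M` is `2 * 10 M * 5`, from the slope of the cutoff and
  -- the bound `b5`.
  refine ⟨6 * (6 * (K + 1) + 18 + 100 * M), by positivity, ?_⟩
  intro h a V V₁ V₂ u F G hh ha hV hu hbot htop hc hF hG
  -- The cutoff drops from `1` to `0` between `3h/10` and `2h/5`. The second value has to stay below
  -- `h / 2` for the doubling identity; twice the first has to exceed `h / 2` so that a reflection
  -- covers the rest.
  let m : ℝ → ℝ := fun x => Real.smoothTransition (4 - 10 / h * x)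
  have hm : ContDiff ℝ ∞ m := contDiff_smoothTransition.comp (by fun_prop)
  have hmd : ∀ x, |deriv m x| ≤ 10 * M / h := by
    intro x
    have h1 : HasDerivAt (fun x : ℝ => 4 - 10 / h * x) (-(10 / h)) x := by
      simpa using ((hasDerivAt_id x).const_mul (10 / h)).const_sub 4
    have h2 : deriv m x = _ :=
      ((contDiff_smoothTransition.differentiable (by simp) _).hasDerivAt.comp x h1).deriv
    rw [h2, abs_mul, abs_neg, abs_of_pos (by positivity : 0 < 10 / h)]
    calc _ ≤ M * (10 / h) := by gcongr; exact hM _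
      _ = _ := by ring
  have hm1 : ∀ x ≤ 3 * h / 10, m x = 1 := by
    intro x hx
    refine Real.smoothTransition.one_of_one_le ?_
    have : 10 / h * x ≤ 10 / h * (3 * h / 10) := by gcongr
    have h3 : 10 / h * (3 * h / 10) = 3 := by field_simp
    linarith
  have hm0 : ∀ x, 2 * h / 5 ≤ x → m x = 0 := by
    intro x hx
    refine Real.smoothTransition.zero_of_nonpos ?_
    have : 10 / h * (2 * h / 5) ≤ 10 / h * x := by gcongr
    have h3 : 10 / h * (2 * h / 5) = 4 := by field_simp; norm_num
    linarith
  set dbl := diagAffine 2 0 1 0 with hdbl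
  -- Paired with `v(x,y) - v(2x,y)`, formally, this has shear `D(x,y) - 2 D(2x,y)`. The coefficient
  -- `2` matches the one produced by the doubling identity.
  let U : ℝ × ℝ → ℝ := fun p => u p - 2 * u (dbl p)
  have hU : ContDiff ℝ ∞ U :=
    hu.sub (contDiff_const.mul (hu.comp (contDiff_diagAffine _ _ _ _)))
  have hUb : ∀ x, U (x, 0) = 0 := fun x => by simp [U, hdbl, diagAffine, hbot]
  have hUt : ∀ x, U (x, a) = 0 := fun x => by simp [U, hdbl, diagAffine, htop]
  have hdu : ∀ p, DifferentiableAt ℝ u p := fun p => hu.differentiable (by simp) p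
  have hdu' : ∀ p, DifferentiableAt ℝ (fun q => 2 * u (dbl q)) p := fun p =>
    ((contDiff_const.mul (hu.comp (contDiff_diagAffine _ _ _ _))).differentiable (by simp)) p
  have hdu'' : ∀ p, DifferentiableAt ℝ (fun q => u (dbl q)) p := fun p =>
    ((hu.comp (contDiff_diagAffine _ _ _ _)).differentiable (by simp)) p
  have hfU : ∀ p e, fderiv ℝ U p e = fderiv ℝ u p e - 2 * fderiv ℝ (fun q => u (dbl q)) p e := by
    intro p e
    have h1 : fderiv ℝ U p = fderiv ℝ u p - fderiv ℝ (fun q => 2 * u (dbl q)) p :=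
      fderiv_fun_sub (hdu p) (hdu' p)
    rw [h1, fderiv_const_mul (hdu'' p)]
    simp
  have hUy : ∀ p, pdy U p = pdy u p - 2 * pdy u (dbl p) := by
    intro p
    have h1 : fderiv ℝ (fun q => u (dbl q)) p (0, 1) = 1 * fderiv ℝ u (dbl p) (0, 1) :=
      pdy_comp_diagAffine (hdu _)
    simp only [pdy]
    rw [hfU, h1, one_mul]
  have hUx : ∀ p, pdx U p = pdx u p - 4 * pdx u (dbl p) := by
    intro p
    have h1 : fderiv ℝ (fun q => u (dbl q)) p (1, 0) = 2 * fderiv ℝ u (dbl p) (1, 0) :=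
      pdx_comp_diagAffine (hdu _)
    simp only [pdx]
    rw [hfU, h1]; ring
  have hcont := hV.continuousOn
  have hV0 := hV.nonneg
  have mu : MemLp u 2 (volume.restrict (rect h a)) :=
    memLp_rect_of_continuousOn hu.continuous.continuousOn
  have mux : MemLp (pdx u) 2 (volume.restrict (rect h a)) :=
    memLp_rect_of_continuousOn (contDiff_fderiv_apply hu _).continuous.continuousOn
  have muy : MemLp (pdy u) 2 (volume.restrict (rect h a)) :=
    memLp_rect_of_continuousOn (contDiff_fderiv_apply hu _).continuous.continuousOn
  have mUy : MemLp (pdy U) 2 (volume.restrict (rect (h / 2) a)) :=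
    memLp_rect_of_continuousOn (contDiff_fderiv_apply hU _).continuous.continuousOn
  have mD : MemLp (fun p => pdy u p + F p) 2 (volume.restrict (rect h a)) := muy.add hF
  have htest := hc.integral_doubling_eq hh ha (by linarith : 2 * h / 5 < h / 2)
    (hF.integrable (by norm_num)) (hG.integrable (by norm_num))
    (ψ := fun p => m p.1 * V p.2 * U p)
    (fun p hp => (((hm.comp contDiff_fst).contDiffAt.mul
      ((hV.smooth p.2 hp.2).comp p contDiffAt_snd)).mul hU.contDiffAt))
    (fun p hp => by simp [hm0 _ hp]) (fun x => by simp [hUb]) (fun x => by simp [hUt])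
  have hG1 : MemLp (fun p => G p - G (dbl p)) 2 (volume.restrict (rect (h / 2) a)) := by
    simpa using memLp_sub_doubling (c := 1) hh hG
  have hen := energy_le ha hV hK hm (fun x => ⟨Real.smoothTransition.nonneg _,
    Real.smoothTransition.le_one _⟩) hmd hU hUb hUt (memLp_sub_doubling hh hF) hG1 htest
  have b1 : (∫ p in rect (h / 2) a, V p.2 * (pdy U p + (F p - 2 * F (dbl p))) ^ 2) ≤
      6 * wsq h a V (fun p => pdy u p + F p) := by
    have := wsq_sub_doubling_le (c := 2) hh hcont hV0 mD
    refine le_trans (le_of_eq ?_) (this.trans (by norm_num))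
    unfold wsq
    refine integral_congr_ae (Eventually.of_forall fun p => ?_)
    simp only [hUy, ← hdbl]; ring
  have b2 : (∫ p in rect (h / 2) a, V p.2 * (G p - G (dbl p)) ^ 2) ≤ 3 * wsq h a V G := by
    have := wsq_sub_doubling_le (c := 1) hh hcont hV0 hG
    simp only [one_mul, one_pow] at this
    exact this.trans (by norm_num)
  have b3 : (∫ p in rect (h / 2) a, V p.2 * pdx U p ^ 2) ≤ 18 * wsq h a V (pdx u) := by
    have := wsq_sub_doubling_le (c := 4) hh hcont hV0 mux
    simp only [hUx]
    exact this.trans (by norm_num)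
  have b4 : (∫ p in rect (h / 2) a, V p.2 * U p ^ 2) ≤ 6 * wsq h a V u :=
    (wsq_sub_doubling_le (c := 2) hh hcont hV0 mu).trans (by norm_num)
  have b5 : (∫ p in rect (h / 2) a, V p.2 * (|G p - G (dbl p)| * |U p|)) ≤
      5 * (√(wsq h a V u) * √(wsq h a V G)) := by
    have h1 := integral_weight_mul_le hcont hV0 hG1
      (memLp_rect_of_continuousOn (h := h / 2) (a := a) (q := 2) hU.continuous.continuousOn)
    have h2 : √(3 : ℝ) ≤ 2 := by rw [Real.sqrt_le_left (by norm_num)]; norm_num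
    have h3 : √(6 : ℝ) ≤ 5 / 2 := by rw [Real.sqrt_le_left (by norm_num)]; norm_num
    calc _ ≤ _ := h1
      _ ≤ √(3 * wsq h a V G) * √(6 * wsq h a V u) := by gcongr
      _ = √3 * √6 * (√(wsq h a V u) * √(wsq h a V G)) := by
          rw [Real.sqrt_mul (by norm_num), Real.sqrt_mul (by norm_num)]; ring
      _ ≤ 2 * (5 / 2) * (√(wsq h a V u) * √(wsq h a V G)) := by gcongr
      _ = _ := by ring
  have p1 := wsq_nonneg (h := h) hV0 (pdx u)
  have p2 := wsq_nonneg (h := h) hV0 (fun p => pdy u p + F p)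
  have p3 := wsq_nonneg (h := h) hV0 G
  have p4 : 0 ≤ √(wsq h a V u) * √(wsq h a V G) / h := by positivity
  have hE : wsq (3 * h / 10) a V (pdy U) ≤
      (6 * (K + 1) + 18 + 100 * M) * kornBound h a V u (pdx u) (fun p => pdy u p + F p) G := by
    have c1 : wsq (3 * h / 10) a V (pdy U) ≤
        ∫ p in rect (h / 2) a, m p.1 * (V p.2 * pdy U p ^ 2) := by
      have e : wsq (3 * h / 10) a V (pdy U) =
          ∫ p in rect (3 * h / 10) a, m p.1 * (V p.2 * pdy U p ^ 2) := by
        refine setIntegral_congr_fun (measurableSet_rect _ a) fun p hp => ?_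
        simp only [hm1 p.1 hp.1.2.le, one_mul]
      rw [e]
      refine setIntegral_mono_subset (rect_mono (by linarith)) (measurableSet_rect _ a)
        (integrableOn_rect_continuousOn_mul (hm.continuous.comp continuous_fst).continuousOn
          (integrableOn_wsq hcont mUy)) fun p hp => ?_
      exact mul_nonneg (Real.smoothTransition.nonneg _)
        (mul_nonneg (hV0 _ (rect_subset_Icc _ a hp).2) (sq_nonneg _))
    have c2 : 2 * (10 * M / h) * (∫ p in rect (h / 2) a, V p.2 * (|G p - G (dbl p)| * |U p|)) ≤
        100 * M * (√(wsq h a V u) * √(wsq h a V G) / h) := by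
      calc _ ≤ 2 * (10 * M / h) * (5 * (√(wsq h a V u) * √(wsq h a V G))) := by gcongr
        _ = _ := by ring
    have c3 := mul_le_mul_of_nonneg_left b1 (by positivity : 0 ≤ K + 1)
    unfold kornBound
    generalize √(wsq h a V u) * √(wsq h a V G) / h = z at *
    generalize wsq h a V (pdx u) = z1 at *
    generalize wsq h a V (fun p => pdy u p + F p) = z2 at *
    generalize wsq h a V G = z3 at *
    have q1 : 0 ≤ K * z := by positivity
    have q2 : 0 ≤ K * z1 := by positivity
    have q3 : 0 ≤ K * z3 := by positivity
    have q4 : 0 ≤ M * z1 := by positivity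
    have q5 : 0 ≤ M * z2 := by positivity
    have q6 : 0 ≤ M * z3 := by positivity
    linarith
  -- The squared norm of `2 u_y(2x, y)` over width `3h/10` is twice that of `u_y` over width `3h/5`:
  -- a factor `4` from the coefficient and `1 / 2` from the Jacobian. Since `3 / 2 < 2`, the first
  -- term on the right can be absorbed.
  have habs : 2 * wsq (3 * h / 5) a V (pdy u) ≤
      3 / 2 * wsq (3 * h / 10) a V (pdy u) + 3 * wsq (3 * h / 10) a V (pdy U) := by
    have hpre : dbl ⁻¹' rect (3 * h / 5) a = rect (3 * h / 10) a := by
      ext p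
      simp only [hdbl, diagAffine, rect, mem_preimage, mem_prod, mem_Ioo, one_mul, add_zero]
      constructor
      · rintro ⟨⟨h1, h2⟩, h3⟩; exact ⟨⟨by linarith, by linarith⟩, h3⟩
      · rintro ⟨⟨h1, h2⟩, h3⟩; exact ⟨⟨by linarith, by linarith⟩, h3⟩
    have e := setIntegral_comp_diagAffine (σ := 2) (t := 1) (by norm_num) (by norm_num) 0 0
      (fun p => V p.2 * pdy u p ^ 2) (rect (3 * h / 5) a)
    rw [← hdbl, hpre] at e
    have e' : 2 * wsq (3 * h / 5) a V (pdy u) =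
        wsq (3 * h / 10) a V (fun p => 2 * pdy u (dbl p)) := by
      have e2 : wsq (3 * h / 10) a V (fun p => 2 * pdy u (dbl p)) =
          4 * ∫ p in rect (3 * h / 10) a, V (dbl p).2 * pdy u (dbl p) ^ 2 := by
        rw [← integral_const_mul]
        refine integral_congr_ae (Eventually.of_forall fun p => ?_)
        simp only [hdbl, diagAffine, one_mul, add_zero]; ring
      rw [e2, e]
      norm_num
      unfold wsq; ring
    rw [e']
    refine wsq_le_add hcont hV0 ?_ (memLp_rect_mono (by linarith) muy)
      (memLp_rect_mono (by linarith) mUy) fun p _ => ?_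
    · exact memLp_rect_mono (by linarith) ((memLp_doubling muy).const_mul 2)
    · rw [hUy]
      nlinarith [sq_nonneg (pdy u p + 2 * (pdy u p - 2 * pdy u (dbl p)))]
  have hmono := wsq_mono_width (by linarith : 3 * h / 10 ≤ 3 * h / 5) hcont hV0
    (memLp_rect_mono (by linarith : 3 * h / 5 ≤ h) muy)
  linarith

/-- Weighted Korn inequality for displacements whose first component vanishes on the horizontal
sides. -/
theorem exists_korn_dirichlet {K : ℝ} (hK : 0 ≤ K) : ∃ C : ℝ, 0 < C ∧
    ∀ {h a : ℝ} {V V₁ V₂ : ℝ → ℝ} {u F G : ℝ × ℝ → ℝ}, 0 < h → 0 < a →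
      ConcaveWeight a K V V₁ V₂ → ContDiff ℝ ∞ u → (∀ x, u (x, 0) = 0) → (∀ x, u (x, a) = 0) →
      CurlFree (rect h a) F G → MemLp F 2 (volume.restrict (rect h a)) →
      MemLp G 2 (volume.restrict (rect h a)) →
      wsq h a V (pdy u) ≤ C * kornBound h a V u (pdx u) (fun p => pdy u p + F p) G := by
  obtain ⟨C, hC0, hC⟩ := exists_korn_left hK
  refine ⟨2 * C, by positivity, ?_⟩
  intro h a V V₁ V₂ u F G hh ha hV hu hbot htop hc hF hG
  have hleft := hC hh ha hV hu hbot htop hc hF hG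
  -- The left estimate for the displacement reflected in `x` is an estimate over `2h/5 < x < h`,
  -- which overlaps `0 < x < 3h/5`.
  set ρ := diagAffine (-1) h 1 0 with hρ
  have hmaps : MapsTo ρ (rect h a) (rect h a) := by
    rintro p ⟨⟨h1, h2⟩, h3⟩
    simp only [hρ, diagAffine, rect, mem_prod, mem_Ioo, one_mul, add_zero]
    exact ⟨⟨by linarith, by linarith⟩, h3⟩
  have hdu : ∀ p, DifferentiableAt ℝ u p := fun p => hu.differentiable (by simp) p
  have hx : ∀ p, pdx (fun q => u (ρ q)) p = -1 * pdx u (ρ p) := fun p =>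
    pdx_comp_diagAffine (hdu _)
  have hy : ∀ p, pdy (fun q => u (ρ q)) p = 1 * pdy u (ρ p) := fun p =>
    pdy_comp_diagAffine (hdu _)
  have hright := hC hh ha hV (u := fun q => u (ρ q)) (hu.comp (contDiff_diagAffine _ _ _ _))
    (fun x => by simp [hρ, diagAffine, hbot]) (fun x => by simp [hρ, diagAffine, htop])
    (hc.comp_diagAffine (by norm_num) (by norm_num) h 0 hmaps)
    ((memLp_comp_diagAffine (by norm_num) (by norm_num) h 0 hF hmaps).const_mul 1)
    ((memLp_comp_diagAffine (by norm_num) (by norm_num) h 0 hG hmaps).const_mul _)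
  have hinv : ∀ f : ℝ × ℝ → ℝ, wsq h a V (fun p => f (ρ p)) = wsq h a V f := by
    intro f
    have hpre : ρ ⁻¹' rect h a = rect h a := by
      ext p
      simp only [hρ, diagAffine, rect, mem_preimage, mem_prod, mem_Ioo, one_mul, add_zero]
      constructor
      · rintro ⟨⟨h1, h2⟩, h3⟩; exact ⟨⟨by linarith, by linarith⟩, h3⟩
      · rintro ⟨⟨h1, h2⟩, h3⟩; exact ⟨⟨by linarith, by linarith⟩, h3⟩
    have e := setIntegral_comp_diagAffine (σ := -1) (t := 1) (by norm_num) (by norm_num) h 0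
      (fun p => V p.2 * f p ^ 2) (rect h a)
    rw [← hρ, hpre] at e
    simp only [hρ, diagAffine, one_mul, add_zero] at e ⊢
    unfold wsq
    rw [e]; norm_num
  have hsq : ∀ f g : ℝ × ℝ → ℝ, (∀ p, f p ^ 2 = g p ^ 2) → wsq h a V f = wsq h a V g := by
    intro f g hfg; unfold wsq; simp only [hfg]
  -- Under the reflection `u_x` and `G` only change sign, which the squares do not see, while `u`
  -- and the shear are merely composed with `ρ`.
  have hb : kornBound h a V (fun q => u (ρ q)) (pdx fun q => u (ρ q))
      (fun p => pdy (fun q => u (ρ q)) p + 1 * F (diagAffine (-1) h 1 0 p))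
      (fun p => 1 ^ 2 / -1 * G (diagAffine (-1) h 1 0 p)) =
      kornBound h a V u (pdx u) (fun p => pdy u p + F p) G := by
    unfold kornBound
    rw [hinv u, hsq (pdx fun q => u (ρ q)) (fun p => pdx u (ρ p)) (fun p => by rw [hx]; ring),
      hinv (pdx u), hsq (fun p => pdy (fun q => u (ρ q)) p + 1 * F (diagAffine (-1) h 1 0 p))
        (fun p => (fun p => pdy u p + F p) (ρ p)) (fun p => by simp only [hy, ← hρ]; ring),
      hinv (fun p => pdy u p + F p), hsq (fun p => 1 ^ 2 / -1 * G (diagAffine (-1) h 1 0 p))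
        (fun p => G (ρ p)) (fun p => by simp only [← hρ]; ring), hinv G]
  rw [hb] at hright
  have muy : MemLp (pdy u) 2 (volume.restrict (rect h a)) :=
    memLp_rect_of_continuousOn (contDiff_fderiv_apply hu _).continuous.continuousOn
  have hint := integrableOn_wsq hV.continuousOn muy
  have hnn : ∀ p ∈ rect h a, 0 ≤ V p.2 * pdy u p ^ 2 := fun p hp =>
    mul_nonneg (hV.nonneg _ (rect_subset_Icc h a hp).2) (sq_nonneg _)
  set T : Set (ℝ × ℝ) := Ioo (2 * h / 5) h ×ˢ Ioo 0 a with hT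
  have hTm : MeasurableSet T := measurableSet_Ioo.prod measurableSet_Ioo
  have hTsub : T ⊆ rect h a := prod_mono (Ioo_subset_Ioo_left (by positivity)) subset_rfl
  have hLsub : rect (3 * h / 5) a ⊆ rect h a := rect_mono (by linarith)
  have hcover : rect h a ⊆ rect (3 * h / 5) a ∪ T := by
    rintro p ⟨⟨h1, h2⟩, h3⟩
    rcases lt_or_ge p.1 (3 * h / 5) with h4 | h4
    · exact Or.inl ⟨⟨h1, h4⟩, h3⟩
    · exact Or.inr ⟨⟨by linarith, h2⟩, h3⟩
  have hTval : ∫ p in T, V p.2 * pdy u p ^ 2 = wsq (3 * h / 5) a V (pdy fun q => u (ρ q)) := by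
    have hpre : ρ ⁻¹' T = rect (3 * h / 5) a := by
      ext p
      simp only [hρ, hT, diagAffine, rect, mem_preimage, mem_prod, mem_Ioo, one_mul, add_zero]
      constructor
      · rintro ⟨⟨h1, h2⟩, h3⟩; exact ⟨⟨by linarith, by linarith⟩, h3⟩
      · rintro ⟨⟨h1, h2⟩, h3⟩; exact ⟨⟨by linarith, by linarith⟩, h3⟩
    have e := setIntegral_comp_diagAffine (σ := -1) (t := 1) (by norm_num) (by norm_num) h 0
      (fun p => V p.2 * pdy u p ^ 2) T
    rw [← hρ, hpre] at e
    unfold wsq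
    simp only [hy, one_mul]
    simp only [hρ, diagAffine, one_mul, add_zero] at e ⊢
    rw [e]; norm_num
  have h1 : wsq h a V (pdy u) ≤ wsq (3 * h / 5) a V (pdy u) + ∫ p in T, V p.2 * pdy u p ^ 2 := by
    refine le_trans ?_ (setIntegral_union_le (measurableSet_rect _ a) hTm (hint.mono_set hLsub)
      (hint.mono_set hTsub) fun p hp => hnn p (hTsub hp))
    refine setIntegral_mono_subset hcover ((measurableSet_rect _ a).union hTm)
      ((hint.mono_set hLsub).union (hint.mono_set hTsub)) ?_
    rintro p (hp | hp)
    · exact hnn p (hLsub hp)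
    · exact hnn p (hTsub hp)
  rw [hTval] at h1
  linarith

/-! ### Combinations of vertical rescalings -/

theorem memLp_rect_of_continuous {h a : ℝ} {q : ENNReal} {g : ℝ × ℝ → ℝ} (hg : Continuous g) :
    MemLp g q (volume.restrict (rect h a)) :=
  memLp_rect_of_continuousOn hg.continuousOn

theorem kornBound_nonneg {h a : ℝ} (hh : 0 < h) {V : ℝ → ℝ} (hV0 : ∀ y ∈ Icc 0 a, 0 ≤ V y)
    (u A D B : ℝ × ℝ → ℝ) : 0 ≤ kornBound h a V u A D B := by
  have h1 := wsq_nonneg (h := h) hV0 A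
  have h2 := wsq_nonneg (h := h) hV0 D
  have h3 := wsq_nonneg (h := h) hV0 B
  unfold kornBound
  positivity

/-- The mixed term is a product of two square roots, hence homogeneous of degree one in the squared
norms, like the other terms. -/
theorem kornBound_le_mul {h a c : ℝ} (hh : 0 < h) (hc : 0 ≤ c) {V W : ℝ → ℝ}
    {u A D B u' A' D' B' : ℝ × ℝ → ℝ} (hu : wsq h a V u' ≤ c * wsq h a W u)
    (hA : wsq h a V A' ≤ c * wsq h a W A) (hD : wsq h a V D' ≤ c * wsq h a W D)
    (hB : wsq h a V B' ≤ c * wsq h a W B) :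
    kornBound h a V u' A' D' B' ≤ c * kornBound h a W u A D B := by
  have h1 : √(wsq h a V u') * √(wsq h a V B') / h ≤
      c * (√(wsq h a W u) * √(wsq h a W B) / h) := by
    calc _ ≤ √(c * wsq h a W u) * √(c * wsq h a W B) / h := by gcongr
      _ = (√c * √c) * (√(wsq h a W u) * √(wsq h a W B) / h) := by
          rw [Real.sqrt_mul hc, Real.sqrt_mul hc]; ring
      _ = _ := by rw [Real.mul_self_sqrt hc]
  unfold kornBound
  linarith

/-- Cauchy–Schwarz for a sum of `n` terms gives one factor `n`, and summing the `n` estimates the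
other. Each term loses `3` in the comparison of weights and at most `6` in the Jacobian. -/
theorem wsq_sum_comp_le {n : ℕ} {h a : ℝ} {V W : ℝ → ℝ} (hV : ContinuousOn V (Icc 0 a))
    (hV0 : ∀ y ∈ Icc 0 a, 0 ≤ V y) (hW : ContinuousOn W (Icc 0 a)) (hW0 : ∀ y ∈ Icc 0 a, 0 ≤ W y)
    {c t s : Fin n → ℝ} (hc : ∀ i, |c i| ≤ 1) (ht0 : ∀ i, t i ≠ 0) (ht6 : ∀ i, |(t i)⁻¹| ≤ 6)
    (hVW : ∀ i, ∀ y ∈ Ioo 0 a, V y ≤ 3 * W (t i * y + s i))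
    (hm : ∀ i, MapsTo (diagAffine 1 0 (t i) (s i)) (rect h a) (rect h a)) {f : ℝ × ℝ → ℝ}
    (hf : MemLp f 2 (volume.restrict (rect h a))) :
    wsq h a V (fun p => ∑ i, c i * f (diagAffine 1 0 (t i) (s i) p)) ≤
      18 * n ^ 2 * wsq h a W f := by
  have hmem : ∀ i, MemLp (fun p => f (diagAffine 1 0 (t i) (s i) p)) 2
      (volume.restrict (rect h a)) := fun i =>
    memLp_comp_diagAffine one_ne_zero (ht0 i) 0 (s i) hf (hm i)
  have hsum : MemLp (fun p => ∑ i, c i * f (diagAffine 1 0 (t i) (s i) p)) 2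
      (volume.restrict (rect h a)) :=
    memLp_finsetSum _ fun i _ => (hmem i).const_mul (c i)
  have h1 : wsq h a V (fun p => ∑ i, c i * f (diagAffine 1 0 (t i) (s i) p)) ≤
      ∑ i : Fin n, n * wsq h a V (fun p => f (diagAffine 1 0 (t i) (s i) p)) := by
    have hi : ∀ i ∈ Finset.univ, IntegrableOn
        (fun p => (n : ℝ) * (V p.2 * f (diagAffine 1 0 (t i) (s i) p) ^ 2)) (rect h a) :=
      fun i _ => (integrableOn_wsq hV (hmem i)).const_mul n
    unfold wsq
    simp only [← integral_const_mul]
    rw [← integral_finsetSum _ hi]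
    refine setIntegral_mono_on (integrableOn_wsq hV hsum) (integrable_finsetSum _ hi)
      (measurableSet_rect h a) fun p hp => ?_
    have hv := hV0 _ (rect_subset_Icc h a hp).2
    have h2 := sq_sum_le_card_mul_sum_sq (s := Finset.univ)
      (f := fun i => c i * f (diagAffine 1 0 (t i) (s i) p))
    rw [Finset.card_univ, Fintype.card_fin] at h2
    have h3 : ∑ i, (c i * f (diagAffine 1 0 (t i) (s i) p)) ^ 2 ≤
        ∑ i, f (diagAffine 1 0 (t i) (s i) p) ^ 2 := by
      refine Finset.sum_le_sum fun i _ => ?_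
      rw [mul_pow]
      refine mul_le_of_le_one_left (sq_nonneg _) ?_
      rw [sq_le_one_iff_abs_le_one]; exact hc i
    calc _ ≤ V p.2 * (n * ∑ i, f (diagAffine 1 0 (t i) (s i) p) ^ 2) := by
          gcongr; exact h2.trans (by gcongr)
      _ = _ := by rw [Finset.mul_sum, Finset.mul_sum]; exact Finset.sum_congr rfl fun i _ => by ring
  refine h1.trans ?_
  have h2 : ∀ i : Fin n, (n : ℝ) * wsq h a V (fun p => f (diagAffine 1 0 (t i) (s i) p)) ≤
      n * (18 * wsq h a W f) := by
    intro i
    have h3 := wsq_comp_diagAffine_le one_ne_zero (ht0 i) hW hW0 hV (hVW i) (by norm_num) (hm i) hf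
    rw [one_mul] at h3
    have h4 : 3 * |(t i)⁻¹| * wsq h a W f ≤ 3 * 6 * wsq h a W f := by
      have := wsq_nonneg (h := h) hW0 f
      have := ht6 i
      gcongr
    gcongr
    linarith
  calc _ ≤ ∑ _i : Fin n, (n : ℝ) * (18 * wsq h a W f) := Finset.sum_le_sum fun i _ => h2 i
    _ = _ := by rw [Finset.sum_const, Finset.card_univ, Fintype.card_fin, nsmul_eq_mul]; ring

/-- Weighted Korn inequality for a combination of vertical rescalings of a displacement whose first
component vanishes on the horizontal sides. -/
theorem exists_korn_combination {K : ℝ} (hK : 0 ≤ K) (n : ℕ) : ∃ C : ℝ, 0 < C ∧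
    ∀ {h a : ℝ} {V V₁ V₂ W : ℝ → ℝ} {u F G : ℝ × ℝ → ℝ} {μ t s : Fin n → ℝ}, 0 < h → 0 < a →
      ConcaveWeight a K V V₁ V₂ → ContinuousOn W (Icc 0 a) → (∀ y ∈ Icc 0 a, 0 ≤ W y) →
      ContDiff ℝ ∞ u → CurlFree (rect h a) F G → MemLp F 2 (volume.restrict (rect h a)) →
      MemLp G 2 (volume.restrict (rect h a)) →
      (∀ i, |μ i| ≤ 1) → (∀ i, t i ≠ 0) → (∀ i, |t i| ≤ 1) → (∀ i, |(t i)⁻¹| ≤ 6) →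
      (∀ i, ∀ y ∈ Ioo 0 a, V y ≤ 3 * W (t i * y + s i)) →
      (∀ i, ∀ y ∈ Ioo 0 a, t i * y + s i ∈ Ioo 0 a) →
      (∀ x, ∑ i, μ i * u (x, s i) = 0) → (∀ x, ∑ i, μ i * u (x, t i * a + s i) = 0) →
      wsq h a V (fun p => ∑ i, μ i * t i * pdy u (diagAffine 1 0 (t i) (s i) p)) ≤
        C * kornBound h a W u (pdx u) (fun p => pdy u p + F p) G := by
  obtain ⟨C, hC0, hC⟩ := exists_korn_dirichlet hK
  refine ⟨C * (18 * n ^ 2 + 1), by positivity, ?_⟩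
  intro h a V V₁ V₂ W u F G μ t s hh ha hV hW hW0 hu hc hF hG hμ ht0 ht1 ht6 hVW hT hbot htop
  have hm : ∀ i, MapsTo (diagAffine 1 0 (t i) (s i)) (rect h a) (rect h a) := by
    intro i p hp
    refine ⟨?_, hT i p.2 hp.2⟩
    simpa [diagAffine] using hp.1
  have hdu : ∀ p, DifferentiableAt ℝ u p := fun p => hu.differentiable (by simp) p
  have hcomp : ∀ i, ContDiff ℝ ∞ (fun p => u (diagAffine 1 0 (t i) (s i) p)) := fun i =>
    hu.comp (contDiff_diagAffine _ _ _ _)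
  let U : ℝ × ℝ → ℝ := fun p => ∑ i, μ i * u (diagAffine 1 0 (t i) (s i) p)
  have hU : ContDiff ℝ ∞ U := ContDiff.sum fun i _ => contDiff_const.mul (hcomp i)
  have hfU : ∀ p e, fderiv ℝ U p e =
      ∑ i, μ i * fderiv ℝ (fun q => u (diagAffine 1 0 (t i) (s i) q)) p e := by
    intro p e
    have h1 : fderiv ℝ U p =
        ∑ i, fderiv ℝ (fun q => μ i * u (diagAffine 1 0 (t i) (s i) q)) p :=
      fderiv_fun_sum fun i _ => ((contDiff_const.mul (hcomp i)).differentiable (by simp)) p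
    rw [h1, _root_.sum_apply]
    refine Finset.sum_congr rfl fun i _ => ?_
    rw [fderiv_const_mul ((hcomp i).differentiable (by simp) p)]
    simp
  have hUy : pdy U = fun p => ∑ i, μ i * t i * pdy u (diagAffine 1 0 (t i) (s i) p) := by
    funext p
    simp only [pdy]
    rw [hfU]
    refine Finset.sum_congr rfl fun i _ => ?_
    have := pdy_comp_diagAffine (σ := 1) (τ := 0) (t := t i) (s := s i) (p := p) (hdu _)
    simp only [pdy] at this
    rw [this]; ring
  have hUx : pdx U = fun p => ∑ i, μ i * pdx u (diagAffine 1 0 (t i) (s i) p) := by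
    funext p
    simp only [pdx]
    rw [hfU]
    refine Finset.sum_congr rfl fun i _ => ?_
    have := pdx_comp_diagAffine (σ := 1) (τ := 0) (t := t i) (s := s i) (p := p) (hdu _)
    simp only [pdx] at this
    rw [this]; ring
  have hFi : ∀ i, MemLp (fun p => t i * F (diagAffine 1 0 (t i) (s i) p)) 2
      (volume.restrict (rect h a)) := fun i =>
    (memLp_comp_diagAffine one_ne_zero (ht0 i) 0 (s i) hF (hm i)).const_mul _
  have hGi : ∀ i, MemLp (fun p => t i ^ 2 / 1 * G (diagAffine 1 0 (t i) (s i) p)) 2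
      (volume.restrict (rect h a)) := fun i =>
    (memLp_comp_diagAffine one_ne_zero (ht0 i) 0 (s i) hG (hm i)).const_mul _
  have hcurl := CurlFree.sum Finset.univ μ (fun i _ => (hFi i).integrable (by norm_num))
    (fun i _ => (hGi i).integrable (by norm_num))
    (fun i _ => hc.comp_diagAffine one_ne_zero (ht0 i) 0 (s i) (hm i))
  have key := hC hh ha hV hU (fun x => by simpa [U, diagAffine] using hbot x)
    (fun x => by simpa [U, diagAffine] using htop x) hcurl
    (memLp_finsetSum _ fun i _ => (hFi i).const_mul (μ i))
    (memLp_finsetSum _ fun i _ => (hGi i).const_mul (μ i))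
  rw [hUx] at key
  have mu : MemLp u 2 (volume.restrict (rect h a)) := memLp_rect_of_continuous hu.continuous
  have mux : MemLp (pdx u) 2 (volume.restrict (rect h a)) :=
    memLp_rect_of_continuous (contDiff_fderiv_apply hu _).continuous
  have muy : MemLp (pdy u) 2 (volume.restrict (rect h a)) :=
    memLp_rect_of_continuous (contDiff_fderiv_apply hu _).continuous
  have hμt : ∀ i, |μ i * t i| ≤ 1 := fun i => by
    rw [abs_mul]; exact mul_le_one₀ (hμ i) (abs_nonneg _) (ht1 i)
  have hμt2 : ∀ i, |μ i * t i ^ 2| ≤ 1 := fun i => by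
    rw [abs_mul, abs_pow]
    exact mul_le_one₀ (hμ i) (by positivity) (pow_le_one₀ (abs_nonneg _) (ht1 i))
  have hb := kornBound_le_mul hh (by positivity : (0 : ℝ) ≤ 18 * n ^ 2)
    (wsq_sum_comp_le hV.continuousOn hV.nonneg hW hW0 hμ ht0 ht6 hVW hm mu)
    (wsq_sum_comp_le hV.continuousOn hV.nonneg hW hW0 hμ ht0 ht6 hVW hm mux)
    (wsq_sum_comp_le hV.continuousOn hV.nonneg hW hW0 hμt ht0 ht6 hVW hm (muy.add hF))
    (wsq_sum_comp_le hV.continuousOn hV.nonneg hW hW0 hμt2 ht0 ht6 hVW hm hG)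
  -- The rescaled fields have been normalised so that the shear of the combination is again a
  -- combination of rescaled shears, with coefficients `μ i * t i`.
  have eD : (fun p => pdy U p + ∑ i, μ i * (t i * F (diagAffine 1 0 (t i) (s i) p))) =
      fun p => ∑ i, μ i * t i * (pdy u + F) (diagAffine 1 0 (t i) (s i) p) := by
    funext p
    rw [hUy, ← Finset.sum_add_distrib]
    exact Finset.sum_congr rfl fun i _ => by simp only [Pi.add_apply]; ring
  have eG : (fun p => ∑ i, μ i * (t i ^ 2 / 1 * G (diagAffine 1 0 (t i) (s i) p))) =
      fun p => ∑ i, μ i * t i ^ 2 * G (diagAffine 1 0 (t i) (s i) p) := by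
    funext p
    exact Finset.sum_congr rfl fun i _ => by ring
  rw [eD, eG, hUy] at key
  have hpos := kornBound_nonneg hh hW0 u (pdx u) (pdy u + F) G
  calc _ ≤ _ := key
    _ ≤ C * (18 * n ^ 2 * kornBound h a W u (pdx u) (pdy u + F) G) := by gcongr
    _ ≤ C * (18 * n ^ 2 + 1) * kornBound h a W u (pdx u) (pdy u + F) G := by nlinarith
    _ = _ := rfl

/-! ### Power-like weights and the Korn inequality with equal boundary values -/

/-- The properties of a power-like weight on `[0, a]` that enter the Korn inequality. -/
structure PowerLikeWeight (a K θ : ℝ) (W : ℝ → ℝ) : Prop where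
  continuousOn : ContinuousOn W (Icc 0 a)
  nonneg : ∀ y ∈ Icc 0 a, 0 ≤ W y
  mono : MonotoneOn W (Icc 0 a)
  doubling : ∀ y ∈ Icc 0 (a / 2), W (2 * y) ≤ 2 * θ * W y
  top_le : ∀ y ∈ Icc (a / 3) a, W a ≤ 3 * W y
  concave : ∀ ζ ∈ Ioc (0 : ℝ) 1, ∃ V₁ V₂, ConcaveWeight a K (fun y => W (ζ * y)) V₁ V₂

/-- Needed near the far side, where the weight is frozen at its maximal value; all derivatives
vanish, so any `K` is admissible. -/
theorem concaveWeight_const {a K c : ℝ} (hc : 0 ≤ c) :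
    ConcaveWeight a K (fun _ => c) (fun _ => 0) (fun _ => 0) where
  smooth _ _ := contDiffAt_const
  hasDerivAt _ _ := hasDerivAt_const _ _
  hasDerivAt₁ _ _ := hasDerivAt_const _ _
  continuousOn₂ := continuousOn_const
  nonneg _ _ := hc
  nonpos₂ _ _ := le_rfl
  sq_le _ _ := by simp

theorem setIntegral_comp_vertical {h a t s b c : ℝ} (ht : t ≠ 0)
    (hI : ∀ y, t * y + s ∈ Ioo b c ↔ y ∈ Ioo 0 a) (g : ℝ × ℝ → ℝ) :
    ∫ p in rect h a, g (diagAffine 1 0 t s p) = |t⁻¹| * ∫ p in Ioo 0 h ×ˢ Ioo b c, g p := by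
  have hpre : diagAffine 1 0 t s ⁻¹' (Ioo 0 h ×ˢ Ioo b c) = rect h a := by
    ext p
    simp only [diagAffine, rect, mem_preimage, mem_prod, one_mul, add_zero, hI]
  have e := setIntegral_comp_diagAffine one_ne_zero ht 0 s g (Ioo 0 h ×ˢ Ioo b c)
  rwa [hpre, one_mul] at e

/-- The weighted integral of `(r f)²` after a vertical change of variables. -/
theorem wsq_comp_vertical {h a t s b c r : ℝ} (ht : t ≠ 0)
    (hI : ∀ y, t * y + s ∈ Ioo b c ↔ y ∈ Ioo 0 a) {V W : ℝ → ℝ}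
    (hVW : ∀ y ∈ Ioo 0 a, V y = W (t * y + s)) (f : ℝ × ℝ → ℝ) :
    wsq h a V (fun p => r * f (diagAffine 1 0 t s p)) =
      r ^ 2 * |t⁻¹| * ∫ p in Ioo 0 h ×ˢ Ioo b c, W p.2 * f p ^ 2 := by
  have e := setIntegral_comp_vertical (h := h) ht hI (fun p => W p.2 * f p ^ 2)
  rw [mul_assoc, ← e, ← integral_const_mul]
  refine setIntegral_congr_fun (measurableSet_rect h a) fun p hp => ?_
  simp only [hVW _ hp.2, diagAffine]
  ring

/-- The point is the coefficient of `y ^ 2`, which may be taken as close to `1` as desired, so that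
the gain `θ < 1` is not lost. -/
theorem sq_le_young {τ x y : ℝ} (hτ : 0 < τ) (z : ℝ) (hz : z = x + y) :
    x ^ 2 ≤ (1 + τ) * y ^ 2 + (1 + τ⁻¹) * z ^ 2 := by
  have h1 : x = z - y := by rw [hz]; ring
  have h2 : 0 ≤ τ⁻¹ * (τ * y + z) ^ 2 := by positivity
  have h3 : τ⁻¹ * (τ * y + z) ^ 2 = τ * y ^ 2 + 2 * y * z + τ⁻¹ * z ^ 2 := by
    field_simp
    ring
  rw [h1]
  nlinarith

/-- Only the coefficient `3 / 2` of the second term matters: it is small enough for that term to be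
absorbed when the functions are the four rescalings of `u_y`. -/
theorem wsq_le_of_sum_four {h a : ℝ} {V : ℝ → ℝ} (hV : ContinuousOn V (Icc 0 a))
    (hV0 : ∀ y ∈ Icc 0 a, 0 ≤ V y) {f₁ f₂ f₃ f₄ : ℝ × ℝ → ℝ}
    (h₁ : MemLp f₁ 2 (volume.restrict (rect h a))) (h₂ : MemLp f₂ 2 (volume.restrict (rect h a)))
    (h₃ : MemLp f₃ 2 (volume.restrict (rect h a))) (h₄ : MemLp f₄ 2 (volume.restrict (rect h a))) :
    wsq h a V f₁ ≤ 3 / 2 * wsq h a V f₂ +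
      9 * wsq h a V (fun p => f₁ p + f₂ p + f₃ p + f₄ p) +
        (9 * wsq h a V f₃ + 9 * wsq h a V f₄) := by
  have hs : MemLp (fun p => f₁ p + f₂ p + f₃ p + f₄ p) 2 (volume.restrict (rect h a)) :=
    ((h₁.add h₂).add h₃).add h₄
  have j₂ := (integrableOn_wsq hV h₂).const_mul (3 / 2)
  have j₃ := (integrableOn_wsq hV h₃).const_mul 9
  have j₄ := (integrableOn_wsq hV h₄).const_mul 9
  have js := (integrableOn_wsq hV hs).const_mul 9
  unfold wsq
  simp only [← integral_const_mul]
  rw [← integral_add' j₃ j₄, ← integral_add' j₂ js, ← integral_add' (j₂.add js) (j₃.add j₄)]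
  refine setIntegral_mono_on (integrableOn_wsq hV h₁) ((j₂.add js).add (j₃.add j₄))
    (measurableSet_rect h a) fun p hp => ?_
  have hv := hV0 _ (rect_subset_Icc h a hp).2
  have hq : f₁ p ^ 2 ≤ 3 / 2 * f₂ p ^ 2 + 9 * (f₁ p + f₂ p + f₃ p + f₄ p) ^ 2 +
      (9 * f₃ p ^ 2 + 9 * f₄ p ^ 2) := by
    generalize f₁ p = x₁, f₂ p = x₂, f₃ p = x₃, f₄ p = x₄
    have e : x₁ ^ 2 ≤ 3 / 2 * x₂ ^ 2 + 3 * (x₁ + x₂) ^ 2 := by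
      nlinarith [sq_nonneg (2 * x₁ + 3 * x₂)]
    have e' : (x₁ + x₂) ^ 2 ≤ 3 * ((x₁ + x₂ + x₃ + x₄) ^ 2 + x₃ ^ 2 + x₄ ^ 2) := by
      nlinarith [sq_nonneg (x₁ + x₂ + x₃ + x₄ + x₃), sq_nonneg (x₁ + x₂ + x₃ + x₄ + x₄),
        sq_nonneg (x₃ - x₄)]
    linarith
  have := mul_le_mul_of_nonneg_left hq hv
  simp only [Pi.add_apply]
  linarith

/-- The standing assumptions on a displacement with smooth first component `u` whose second
component has weak partial derivatives `F` and `G`. -/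
structure KornData (h a : ℝ) (u F G : ℝ × ℝ → ℝ) : Prop where
  width_pos : 0 < h
  height_pos : 0 < a
  smooth : ContDiff ℝ ∞ u
  curlFree : CurlFree (rect h a) F G
  memLp_dx : MemLp F 2 (volume.restrict (rect h a))
  memLp_dy : MemLp G 2 (volume.restrict (rect h a))

/-- Folding the rectangle along the line `y = ζ a`. -/
theorem exists_fold_le {K : ℝ} (hK : 0 ≤ K) :
    ∃ C : ℝ, 0 < C ∧ ∀ {h a θ ζ : ℝ} {W : ℝ → ℝ} {u F G : ℝ × ℝ → ℝ}, KornData h a u F G →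
      PowerLikeWeight a K θ W → (∀ x, u (x, 0) = u (x, a)) → 1 / 2 ≤ ζ → ζ ≤ 2 / 3 →
      wsq h a (fun y => W (ζ * y)) (fun p => ζ * pdy u (diagAffine 1 0 ζ 0 p) +
        (1 - ζ) * pdy u (diagAffine 1 0 (-(1 - ζ)) a p)) ≤
          C * kornBound h a W u (pdx u) (fun p => pdy u p + F p) G := by
  obtain ⟨C₂, hC₂0, hC₂⟩ := exists_korn_combination hK 2
  refine ⟨C₂, hC₂0, ?_⟩
  intro h a θ ζ W u F G hu hW hper h1 h2
  have hh := hu.width_pos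
  have ha := hu.height_pos
  obtain ⟨V₁, V₂, hV⟩ := hW.concave ζ ⟨by linarith, by linarith⟩
  -- The combination `u(x, ζ y) - u(x, a - (1 - ζ) y)` vanishes at `y = 0` by the equality of
  -- boundary values, and at `y = a` because both arguments reach `ζ a`.
  have := hC₂ (u := u) (F := F) (G := G) (μ := ![1, -1]) (t := ![ζ, -(1 - ζ)]) (s := ![0, a])
    hh ha hV hW.continuousOn hW.nonneg hu.smooth hu.curlFree hu.memLp_dx hu.memLp_dy
    (by intro i; fin_cases i <;> simp)
    (by intro i; fin_cases i
        · simp; linarith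
        · simp; linarith)
    (by intro i; fin_cases i
        · simp only [Fin.zero_eta, Matrix.cons_val_zero]; rw [abs_le]; constructor <;> linarith
        · simp only [Fin.mk_one, Matrix.cons_val_one]; rw [abs_le]; constructor <;> simp <;> linarith)
    (by intro i; fin_cases i
        · simp only [Fin.zero_eta, Matrix.cons_val_zero]
          rw [abs_inv, abs_of_pos (by linarith)]
          exact inv_le_of_inv_le₀ (by norm_num) (by linarith)
        · simp only [Fin.mk_one, Matrix.cons_val_one, Matrix.cons_val_fin_one]
          rw [abs_inv, abs_neg, abs_of_pos (by linarith)]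
          exact inv_le_of_inv_le₀ (by norm_num) (by linarith))
    (by
      intro i y hy
      have hy1 : ζ * y ∈ Icc 0 a := ⟨mul_nonneg (by linarith) hy.1.le, by nlinarith [hy.1, hy.2]⟩
      have h3 := hW.nonneg _ hy1
      fin_cases i
      · simp only [Fin.zero_eta, Matrix.cons_val_zero, add_zero]; linarith
      · simp only [Fin.mk_one, Matrix.cons_val_one, Matrix.cons_val_fin_one]
        have hy2 : -(1 - ζ) * y + a ∈ Icc 0 a :=
          ⟨by nlinarith [hy.1, hy.2], by nlinarith [hy.1, hy.2]⟩
        -- The upper branch of the fold lies above the lower one, `ζ y ≤ a - (1 - ζ) y`, so the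
        -- monotone weight is larger there.
        have := hW.mono hy1 hy2 (by nlinarith [hy.2])
        linarith)
    (by
      intro i y hy
      fin_cases i
      · simp only [Fin.zero_eta, Matrix.cons_val_zero, add_zero]
        exact ⟨mul_pos (by linarith) hy.1, by nlinarith [hy.1, hy.2]⟩
      · simp only [Fin.mk_one, Matrix.cons_val_one, Matrix.cons_val_fin_one]
        exact ⟨by nlinarith [hy.1, hy.2], by nlinarith [hy.1, hy.2]⟩)
    (by intro x; simp [Fin.sum_univ_two, hper])
    (by
      intro x
      have e : -(1 - ζ) * a + a = ζ * a := by ring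
      simp only [Fin.sum_univ_two, Matrix.cons_val_zero, Matrix.cons_val_one,
        Matrix.cons_val_fin_one, e, add_zero]
      ring)
  refine le_trans (le_of_eq ?_) this
  congr 1
  funext p
  simp only [Fin.sum_univ_two, Matrix.cons_val_zero, Matrix.cons_val_one,
    Matrix.cons_val_fin_one]
  ring

/-- The weighted bound on the lower two thirds of the rectangle, obtained by comparing two
foldings. -/
theorem exists_lower_le {K θ : ℝ} (hK : 0 ≤ K) (hθ0 : 0 < θ) (hθ1 : θ < 1) :
    ∃ C : ℝ, 0 < C ∧ ∀ {h a : ℝ} {W : ℝ → ℝ} {u F G : ℝ × ℝ → ℝ}, KornData h a u F G →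
      PowerLikeWeight a K θ W → (∀ x, u (x, 0) = u (x, a)) →
      ∫ p in Ioo 0 h ×ˢ Ioo 0 (2 * a / 3), W p.2 * pdy u p ^ 2 ≤
        C * kornBound h a W u (pdx u) (fun p => pdy u p + F p) G := by
  obtain ⟨C₂, hC₂0, hC₂⟩ := exists_fold_le hK
  -- Small enough that `(1 + τ)² θ ≤ 1 - (1 - θ) / 3`, so two uses of Young's inequality still leave
  -- a contraction.
  set τ : ℝ := (1 - θ) / 3 with hτ
  have hτ0 : 0 < τ := by rw [hτ]; linarith
  set C' : ℝ := 3 / (1 - θ) * ((1 + τ) * θ * (2 * (1 + τ⁻¹) * C₂) + 3 / 2 * (1 + τ⁻¹) * C₂) with hC'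
  have h1θ : 0 < 1 - θ := by linarith
  have hC'0 : 0 < C' := by positivity
  refine ⟨C', hC'0, ?_⟩
  intro h a W u F G hu hW hper
  have hh := hu.width_pos
  have ha := hu.height_pos
  set E := kornBound h a W u (pdx u) (fun p => pdy u p + F p) G with hE
  have cp : Continuous (pdy u) := (contDiff_fderiv_apply hu.smooth _).continuous
  have cW : ContinuousOn (fun p : ℝ × ℝ => W p.2) (Icc 0 h ×ˢ Icc 0 a) :=
    continuousOn_comp_snd hW.continuousOn
  have cΦ : ∀ t s : ℝ, Continuous (fun p => pdy u (diagAffine 1 0 t s p)) := fun t s =>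
    cp.comp (contDiff_diagAffine _ _ _ _).continuous
  have iWp : IntegrableOn (fun p => W p.2 * pdy u p ^ 2) (rect h a) :=
    integrableOn_rect_of_continuousOn (cW.mul (cp.pow 2).continuousOn)
  have iWr : IntegrableOn (fun p => W (a - p.2) * pdy u p ^ 2) (rect h a) := by
    refine integrableOn_rect_of_continuousOn (ContinuousOn.mul ?_ (cp.pow 2).continuousOn)
    exact hW.continuousOn.comp (by fun_prop) fun p hp => ⟨by linarith [hp.2.2], by linarith [hp.2.1]⟩
  have hstrip : ∀ b c : ℝ, 0 ≤ b → c ≤ a → Ioo 0 h ×ˢ Ioo b c ⊆ rect h a := fun b c hb hc =>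
    prod_mono subset_rfl (Ioo_subset_Ioo hb hc)
  have mstrip : ∀ b c : ℝ, MeasurableSet (Ioo 0 h ×ˢ Ioo b c) := fun b c =>
    measurableSet_Ioo.prod measurableSet_Ioo
  have nWp : ∀ p ∈ rect h a, 0 ≤ W p.2 * pdy u p ^ 2 := fun p hp =>
    mul_nonneg (hW.nonneg _ (rect_subset_Icc h a hp).2) (sq_nonneg _)
  have nWr : ∀ p ∈ rect h a, 0 ≤ W (a - p.2) * pdy u p ^ 2 := fun p hp =>
    mul_nonneg (hW.nonneg _ ⟨by linarith [hp.2.2], by linarith [hp.2.1]⟩) (sq_nonneg _)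
  set X : ℝ := ∫ p in Ioo 0 h ×ˢ Ioo 0 (a / 2), W p.2 * pdy u p ^ 2 with hX
  set X' : ℝ := ∫ p in Ioo 0 h ×ˢ Ioo 0 (2 * a / 3), W p.2 * pdy u p ^ 2 with hX'
  set Y : ℝ := ∫ p in Ioo 0 h ×ˢ Ioo (a / 2) a, W (a - p.2) * pdy u p ^ 2 with hY
  have hXX' : X ≤ X' :=
    setIntegral_mono_subset (prod_mono subset_rfl (Ioo_subset_Ioo_right (by linarith)))
      (mstrip _ _) (iWp.mono_set (hstrip _ _ le_rfl (by linarith)))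
      fun p hp => nWp p (hstrip _ _ le_rfl (by linarith) hp)
  have hfold := fun ζ h1 h2 => hC₂ (ζ := ζ) hu hW hper h1 h2
  have cWζ : ∀ ζ : ℝ, 1 / 2 ≤ ζ → ζ ≤ 2 / 3 → ContinuousOn (fun y => W (ζ * y)) (Icc 0 a) ∧
      ∀ y ∈ Icc 0 a, 0 ≤ W (ζ * y) := by
    intro ζ h1 h2
    obtain ⟨V₁, V₂, hV⟩ := hW.concave ζ ⟨by linarith, by linarith⟩
    exact ⟨hV.continuousOn, hV.nonneg⟩
  -- The symmetric fold bounds the upper half, with the reflected weight `W (a - y)`, by the lower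
  -- half with weight `W`.
  have hfoldY : 1 / 2 * Y ≤ (1 + τ) * (1 / 2 * X) + (1 + τ⁻¹) * (C₂ * E) := by
    obtain ⟨c1, c2⟩ := cWζ (1 / 2) le_rfl (by norm_num)
    have h1 := hfold (1 / 2) le_rfl (by norm_num)
    have h2 := wsq_le_add (h := h) (c₁ := 1 + τ) (c₂ := 1 + τ⁻¹) c1 c2
      (f := fun p => (1 - 1 / 2) * pdy u (diagAffine 1 0 (-(1 - 1 / 2)) a p))
      (g := fun p => 1 / 2 * pdy u (diagAffine 1 0 (1 / 2) 0 p))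
      (k := fun p => 1 / 2 * pdy u (diagAffine 1 0 (1 / 2) 0 p) +
        (1 - 1 / 2) * pdy u (diagAffine 1 0 (-(1 - 1 / 2)) a p))
      (memLp_rect_of_continuous (continuous_const.mul (cΦ _ _)))
      (memLp_rect_of_continuous (continuous_const.mul (cΦ _ _)))
      (memLp_rect_of_continuous ((continuous_const.mul (cΦ _ _)).add
        (continuous_const.mul (cΦ _ _))))
      (fun p _ => sq_le_young hτ0 _ (by ring))
    rw [wsq_comp_vertical (b := a / 2) (c := a) (W := fun y => W (a - y)) (by norm_num)
        (fun y => by simp only [mem_Ioo]; constructor <;> rintro ⟨h3, h4⟩ <;> constructor <;> linarith)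
        (fun y _ => by congr 1; ring),
      wsq_comp_vertical (b := 0) (c := a / 2) (W := W) (by norm_num)
        (fun y => by simp only [mem_Ioo]; constructor <;> rintro ⟨h3, h4⟩ <;> constructor <;> linarith)
        (fun y _ => by rw [add_zero])] at h2
    have e1 : ((1 : ℝ) - 1 / 2) ^ 2 * |(-(1 - 1 / 2) : ℝ)⁻¹| = 1 / 2 := by norm_num
    have e2 : (1 / 2 : ℝ) ^ 2 * |(1 / 2 : ℝ)⁻¹| = 1 / 2 := by norm_num
    rw [e1, e2] at h2
    have h3 := mul_le_mul_of_nonneg_left h1 (by positivity : 0 ≤ 1 + τ⁻¹)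
    linarith
  -- The fold at `2a/3` brings the weight `W (2 (a - y))` onto the upper third. Its coefficient is
  -- `1 / 3` against `2 / 3`, so doubling the weight would just balance the two sides; the doubling
  -- constant `2 θ` leaves the factor `θ < 1`.
  have hfoldX : 2 / 3 * X' ≤ (1 + τ) * (2 / 3 * θ * Y) + (1 + τ⁻¹) * (C₂ * E) := by
    obtain ⟨c1, c2⟩ := cWζ (2 / 3) (by norm_num) le_rfl
    have h1 := hfold (2 / 3) (by norm_num) le_rfl
    have h2 := wsq_le_add (h := h) (c₁ := 1 + τ) (c₂ := 1 + τ⁻¹) c1 c2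
      (f := fun p => 2 / 3 * pdy u (diagAffine 1 0 (2 / 3) 0 p))
      (g := fun p => (1 - 2 / 3) * pdy u (diagAffine 1 0 (-(1 - 2 / 3)) a p))
      (k := fun p => 2 / 3 * pdy u (diagAffine 1 0 (2 / 3) 0 p) +
        (1 - 2 / 3) * pdy u (diagAffine 1 0 (-(1 - 2 / 3)) a p))
      (memLp_rect_of_continuous (continuous_const.mul (cΦ _ _)))
      (memLp_rect_of_continuous (continuous_const.mul (cΦ _ _)))
      (memLp_rect_of_continuous ((continuous_const.mul (cΦ _ _)).add
        (continuous_const.mul (cΦ _ _))))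
      (fun p _ => sq_le_young hτ0 _ (by ring))
    rw [wsq_comp_vertical (b := 0) (c := 2 * a / 3) (W := W) (by norm_num)
        (fun y => by simp only [mem_Ioo]; constructor <;> rintro ⟨h3, h4⟩ <;> constructor <;> linarith)
        (fun y _ => by rw [add_zero]),
      wsq_comp_vertical (b := 2 * a / 3) (c := a) (W := fun y => W (2 * (a - y))) (by norm_num)
        (fun y => by simp only [mem_Ioo]; constructor <;> rintro ⟨h3, h4⟩ <;> constructor <;> linarith)
        (fun y _ => by congr 1; ring)] at h2
    have e1 : ((1 : ℝ) - 2 / 3) ^ 2 * |(-(1 - 2 / 3) : ℝ)⁻¹| = 1 / 3 := by norm_num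
    have e2 : (2 / 3 : ℝ) ^ 2 * |(2 / 3 : ℝ)⁻¹| = 2 / 3 := by norm_num
    rw [e1, e2] at h2
    have h3 := mul_le_mul_of_nonneg_left h1 (by positivity : 0 ≤ 1 + τ⁻¹)
    have hs : Ioo 0 h ×ˢ Ioo (2 * a / 3) a ⊆ Ioo 0 h ×ˢ Ioo (a / 2) a :=
      prod_mono subset_rfl (Ioo_subset_Ioo_left (by linarith))
    have iY : IntegrableOn (fun p => W (a - p.2) * pdy u p ^ 2) (Ioo 0 h ×ˢ Ioo (a / 2) a) :=
      iWr.mono_set (hstrip _ _ (by linarith) le_rfl)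
    have h4 : (∫ p in Ioo 0 h ×ˢ Ioo (2 * a / 3) a, W (2 * (a - p.2)) * pdy u p ^ 2) ≤
        2 * θ * Y := by
      calc _ ≤ ∫ p in Ioo 0 h ×ˢ Ioo (2 * a / 3) a, 2 * θ * (W (a - p.2) * pdy u p ^ 2) := by
            refine setIntegral_mono_on ?_ ((iY.mono_set hs).const_mul _) (mstrip _ _)
              fun p hp => ?_
            · have c3 : ContinuousOn (fun p : ℝ × ℝ => W (2 * (a - p.2)) * pdy u p ^ 2)
                  (Icc 0 h ×ˢ Icc (2 * a / 3) a) := by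
                refine ContinuousOn.mul ?_ (cp.pow 2).continuousOn
                exact hW.continuousOn.comp (by fun_prop) fun p hp =>
                  ⟨by linarith [hp.2.2], by linarith [hp.2.1]⟩
              exact (c3.integrableOn_compact (isCompact_Icc.prod isCompact_Icc)).mono_set
                (prod_mono Ioo_subset_Icc_self Ioo_subset_Icc_self)
            · rw [← mul_assoc]
              exact mul_le_mul_of_nonneg_right
                (hW.doubling _ ⟨by linarith [hp.2.2], by linarith [hp.2.1]⟩) (sq_nonneg _)
        _ = 2 * θ * ∫ p in Ioo 0 h ×ˢ Ioo (2 * a / 3) a, W (a - p.2) * pdy u p ^ 2 := by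
            rw [integral_const_mul]
        _ ≤ 2 * θ * Y := by
            gcongr
            exact setIntegral_mono_subset hs (mstrip _ _) iY
              fun p hp => nWr p (hstrip _ _ (by linarith) le_rfl hp)
    have h5 := mul_le_mul_of_nonneg_left h4 (by positivity : 0 ≤ (1 + τ) * (1 / 3))
    linarith
  have hX'0 : 0 ≤ X' := setIntegral_nonneg (mstrip _ _)
    fun p hp => nWp p (hstrip _ _ le_rfl (by linarith) hp)
  have h1 : Y ≤ (1 + τ) * X' + 2 * (1 + τ⁻¹) * C₂ * E := by
    have := mul_le_mul_of_nonneg_left hXX' (by positivity : 0 ≤ 1 + τ)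
    linarith
  -- Together with `h1` this bounds `X'` by `(1 + τ)² θ X'` plus multiples of `E`.
  have h2 : X' ≤ (1 + τ) * θ * Y + 3 / 2 * (1 + τ⁻¹) * C₂ * E := by linarith
  have h3 := mul_le_mul_of_nonneg_left h1 (by positivity : 0 ≤ (1 + τ) * θ)
  have h4 : (1 + τ) * θ * (1 + τ) ≤ 1 - (1 - θ) / 3 := by
    rw [hτ]; nlinarith [mul_pos h1θ h1θ, mul_pos (mul_pos h1θ h1θ) h1θ]
  have h5 := mul_le_mul_of_nonneg_right h4 hX'0
  have h6 : (1 - θ) / 3 * X' ≤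
      ((1 + τ) * θ * (2 * (1 + τ⁻¹) * C₂) + 3 / 2 * (1 + τ⁻¹) * C₂) * E := by linarith
  calc X' = 3 / (1 - θ) * ((1 - θ) / 3 * X') := by field_simp
    _ ≤ 3 / (1 - θ) * (((1 + τ) * θ * (2 * (1 + τ⁻¹) * C₂) + 3 / 2 * (1 + τ⁻¹) * C₂) * E) := by
        gcongr
    _ = C' * E := by rw [hC']; ring

/-- The bound on the upper two thirds of the rectangle in terms of the middle third. -/
theorem exists_upper_le {K : ℝ} (hK : 0 ≤ K) :
    ∃ C : ℝ, 0 < C ∧ ∀ {h a θ : ℝ} {W : ℝ → ℝ} {u F G : ℝ × ℝ → ℝ}, KornData h a u F G →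
      PowerLikeWeight a K θ W →
      ∫ p in Ioo 0 h ×ˢ Ioo (a / 3) a, W a * pdy u p ^ 2 ≤
        54 * (∫ p in Ioo 0 h ×ˢ Ioo 0 (2 * a / 3), W p.2 * pdy u p ^ 2) +
          54 * (C * kornBound h a W u (pdx u) (fun p => pdy u p + F p) G) := by
  obtain ⟨C₄, hC₄0, hC₄⟩ := exists_korn_combination hK 4
  refine ⟨C₄, hC₄0, ?_⟩
  intro h a θ W u F G hu hW
  have hh := hu.width_pos
  have ha := hu.height_pos
  set E := kornBound h a W u (pdx u) (fun p => pdy u p + F p) G with hE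
  have cp : Continuous (pdy u) := (contDiff_fderiv_apply hu.smooth _).continuous
  have cW : ContinuousOn (fun p : ℝ × ℝ => W p.2) (Icc 0 h ×ˢ Icc 0 a) :=
    continuousOn_comp_snd hW.continuousOn
  have cΦ : ∀ t s : ℝ, Continuous (fun p => pdy u (diagAffine 1 0 t s p)) := fun t s =>
    cp.comp (contDiff_diagAffine _ _ _ _).continuous
  have iWp : IntegrableOn (fun p => W p.2 * pdy u p ^ 2) (rect h a) :=
    integrableOn_rect_of_continuousOn (cW.mul (cp.pow 2).continuousOn)
  have ip : IntegrableOn (fun p => W a * pdy u p ^ 2) (rect h a) :=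
    integrableOn_rect_of_continuousOn (continuousOn_const.mul (cp.pow 2).continuousOn)
  have hstrip : ∀ b c : ℝ, 0 ≤ b → c ≤ a → Ioo 0 h ×ˢ Ioo b c ⊆ rect h a := fun b c hb hc =>
    prod_mono subset_rfl (Ioo_subset_Ioo hb hc)
  have mstrip : ∀ b c : ℝ, MeasurableSet (Ioo 0 h ×ˢ Ioo b c) := fun b c =>
    measurableSet_Ioo.prod measurableSet_Ioo
  have nWp : ∀ p ∈ rect h a, 0 ≤ W p.2 * pdy u p ^ 2 := fun p hp =>
    mul_nonneg (hW.nonneg _ (rect_subset_Icc h a hp).2) (sq_nonneg _)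
  have hWa0 : 0 ≤ W a := hW.nonneg a ⟨ha.le, le_rfl⟩
  set X' : ℝ := ∫ p in Ioo 0 h ×ˢ Ioo 0 (2 * a / 3), W p.2 * pdy u p ^ 2 with hX'
  set Z : ℝ := ∫ p in Ioo 0 h ×ˢ Ioo (a / 3) a, W a * pdy u p ^ 2 with hZ
  -- The combination is `u(a - 2y/3) - u(a - y/3) + u(a/2 + y/6) - u(a/2 - y/6)` in the vertical
  -- variable. At `y = 0` it cancels in the pairs at `a` and `a / 2`, at `y = a` in the pairs at `a
  -- / 3` and `2a / 3`; equality of boundary values is not used. All arguments stay above `a / 3`,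
  -- where `W a ≤ 3 W`.
  have hcross : wsq h a (fun _ => W a) (fun p =>
      -(2 / 3) * pdy u (diagAffine 1 0 (-(2 / 3)) a p) +
        1 / 3 * pdy u (diagAffine 1 0 (-(1 / 3)) a p) +
        1 / 6 * pdy u (diagAffine 1 0 (1 / 6) (a / 2) p) +
        1 / 6 * pdy u (diagAffine 1 0 (-(1 / 6)) (a / 2) p)) ≤ C₄ * E := by
    have hin : ∀ i, ∀ y ∈ Ioo 0 a,
        (![-(2 / 3), -(1 / 3), 1 / 6, -(1 / 6)] : Fin 4 → ℝ) i * y +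
          (![a, a, a / 2, a / 2] : Fin 4 → ℝ) i ∈ Ioo (a / 3) a := by
      intro i y hy
      have := hy.1
      have := hy.2
      fin_cases i <;> simp <;> constructor <;> linarith
    have := hC₄ (u := u) (F := F) (G := G) (μ := ![1, -1, 1, -1])
      (t := ![-(2 / 3), -(1 / 3), 1 / 6, -(1 / 6)]) (s := ![a, a, a / 2, a / 2])
      hh ha (concaveWeight_const hWa0) hW.continuousOn hW.nonneg hu.smooth hu.curlFree hu.memLp_dx hu.memLp_dy
      (by intro i; fin_cases i <;> simp)
      (by intro i; fin_cases i <;> simp)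
      (by intro i; fin_cases i <;> simp [abs_div] <;> norm_num)
      (by intro i; fin_cases i <;> simp [abs_div] <;> norm_num)
      (fun i y hy => hW.top_le _ (Ioo_subset_Icc_self (hin i y hy)))
      (fun i y hy => Ioo_subset_Ioo_left (by positivity) (hin i y hy))
      (by intro x; simp [Fin.sum_univ_four])
      (by
        intro x
        have e1 : -(2 / 3) * a + a = a / 3 := by ring
        have e2 : -(1 / 3) * a + a = 2 * a / 3 := by ring
        have e3 : 1 / 6 * a + a / 2 = 2 * a / 3 := by ring
        have e4 : -(1 / 6) * a + a / 2 = a / 3 := by ring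
        simp only [Fin.sum_univ_four, Matrix.cons_val]
        rw [e1, e2, e3, e4]
        ring)
    refine le_trans (le_of_eq ?_) this
    congr 1
    funext p
    simp only [Fin.sum_univ_four, Matrix.cons_val]
    ring
  have cc : ContinuousOn (fun _ : ℝ => W a) (Icc 0 a) := continuousOn_const
  have c0 : ∀ y ∈ Icc 0 a, 0 ≤ (fun _ : ℝ => W a) y := fun _ _ => hWa0
  have q1 : Continuous fun p => -(2 / 3) * pdy u (diagAffine 1 0 (-(2 / 3)) a p) :=
    continuous_const.mul (cΦ _ _)
  have q2 : Continuous fun p => 1 / 3 * pdy u (diagAffine 1 0 (-(1 / 3)) a p) :=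
    continuous_const.mul (cΦ _ _)
  have q3 : Continuous fun p => 1 / 6 * pdy u (diagAffine 1 0 (1 / 6) (a / 2) p) :=
    continuous_const.mul (cΦ _ _)
  have q4 : Continuous fun p => 1 / 6 * pdy u (diagAffine 1 0 (-(1 / 6)) (a / 2) p) :=
    continuous_const.mul (cΦ _ _)
  -- After the changes of variables the first term is `2/3` of the integral over `(a/3, a)` and the
  -- second `1/3` of that over `(2a/3, a)`. Since `3/2 * 1/3 < 2/3`, the second is absorbed, leaving
  -- a factor `1 / 6`; the last two live in the middle third.
  have h1 := wsq_le_of_sum_four (h := h) cc c0 (memLp_rect_of_continuous q1)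
    (memLp_rect_of_continuous q2) (memLp_rect_of_continuous q3) (memLp_rect_of_continuous q4)
  have v1 := wsq_comp_vertical (h := h) (a := a) (t := -(2 / 3)) (s := a) (b := a / 3) (c := a)
    (r := -(2 / 3)) (V := fun _ => W a) (W := fun _ => W a) (by norm_num)
    (fun y => by simp only [mem_Ioo]; constructor <;> rintro ⟨h3, h4⟩ <;> constructor <;> linarith)
    (fun y _ => rfl) (pdy u)
  have v2 := wsq_comp_vertical (h := h) (a := a) (t := -(1 / 3)) (s := a) (b := 2 * a / 3) (c := a)
    (r := 1 / 3) (V := fun _ => W a) (W := fun _ => W a) (by norm_num)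
    (fun y => by simp only [mem_Ioo]; constructor <;> rintro ⟨h3, h4⟩ <;> constructor <;> linarith)
    (fun y _ => rfl) (pdy u)
  have v3 := wsq_comp_vertical (h := h) (a := a) (t := 1 / 6) (s := a / 2) (b := a / 2)
    (c := 2 * a / 3) (r := 1 / 6) (V := fun _ => W a) (W := fun _ => W a) (by norm_num)
    (fun y => by simp only [mem_Ioo]; constructor <;> rintro ⟨h3, h4⟩ <;> constructor <;> linarith)
    (fun y _ => rfl) (pdy u)
  have v4 := wsq_comp_vertical (h := h) (a := a) (t := -(1 / 6)) (s := a / 2) (b := a / 3)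
    (c := a / 2) (r := 1 / 6) (V := fun _ => W a) (W := fun _ => W a) (by norm_num)
    (fun y => by simp only [mem_Ioo]; constructor <;> rintro ⟨h3, h4⟩ <;> constructor <;> linarith)
    (fun y _ => rfl) (pdy u)
  have n1 : (-(2 / 3) : ℝ) ^ 2 * |(-(2 / 3) : ℝ)⁻¹| = 2 / 3 := by norm_num [abs_div]
  have n2 : (1 / 3 : ℝ) ^ 2 * |(-(1 / 3) : ℝ)⁻¹| = 1 / 3 := by norm_num
  have n3 : (1 / 6 : ℝ) ^ 2 * |(1 / 6 : ℝ)⁻¹| = 1 / 6 := by norm_num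
  have n4 : (1 / 6 : ℝ) ^ 2 * |(-(1 / 6) : ℝ)⁻¹| = 1 / 6 := by norm_num
  rw [n1] at v1
  rw [n2] at v2
  rw [n3] at v3
  rw [n4] at v4
  have z2 : (∫ p in Ioo 0 h ×ˢ Ioo (2 * a / 3) a, W a * pdy u p ^ 2) ≤ Z :=
    setIntegral_mono_subset (prod_mono subset_rfl (Ioo_subset_Ioo_left (by linarith)))
      (mstrip _ _) (ip.mono_set (hstrip _ _ (by positivity) le_rfl))
      fun p _ => mul_nonneg hWa0 (sq_nonneg _)
  have zmid : ∀ b c : ℝ, a / 3 ≤ b → c ≤ 2 * a / 3 →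
      (∫ p in Ioo 0 h ×ˢ Ioo b c, W a * pdy u p ^ 2) ≤ 3 * X' := by
    intro b c hb hcc
    have hs1 : Ioo 0 h ×ˢ Ioo b c ⊆ Ioo 0 h ×ˢ Ioo 0 (2 * a / 3) :=
      prod_mono subset_rfl (Ioo_subset_Ioo (by linarith) hcc)
    have hs2 : Ioo 0 h ×ˢ Ioo 0 (2 * a / 3) ⊆ rect h a := hstrip _ _ le_rfl (by linarith)
    calc _ ≤ ∫ p in Ioo 0 h ×ˢ Ioo b c, 3 * (W p.2 * pdy u p ^ 2) := by
          refine setIntegral_mono_on (ip.mono_set (hs1.trans hs2))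
            ((iWp.mono_set (hs1.trans hs2)).const_mul 3) (mstrip _ _) fun p hp => ?_
          rw [← mul_assoc]
          exact mul_le_mul_of_nonneg_right
            (hW.top_le _ ⟨by linarith [hp.2.1], by linarith [hp.2.2]⟩) (sq_nonneg _)
      _ = 3 * ∫ p in Ioo 0 h ×ˢ Ioo b c, W p.2 * pdy u p ^ 2 := by rw [integral_const_mul]
      _ ≤ 3 * X' := by
          gcongr
          exact setIntegral_mono_subset hs1 (mstrip _ _) (iWp.mono_set hs2)
            fun p hp => nWp p (hs2 hp)
  have z3 := zmid (a / 2) (2 * a / 3) (by linarith) le_rfl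
  have z4 := zmid (a / 3) (a / 2) le_rfl (by linarith)
  rw [v1, v2, v3, v4] at h1
  linarith

/-- Weighted Korn inequality for a smooth first component that takes equal values on the two
horizontal sides. -/
theorem exists_korn_periodic {K θ : ℝ} (hK : 0 ≤ K) (hθ0 : 0 < θ) (hθ1 : θ < 1) :
    ∃ C : ℝ, 0 < C ∧ ∀ {h a : ℝ} {W : ℝ → ℝ} {u F G : ℝ × ℝ → ℝ}, KornData h a u F G →
      PowerLikeWeight a K θ W → (∀ x, u (x, 0) = u (x, a)) →
      wsq h a W (pdy u) ≤ C * kornBound h a W u (pdx u) (fun p => pdy u p + F p) G := by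
  obtain ⟨C', hC'0, hC'⟩ := exists_lower_le hK hθ0 hθ1
  obtain ⟨C₄, hC₄0, hC₄⟩ := exists_upper_le hK
  refine ⟨C' + (54 * C' + 54 * C₄), by positivity, ?_⟩
  intro h a W u F G hu hW hper
  have hh := hu.width_pos
  have ha := hu.height_pos
  have hX'E := hC' hu hW hper
  have hZE := hC₄ hu hW
  set E := kornBound h a W u (pdx u) (fun p => pdy u p + F p) G with hE
  have cp : Continuous (pdy u) := (contDiff_fderiv_apply hu.smooth _).continuous
  have cW : ContinuousOn (fun p : ℝ × ℝ => W p.2) (Icc 0 h ×ˢ Icc 0 a) :=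
    continuousOn_comp_snd hW.continuousOn
  have iWp : IntegrableOn (fun p => W p.2 * pdy u p ^ 2) (rect h a) :=
    integrableOn_rect_of_continuousOn (cW.mul (cp.pow 2).continuousOn)
  have ip : IntegrableOn (fun p => W a * pdy u p ^ 2) (rect h a) :=
    integrableOn_rect_of_continuousOn (continuousOn_const.mul (cp.pow 2).continuousOn)
  have hstrip : ∀ b c : ℝ, 0 ≤ b → c ≤ a → Ioo 0 h ×ˢ Ioo b c ⊆ rect h a := fun b c hb hc =>
    prod_mono subset_rfl (Ioo_subset_Ioo hb hc)
  have mstrip : ∀ b c : ℝ, MeasurableSet (Ioo 0 h ×ˢ Ioo b c) := fun b c =>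
    measurableSet_Ioo.prod measurableSet_Ioo
  have nWp : ∀ p ∈ rect h a, 0 ≤ W p.2 * pdy u p ^ 2 := fun p hp =>
    mul_nonneg (hW.nonneg _ (rect_subset_Icc h a hp).2) (sq_nonneg _)
  set X' : ℝ := ∫ p in Ioo 0 h ×ˢ Ioo 0 (2 * a / 3), W p.2 * pdy u p ^ 2 with hX'
  set Z : ℝ := ∫ p in Ioo 0 h ×ˢ Ioo (a / 3) a, W a * pdy u p ^ 2 with hZ
  -- The strips overlap in the middle third; on the upper one the weight is replaced by its maximum
  -- `W a`.
  have hfinal : wsq h a W (pdy u) ≤ X' + Z := by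
    have hs1 : Ioo 0 h ×ˢ Ioo 0 (2 * a / 3) ⊆ rect h a := hstrip _ _ le_rfl (by linarith)
    have hs2 : Ioo 0 h ×ˢ Ioo (a / 3) a ⊆ rect h a := hstrip _ _ (by positivity) le_rfl
    have hcover : rect h a ⊆ Ioo 0 h ×ˢ Ioo 0 (2 * a / 3) ∪ Ioo 0 h ×ˢ Ioo (a / 3) a := by
      rintro p ⟨h1, h2, h3⟩
      rcases lt_or_ge p.2 (2 * a / 3) with h4 | h4
      · exact Or.inl ⟨h1, h2, h4⟩
      · exact Or.inr ⟨h1, by linarith, h3⟩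
    have h1 : (∫ p in Ioo 0 h ×ˢ Ioo (a / 3) a, W p.2 * pdy u p ^ 2) ≤ Z := by
      refine setIntegral_mono_on (iWp.mono_set hs2) (ip.mono_set hs2) (mstrip _ _) fun p hp => ?_
      exact mul_le_mul_of_nonneg_right (hW.mono (rect_subset_Icc h a (hs2 hp)).2 ⟨ha.le, le_rfl⟩
        hp.2.2.le) (sq_nonneg _)
    refine le_trans ?_ (add_le_add le_rfl h1)
    refine le_trans ?_ (setIntegral_union_le (mstrip _ _) (mstrip _ _) (iWp.mono_set hs1)
      (iWp.mono_set hs2) fun p hp => nWp p (hs2 hp))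
    refine setIntegral_mono_subset hcover ((mstrip _ _).union (mstrip _ _))
      ((iWp.mono_set hs1).union (iWp.mono_set hs2)) ?_
    rintro p (hp | hp)
    · exact nWp p (hs1 hp)
    · exact nWp p (hs2 hp)
  linarith

/-! ### Sums of powers as weights -/

/-- The sum of powers `∑ᵢ cᵢ r ^ αᵢ`. -/
noncomputable def powSum {k : ℕ} (c α : Fin k → ℝ) (r : ℝ) : ℝ := ∑ i, c i * r ^ α i

section powSum

variable {k : ℕ} {c α : Fin k → ℝ} {β : ℝ}

theorem powSum_nonneg (hc : ∀ i, 0 ≤ c i) {r : ℝ} (hr : 0 ≤ r) : 0 ≤ powSum c α r :=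
  Finset.sum_nonneg fun i _ => mul_nonneg (hc i) (Real.rpow_nonneg hr _)

theorem powSum_mono (hc : ∀ i, 0 ≤ c i) (hα : ∀ i, 0 ≤ α i ∧ α i ≤ β) {r r' : ℝ} (hr : 0 ≤ r)
    (hrr : r ≤ r') : powSum c α r ≤ powSum c α r' :=
  Finset.sum_le_sum fun i _ =>
    mul_le_mul_of_nonneg_left (Real.rpow_le_rpow hr hrr (hα i).1) (hc i)

theorem powSum_mul_le (hc : ∀ i, 0 ≤ c i) (hα : ∀ i, 0 ≤ α i ∧ α i ≤ β) {r m : ℝ} (hr : 0 ≤ r)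
    (hm : 1 ≤ m) : powSum c α (m * r) ≤ m ^ β * powSum c α r := by
  unfold powSum
  rw [Finset.mul_sum]
  refine Finset.sum_le_sum fun i _ => ?_
  rw [Real.mul_rpow (by linarith) hr]
  have h1 : m ^ α i ≤ m ^ β := Real.rpow_le_rpow_of_exponent_le hm (hα i).2
  have h2 : 0 ≤ c i * r ^ α i := mul_nonneg (hc i) (Real.rpow_nonneg hr _)
  nlinarith

theorem contDiffAt_powSum {r : ℝ} (hr : 0 < r) : ContDiffAt ℝ ∞ (powSum c α) r :=
  ContDiffAt.sum fun _ _ => contDiffAt_const.mul (Real.contDiffAt_rpow_const_of_ne hr.ne')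

theorem hasDerivAt_powSum {r : ℝ} (hr : 0 < r) :
    HasDerivAt (powSum c α) (powSum (fun i => c i * α i) (fun i => α i - 1) r) r := by
  have : HasDerivAt (fun r => ∑ i, c i * r ^ α i) (∑ i, c i * (α i * r ^ (α i - 1))) r :=
    HasDerivAt.fun_sum fun i _ => (Real.hasDerivAt_rpow_const (Or.inl hr.ne')).const_mul (c i)
  refine this.congr_deriv (Finset.sum_congr rfl fun i _ => by ring)

/-- Multiplying a derivative by `r` multiplies each power by its exponent (`αᵢ`, then `αᵢ - 1`), so
`αᵢ ≤ β` gives the bounds term by term. -/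
theorem powSum_deriv_bounds (hc : ∀ i, 0 ≤ c i) (hα : ∀ i, 0 ≤ α i ∧ α i ≤ β) {r : ℝ}
    (hr : 0 < r) :
    0 ≤ powSum (fun i => c i * α i) (fun i => α i - 1) r ∧
    r * powSum (fun i => c i * α i) (fun i => α i - 1) r ≤ β * powSum c α r ∧
    r * powSum (fun i => c i * α i * (α i - 1)) (fun i => α i - 1 - 1) r ≤
      (β - 1) * powSum (fun i => c i * α i) (fun i => α i - 1) r := by
  refine ⟨powSum_nonneg (fun i => mul_nonneg (hc i) (hα i).1) hr.le, ?_, ?_⟩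
  · unfold powSum
    rw [Finset.mul_sum, Finset.mul_sum]
    refine Finset.sum_le_sum fun i _ => ?_
    have h1 : r * r ^ (α i - 1) = r ^ α i := by
      rw [Real.rpow_sub_one hr.ne']; field_simp
    have h2 : 0 ≤ c i * r ^ α i := mul_nonneg (hc i) (Real.rpow_nonneg hr.le _)
    calc _ = α i * (c i * r ^ α i) := by rw [← h1]; ring
      _ ≤ β * (c i * r ^ α i) := by gcongr; exact (hα i).2
  · unfold powSum
    rw [Finset.mul_sum, Finset.mul_sum]
    refine Finset.sum_le_sum fun i _ => ?_
    have h1 : r * r ^ (α i - 1 - 1) = r ^ (α i - 1) := by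
      rw [Real.rpow_sub_one hr.ne' (α i - 1)]; field_simp
    have h2 : 0 ≤ c i * α i * r ^ (α i - 1) :=
      mul_nonneg (mul_nonneg (hc i) (hα i).1) (Real.rpow_nonneg hr.le _)
    calc _ = (α i - 1) * (c i * α i * r ^ (α i - 1)) := by rw [← h1]; ring
      _ ≤ (β - 1) * (c i * α i * r ^ (α i - 1)) := by gcongr; exact (hα i).2

/-- The squares of sums of powers with exponents at most `β < 1/2` are concave weights. -/
theorem concaveWeight_powSum (hβ : β < 1 / 2) (hc : ∀ i, 0 ≤ c i)
    (hα : ∀ i, 0 ≤ α i ∧ α i ≤ β) {a ε ζ : ℝ} (hε : 0 < ε) (hζ : 0 < ζ) :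
    ∃ V₁ V₂, ConcaveWeight a (1 / (1 - 2 * β)) (fun y => powSum c α (ζ * y + ε) ^ 2) V₁ V₂ := by
  set f := powSum c α with hf
  set f₁ := powSum (fun i => c i * α i) (fun i => α i - 1) with hf₁
  set f₂ := powSum (fun i => c i * α i * (α i - 1)) (fun i => α i - 1 - 1) with hf₂
  have hr : ∀ y ∈ Icc 0 a, 0 < ζ * y + ε := fun y hy => by
    have := mul_nonneg hζ.le hy.1
    linarith
  have hd : ∀ y ∈ Icc 0 a, HasDerivAt (fun y => f (ζ * y + ε)) (f₁ (ζ * y + ε) * ζ) y := by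
    intro y hy
    have h1 : HasDerivAt (fun y : ℝ => ζ * y + ε) ζ y := by
      simpa using ((hasDerivAt_id y).const_mul ζ).add_const ε
    exact (hasDerivAt_powSum (hr y hy)).comp y h1
  have hd₁ : ∀ y ∈ Icc 0 a, HasDerivAt (fun y => f₁ (ζ * y + ε)) (f₂ (ζ * y + ε) * ζ) y := by
    intro y hy
    have h1 : HasDerivAt (fun y : ℝ => ζ * y + ε) ζ y := by
      simpa using ((hasDerivAt_id y).const_mul ζ).add_const ε
    exact (hasDerivAt_powSum (hr y hy)).comp y h1
  have hβ' : 0 < 1 - 2 * β := by linarith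
  refine ⟨fun y => 2 * f (ζ * y + ε) * (f₁ (ζ * y + ε) * ζ),
    fun y => 2 * (f₁ (ζ * y + ε) * ζ) ^ 2 + 2 * f (ζ * y + ε) * (f₂ (ζ * y + ε) * ζ * ζ), ?_⟩
  -- The derivative bounds give `r (f₁² + f f₂) ≤ -(1 - 2β) f f₁`, which is concavity of `f²`. They
  -- also give `r f₁² ≤ β f f₁`, and comparing the two with `2β ≤ 1` yields the constant `1 / (1 -
  -- 2β)`.
  have key : ∀ y ∈ Icc 0 a, f₁ (ζ * y + ε) ^ 2 + f (ζ * y + ε) * f₂ (ζ * y + ε) ≤ 0 ∧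
      2 * f₁ (ζ * y + ε) ^ 2 ≤
        1 / (1 - 2 * β) * -(f₁ (ζ * y + ε) ^ 2 + f (ζ * y + ε) * f₂ (ζ * y + ε)) := by
    intro y hy
    have hr' := hr y hy
    obtain ⟨b1, b2, b3⟩ := powSum_deriv_bounds hc hα hr'
    have b0 : 0 ≤ f (ζ * y + ε) := powSum_nonneg hc hr'.le
    rw [← hf₁] at b1 b2 b3
    rw [← hf] at b2
    rw [← hf₂] at b3
    generalize f (ζ * y + ε) = F at *
    generalize f₁ (ζ * y + ε) = F₁ at *
    generalize f₂ (ζ * y + ε) = F₂ at *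
    generalize ζ * y + ε = r at *
    have e1 : r * F₁ ^ 2 ≤ β * F * F₁ := by nlinarith
    have e2 : r * (F * F₂) ≤ (β - 1) * (F * F₁) := by nlinarith
    have e3 : 0 ≤ F * F₁ := mul_nonneg b0 b1
    have e4 : r * (F₁ ^ 2 + F * F₂) ≤ -((1 - 2 * β) * (F * F₁)) := by nlinarith
    refine ⟨?_, ?_⟩
    · by_contra hcon
      have := mul_pos hr' (not_le.1 hcon)
      nlinarith [mul_nonneg hβ'.le e3]
    · rw [div_mul_eq_mul_div, one_mul, le_div_iff₀ hβ']
      have : r * (2 * F₁ ^ 2 * (1 - 2 * β)) ≤ r * -(F₁ ^ 2 + F * F₂) := by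
        have e5 : r * F₁ ^ 2 * (1 - 2 * β) ≤ β * F * F₁ * (1 - 2 * β) := by gcongr
        have e6 : 2 * β * ((1 - 2 * β) * (F * F₁)) ≤ (1 - 2 * β) * (F * F₁) :=
          mul_le_of_le_one_left (mul_nonneg hβ'.le e3) (by linarith)
        linarith
      exact le_of_mul_le_mul_left this hr'
  refine ⟨fun y hy => ?_, fun y hy => ?_, fun y hy => ?_, fun y hy => ?_, fun y hy => sq_nonneg _,
    fun y hy => ?_, fun y hy => ?_⟩
  · have h1 : ContDiffAt ℝ ∞ (fun y : ℝ => ζ * y + ε) y := by fun_prop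
    exact (ContDiffAt.comp (g := powSum c α) y (contDiffAt_powSum (hr y hy)) h1).pow 2
  · refine ((hd y hy).pow 2).congr_deriv ?_
    simp
  · refine (((hd y hy).const_mul 2).mul ((hd₁ y hy).mul_const ζ)).congr_deriv ?_
    ring
  · have hc2 : ContinuousAt (fun y => f₂ (ζ * y + ε)) y :=
      ContinuousAt.comp (f := fun y => ζ * y + ε) (contDiffAt_powSum (hr y hy)).continuousAt
        (by fun_prop)
    exact (((((hd₁ y hy).continuousAt.mul continuousAt_const).pow 2).const_mul 2).add
      (((hd y hy).continuousAt.const_mul 2).mul ((hc2.mul continuousAt_const).mul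
        continuousAt_const))).continuousWithinAt
  · have := (key y hy).1
    have hz : 0 ≤ 2 * ζ ^ 2 := by positivity
    nlinarith [mul_nonpos_of_nonneg_of_nonpos hz this]
  · have := (key y hy).2
    have hz : 0 ≤ 2 * ζ ^ 2 * f (ζ * y + ε) ^ 2 := by positivity
    have := mul_le_mul_of_nonneg_left this hz
    calc _ = 2 * ζ ^ 2 * f (ζ * y + ε) ^ 2 * (2 * f₁ (ζ * y + ε) ^ 2) := by ring
      _ ≤ _ := this
      _ = _ := by ring

/-- The shift by `ε` makes the powers smooth on the closed interval, and neither constant depends on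
it. Multiplying the distance by `m ≥ 1` multiplies the squared sum by at most `m ^ (2β)`; `m = 2`
gives the doubling constant and `m = 3` the comparison with the value at `a`. -/
theorem powerLikeWeight_powSum (hβ : β < 1 / 2) (hc : ∀ i, 0 ≤ c i)
    (hα : ∀ i, 0 ≤ α i ∧ α i ≤ β) {a ε : ℝ} (ha : 0 < a) (hε : 0 < ε) :
    PowerLikeWeight a (1 / (1 - 2 * β)) ((2 : ℝ) ^ (2 * β) / 2)
      (fun y => powSum c α (y + ε) ^ 2) := by
  have hsq : ∀ m : ℝ, 0 ≤ m → (m ^ β) ^ 2 = m ^ (2 * β) := fun m hm => by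
    rw [mul_comm, Real.rpow_mul hm, Real.rpow_two]
  have hle : ∀ (m y y' : ℝ), 1 ≤ m → 0 ≤ y → 0 ≤ y' → y' ≤ m * y →
      powSum c α (y' + ε) ^ 2 ≤ m ^ (2 * β) * powSum c α (y + ε) ^ 2 := by
    intro m y y' hm hy hy' hle
    have h1 : powSum c α (y' + ε) ≤ powSum c α (m * (y + ε)) :=
      powSum_mono hc hα (by linarith) (by nlinarith)
    have h2 := powSum_mul_le hc hα (by linarith : 0 ≤ y + ε) hm
    rw [← hsq m (by linarith), ← mul_pow]
    exact pow_le_pow_left₀ (powSum_nonneg hc (by linarith)) (h1.trans h2) 2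
  refine ⟨fun y hy => ?_, fun y _ => sq_nonneg _, fun y hy y' hy' hyy => ?_, fun y hy => ?_,
    fun y hy => ?_, fun ζ hζ => concaveWeight_powSum hβ hc hα hε hζ.1⟩
  · have hr : 0 < y + ε := by linarith [hy.1]
    have : ContinuousAt (fun y => powSum c α (y + ε)) y :=
      ContinuousAt.comp (f := fun y => y + ε) (contDiffAt_powSum hr).continuousAt (by fun_prop)
    exact (this.pow 2).continuousWithinAt
  · refine pow_le_pow_left₀ (powSum_nonneg hc (by linarith [hy.1])) ?_ 2
    exact powSum_mono hc hα (by linarith [hy.1]) (by linarith)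
  · have := hle 2 y (2 * y) (by norm_num) hy.1 (by linarith [hy.1]) le_rfl
    refine this.trans (le_of_eq ?_)
    ring
  · have h0 : 0 ≤ y := le_trans (by positivity) hy.1
    have := hle 3 y a (by norm_num) h0 ha.le (by linarith [hy.1])
    have h3 : (3 : ℝ) ^ (2 * β) ≤ 3 := by
      calc (3 : ℝ) ^ (2 * β) ≤ 3 ^ (1 : ℝ) :=
            Real.rpow_le_rpow_of_exponent_le (by norm_num) (by linarith)
        _ = 3 := Real.rpow_one 3
    refine this.trans ?_
    gcongr

end powSum

/-! ### Smooth approximation with equal boundary values -/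

/-- The square of the `L²` norm on `(0,h) × (0,a)`. -/
noncomputable abbrev rsq (h a : ℝ) (f : ℝ × ℝ → ℝ) : ℝ := wsq h a (fun _ => 1) f

theorem integral_sq_eq_toReal_eLpNorm_sq {α : Type*} [MeasurableSpace α] {μ : Measure α} {f : α → ℝ}
    (hf : MemLp f 2 μ) : ∫ x, f x ^ 2 ∂μ = (eLpNorm f 2 μ).toReal ^ 2 := by
  rw [hf.eLpNorm_eq_integral_rpow_norm (by norm_num) (by norm_num)]
  have h0 : 0 ≤ ∫ x, f x ^ 2 ∂μ := integral_nonneg fun x => sq_nonneg _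
  simp only [ENNReal.toReal_ofNat, Real.rpow_ofNat, Real.norm_eq_abs, sq_abs]
  rw [ENNReal.toReal_ofReal (Real.rpow_nonneg h0 _), ← Real.rpow_natCast, ← Real.rpow_mul h0]
  norm_num

theorem tendsto_integral_sq_of_eLpNorm {α : Type*} [MeasurableSpace α] {μ : Measure α}
    {f : ℕ → α → ℝ} (hf : ∀ n, MemLp (f n) 2 μ)
    (ht : Tendsto (fun n => eLpNorm (f n) 2 μ) atTop (𝓝 0)) :
    Tendsto (fun n => ∫ x, f n x ^ 2 ∂μ) atTop (𝓝 0) := by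
  simp only [fun n => integral_sq_eq_toReal_eLpNorm_sq (hf n)]
  have h1 := (ENNReal.tendsto_toReal ENNReal.zero_ne_top).comp ht
  simpa using h1.pow 2

theorem rsq_eq (h a : ℝ) (f : ℝ × ℝ → ℝ) : rsq h a f = ∫ p in rect h a, f p ^ 2 := by
  simp [rsq, wsq]

theorem rsq_nonneg (h a : ℝ) (f : ℝ × ℝ → ℝ) : 0 ≤ rsq h a f := wsq_nonneg (fun _ _ => zero_le_one) f

theorem rsq_le_add {h a c₁ c₂ : ℝ} {f g k : ℝ × ℝ → ℝ}
    (hf : MemLp f 2 (volume.restrict (rect h a))) (hg : MemLp g 2 (volume.restrict (rect h a)))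
    (hk : MemLp k 2 (volume.restrict (rect h a)))
    (hle : ∀ p ∈ rect h a, f p ^ 2 ≤ c₁ * g p ^ 2 + c₂ * k p ^ 2) :
    rsq h a f ≤ c₁ * rsq h a g + c₂ * rsq h a k :=
  wsq_le_add continuousOn_const (fun _ _ => zero_le_one) hf hg hk hle

theorem rect_mono_height {h a b : ℝ} (hab : b ≤ a) : rect h b ⊆ rect h a :=
  prod_mono subset_rfl (Ioo_subset_Ioo_right hab)

theorem rsq_mono_height {h a b : ℝ} (hab : b ≤ a) {f : ℝ × ℝ → ℝ}
    (hf : MemLp f 2 (volume.restrict (rect h a))) : rsq h b f ≤ rsq h a f := by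
  rw [rsq_eq, rsq_eq]
  exact setIntegral_mono_subset (rect_mono_height hab) (measurableSet_rect h a) hf.integrable_sq
    fun p _ => sq_nonneg _

theorem mapsTo_reflect (h a : ℝ) : MapsTo (diagAffine 1 0 (-1) a) (rect h a) (rect h a) := by
  rintro p ⟨h1, h2, h3⟩
  refine ⟨by simpa [diagAffine] using h1, ?_, ?_⟩ <;> simp [diagAffine] <;> linarith

theorem memLp_reflect {h a : ℝ} {f : ℝ × ℝ → ℝ} (hf : MemLp f 2 (volume.restrict (rect h a))) :
    MemLp (fun p => f (diagAffine 1 0 (-1) a p)) 2 (volume.restrict (rect h a)) :=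
  memLp_comp_diagAffine one_ne_zero (by norm_num) 0 a hf (mapsTo_reflect h a)

theorem wsq_reflect (h a : ℝ) (V : ℝ → ℝ) (f : ℝ × ℝ → ℝ) :
    wsq h a (fun y => V (a - y)) (fun p => f (diagAffine 1 0 (-1) a p)) = wsq h a V f := by
  have := wsq_comp_vertical (h := h) (a := a) (t := -1) (s := a) (b := 0) (c := a) (r := 1)
    (V := fun y => V (a - y)) (W := V) (by norm_num)
    (fun y => by simp only [mem_Ioo]; constructor <;> rintro ⟨h3, h4⟩ <;> constructor <;> linarith)
    (fun y _ => by congr 1; ring) f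
  simpa [wsq, rect] using this

/-- Poincaré inequality in the vertical direction. -/
theorem rsq_sub_bottom_le {h δ : ℝ} (hδ : 0 < δ) {f : ℝ × ℝ → ℝ} (hf : ContDiff ℝ ∞ f) :
    rsq h δ (fun p => f p - f (p.1, 0)) ≤ δ ^ 2 * rsq h δ (pdy f) := by
  have cy : Continuous (pdy f) := (contDiff_fderiv_apply hf _).continuous
  have cf := hf.continuous
  have cd : Continuous (fun p : ℝ × ℝ => f p - f (p.1, 0)) := by fun_prop
  have i1 : IntegrableOn (fun p => (f p - f (p.1, 0)) ^ 2) (rect h δ) :=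
    integrableOn_rect_of_continuousOn (cd.pow 2).continuousOn
  have i2 : IntegrableOn (fun p => δ ^ 2 * pdy f p ^ 2) (rect h δ) :=
    integrableOn_rect_of_continuousOn (continuous_const.mul (cy.pow 2)).continuousOn
  rw [rsq_eq, rsq_eq, ← integral_const_mul]
  have i1' := i1
  have i2' := i2
  unfold rect at i1' i2' ⊢
  rw [Measure.volume_eq_prod] at i1' i2' ⊢
  rw [setIntegral_prod _ i1', setIntegral_prod _ i2']
  have j1 : IntegrableOn (fun x => ∫ y in Ioo 0 δ, (f (x, y) - f (x, 0)) ^ 2) (Ioo 0 h) := by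
    rw [IntegrableOn, ← Measure.prod_restrict] at i1'
    exact i1'.integral_prod_left
  have j2 : IntegrableOn (fun x => ∫ y in Ioo 0 δ, δ ^ 2 * pdy f (x, y) ^ 2) (Ioo 0 h) := by
    rw [IntegrableOn, ← Measure.prod_restrict] at i2'
    exact i2'.integral_prod_left
  refine setIntegral_mono_on j1 j2 measurableSet_Ioo fun x _ => ?_
  have cx : Continuous (fun y => pdy f (x, y)) := cy.comp (by fun_prop)
  have mem : ∀ g : ℝ → ℝ, Continuous g → MemLp g 2 (volume.restrict (Ioo 0 δ)) := by
    intro g hg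
    obtain ⟨C, hC⟩ := (isCompact_Icc (a := (0 : ℝ)) (b := δ)).exists_bound_of_continuousOn
      hg.continuousOn
    exact MemLp.of_bound hg.aestronglyMeasurable C ((ae_restrict_iff' measurableSet_Ioo).2
      (Eventually.of_forall fun y hy => hC y (Ioo_subset_Icc_self hy)))
  have hcs := integral_mul_le_sqrt_mul_sqrt (mem _ cx) (mem (fun _ => 1) continuous_const)
  simp only [abs_one, mul_one, one_pow, integral_const, MeasurableSet.univ,
    measureReal_restrict_apply, univ_inter, Real.volume_real_Ioo_of_le hδ.le, sub_zero,
    smul_eq_mul] at hcs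
  set I := ∫ y in Ioo 0 δ, pdy f (x, y) ^ 2 with hI
  have hI0 : 0 ≤ I := setIntegral_nonneg measurableSet_Ioo fun y _ => sq_nonneg _
  have hpt : ∀ y ∈ Ioo 0 δ, (f (x, y) - f (x, 0)) ^ 2 ≤ δ * I := by
    intro y hy
    have hft : ∫ t in (0 : ℝ)..y, pdy f (x, t) = f (x, y) - f (x, 0) :=
      intervalIntegral.integral_eq_sub_of_hasDerivAt
        (fun t _ => hasDerivAt_slice_snd (hf.differentiable (by simp) _))
        (cx.intervalIntegrable _ _)
    have h1 : |f (x, y) - f (x, 0)| ≤ ∫ t in Ioo 0 δ, |pdy f (x, t)| := by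
      rw [← hft, intervalIntegral.integral_of_le hy.1.le]
      refine (abs_integral_le_integral_abs).trans ?_
      refine setIntegral_mono_set ((mem _ cx).integrable (by norm_num)).abs
        (Eventually.of_forall fun t => abs_nonneg _)
        (Eventually.of_forall fun t ht => ⟨ht.1, ht.2.trans_lt hy.2⟩)
    have h2 := h1.trans hcs
    calc (f (x, y) - f (x, 0)) ^ 2 = |f (x, y) - f (x, 0)| ^ 2 := (sq_abs _).symm
      _ ≤ (√I * √δ) ^ 2 := by gcongr
      _ = δ * I := by rw [mul_pow, Real.sq_sqrt hI0, Real.sq_sqrt hδ.le]; ring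
  calc ∫ y in Ioo 0 δ, (f (x, y) - f (x, 0)) ^ 2 ≤ ∫ _y in Ioo 0 δ, δ * I := by
        refine setIntegral_mono_on ?_ (integrable_const _) measurableSet_Ioo hpt
        exact (mem _ (cd.comp (by fun_prop : Continuous fun y : ℝ => (x, y)))).integrable_sq
    _ = δ ^ 2 * I := by
        simp [Real.volume_real_Ioo_of_le hδ.le]; ring
    _ = ∫ y in Ioo 0 δ, δ ^ 2 * pdy f (x, y) ^ 2 := by rw [integral_const_mul]

theorem rsq_comp_fst {h δ : ℝ} (hδ : 0 < δ) (f : ℝ → ℝ) :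
    rsq h δ (fun p => f p.1) = δ * ∫ x in Ioo 0 h, f x ^ 2 := by
  rw [rsq_eq]
  unfold rect
  rw [Measure.volume_eq_prod]
  have := setIntegral_prod_mul (μ := volume) (ν := volume) (fun x => f x ^ 2) (fun _ : ℝ => (1 : ℝ))
    (Ioo 0 h) (Ioo 0 δ)
  simp only [mul_one] at this
  rw [this]
  simp [Real.volume_real_Ioo_of_le hδ.le]
  ring

/-- A cutoff in the vertical variable, supported in a strip of height `δ`. -/
theorem exists_vertical_cutoff : ∃ M : ℝ, 0 < M ∧ ∀ δ : ℝ, 0 < δ → ∃ ρ : ℝ → ℝ,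
    ContDiff ℝ ∞ ρ ∧ ρ 0 = 1 ∧ (∀ y, |ρ y| ≤ 1) ∧ (∀ y, δ ≤ y → ρ y = 0) ∧
      (∀ y, δ ≤ y → deriv ρ y = 0) ∧ ∀ y, |deriv ρ y| ≤ M / δ := by
  obtain ⟨M, hM, hb⟩ := exists_bound_deriv_smoothTransition
  refine ⟨2 * M, by positivity, fun δ hδ => ⟨fun y => 1 - Real.smoothTransition (2 / δ * y), ?_, ?_,
    ?_, ?_, ?_, ?_⟩⟩
  · exact contDiff_const.sub (contDiff_smoothTransition.comp (contDiff_const.mul contDiff_id))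
  · simp
  · intro y
    have h1 := Real.smoothTransition.nonneg (2 / δ * y)
    have h2 := Real.smoothTransition.le_one (2 / δ * y)
    rw [abs_le]; constructor <;> linarith
  · intro y hy
    have h1 : 1 ≤ 2 / δ * y := by rw [div_mul_eq_mul_div, le_div_iff₀ hδ]; linarith
    simp [Real.smoothTransition.one_of_one_le h1]
  all_goals
    have hd : ∀ y, deriv (fun y => 1 - Real.smoothTransition (2 / δ * y)) y =
        -(deriv Real.smoothTransition (2 / δ * y) * (2 / δ)) := by
      intro y
      have h1 : HasDerivAt Real.smoothTransition _ (2 / δ * y) :=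
        (contDiff_smoothTransition.differentiable (by simp) _).hasDerivAt
      have h2 : HasDerivAt (fun y => 2 / δ * y) (2 / δ) y := by
        simpa using (hasDerivAt_id y).const_mul (2 / δ)
      exact ((h1.comp y h2).const_sub 1).deriv
  · intro y hy
    have h1 : 1 < 2 / δ * y := by rw [div_mul_eq_mul_div, lt_div_iff₀ hδ]; linarith
    rw [hd, deriv_smoothTransition_of_one_lt h1]; simp
  · intro y
    rw [hd, abs_neg, abs_mul, abs_of_pos (by positivity : 0 < 2 / δ)]
    calc _ ≤ M * (2 / δ) := by gcongr; exact hb _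
      _ = 2 * M / δ := by ring

theorem rsq_le_of_support_height {h a δ : ℝ} (hδa : δ ≤ a) {f g : ℝ × ℝ → ℝ}
    (h0 : ∀ p : ℝ × ℝ, δ ≤ p.2 → f p = 0) (hf : MemLp f 2 (volume.restrict (rect h δ)))
    (hg : MemLp g 2 (volume.restrict (rect h δ)))
    (hle : ∀ p ∈ rect h δ, f p ^ 2 ≤ g p ^ 2) : rsq h a f ≤ rsq h δ g := by
  rw [rsq_eq, rsq_eq]
  rw [setIntegral_eq_of_subset_of_forall_sdiff_eq_zero (measurableSet_rect h a)
    (rect_mono_height hδa)]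
  · exact setIntegral_mono_on hf.integrable_sq hg.integrable_sq (measurableSet_rect h δ) hle
  · rintro p ⟨⟨hp1, hp2⟩, hp3⟩
    rw [h0 p, zero_pow two_ne_zero]
    by_contra hlt
    exact hp3 ⟨hp1, hp2.1, not_le.1 hlt⟩

/-- A function that is smooth up to the boundary is made periodic in the vertical variable by a
modification in a thin strip, with control on the modification. -/
theorem exists_periodic_modification : ∃ M : ℝ, 0 < M ∧ ∀ {h a δ : ℝ} {ψ O : ℝ × ℝ → ℝ},
    0 < δ → δ ≤ a → ContDiff ℝ ∞ ψ → O = (fun p => ψ p - ψ (diagAffine 1 0 (-1) a p)) →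
    ∃ φ : ℝ × ℝ → ℝ, ContDiff ℝ ∞ φ ∧ (∀ x, φ (x, 0) = φ (x, a)) ∧
      rsq h a (fun p => φ p - ψ p) ≤ rsq h δ O ∧
      rsq h a (fun p => pdx φ p - pdx ψ p) ≤ rsq h δ (pdx O) ∧
      rsq h a (fun p => pdy φ p - pdy ψ p) ≤
        M * (rsq h δ (pdy O) + 1 / δ * ∫ x in Ioo 0 h, O (x, 0) ^ 2) := by
  obtain ⟨M, hM, hcut⟩ := exists_vertical_cutoff
  refine ⟨2 + 4 * M ^ 2, by positivity, ?_⟩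
  intro h a δ ψ O hδ hδa hψ hO
  obtain ⟨ρ, hρ, hρ0, hρ1, hρz, hρdz, hρd⟩ := hcut δ hδ
  have hOs : ContDiff ℝ ∞ O := by
    rw [hO]; exact hψ.sub (hψ.comp (contDiff_diagAffine _ _ _ _))
  have hρs : ContDiff ℝ ∞ (fun p : ℝ × ℝ => ρ p.2) := hρ.comp contDiff_snd
  have hψd : Differentiable ℝ ψ := hψ.differentiable (by simp)
  have hOd : Differentiable ℝ O := hOs.differentiable (by simp)
  have hρdd : Differentiable ℝ (fun p : ℝ × ℝ => ρ p.2) := hρs.differentiable (by simp)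
  have hfd : ∀ p, HasFDerivAt (fun p => ψ p - ρ p.2 * O p)
      (fderiv ℝ ψ p - (ρ p.2 • fderiv ℝ O p + O p • fderiv ℝ (fun p : ℝ × ℝ => ρ p.2) p)) p :=
    fun p => (hψd p).hasFDerivAt.sub ((hρdd p).hasFDerivAt.mul (hOd p).hasFDerivAt)
  have hρf : ∀ p, HasFDerivAt (fun p : ℝ × ℝ => ρ p.2)
      (deriv ρ p.2 • ContinuousLinearMap.snd ℝ ℝ ℝ) p := fun p =>
    ((hρ.differentiable (by simp) p.2).hasDerivAt).comp_hasFDerivAt p hasFDerivAt_snd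
  have hx : ∀ p, pdx (fun p => ψ p - ρ p.2 * O p) p - pdx ψ p = -(ρ p.2 * pdx O p) := by
    intro p
    simp [pdx, (hfd p).fderiv, (hρf p).fderiv]
  have hy : ∀ p, pdy (fun p => ψ p - ρ p.2 * O p) p - pdy ψ p =
      -(ρ p.2 * pdy O p + deriv ρ p.2 * O p) := by
    intro p
    simp [pdy, (hfd p).fderiv, (hρf p).fderiv]
    ring
  have cρ := hρ.continuous
  have cdρ : Continuous (deriv ρ) := hρ.continuous_deriv (by simp)
  have cO := hOs.continuous
  have cxO : Continuous (pdx O) := (contDiff_fderiv_apply hOs _).continuous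
  have cyO : Continuous (pdy O) := (contDiff_fderiv_apply hOs _).continuous
  have hmem : ∀ {g : ℝ × ℝ → ℝ}, Continuous g → ∀ b, MemLp g 2 (volume.restrict (rect h b)) :=
    fun hg b => memLp_rect_of_continuousOn hg.continuousOn
  have hcontr : ∀ {g : ℝ × ℝ → ℝ}, ∀ p : ℝ × ℝ, (ρ p.2 * g p) ^ 2 ≤ g p ^ 2 := by
    intro g p
    rw [mul_pow]
    have : ρ p.2 ^ 2 ≤ 1 := (sq_le_one_iff_abs_le_one _).2 (hρ1 _)
    exact mul_le_of_le_one_left (sq_nonneg _) this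
  -- On the bottom `ρ = 1` replaces `ψ(x, 0)` by `ψ(x, a)`. On the top `ρ` vanishes because `δ ≤ a`,
  -- so `ψ` is unchanged there.
  refine ⟨fun p => ψ p - ρ p.2 * O p, hψ.sub (hρs.mul hOs), ?_, ?_, ?_, ?_⟩
  · intro x
    simp [hρ0, hρz a hδa, hO, diagAffine]
  · refine rsq_le_of_support_height hδa (fun p hp => by simp [hρz _ hp]) (hmem (by fun_prop) δ)
      (hmem cO δ) fun p _ => ?_
    simpa using hcontr p
  · simp only [hx]
    refine rsq_le_of_support_height hδa (fun p hp => by simp [hρz _ hp]) (hmem (by fun_prop) δ)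
      (hmem cxO δ) fun p _ => ?_
    simpa using hcontr p
  · simp only [hy]
    have h1 : rsq h a (fun p => -(ρ p.2 * pdy O p + deriv ρ p.2 * O p)) ≤
        2 * rsq h a (fun p => ρ p.2 * pdy O p) + 2 * rsq h a (fun p => deriv ρ p.2 * O p) := by
      refine rsq_le_add (hmem (by fun_prop) a) (hmem (by fun_prop) a) (hmem (by fun_prop) a)
        fun p _ => ?_
      nlinarith [sq_nonneg (ρ p.2 * pdy O p - deriv ρ p.2 * O p)]
    have h2 : rsq h a (fun p => ρ p.2 * pdy O p) ≤ rsq h δ (pdy O) :=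
      rsq_le_of_support_height hδa (fun p hp => by simp [hρz _ hp]) (hmem (by fun_prop) δ)
        (hmem cyO δ) fun p _ => hcontr p
    have h3 : rsq h a (fun p => deriv ρ p.2 * O p) ≤ rsq h δ (fun p => M / δ * O p) := by
      refine rsq_le_of_support_height hδa (fun p hp => by simp [hρdz _ hp]) (hmem (by fun_prop) δ)
        (hmem (by fun_prop) δ) fun p _ => ?_
      rw [mul_pow, mul_pow]
      gcongr ?_ * _
      exact sq_le_sq.2 ((hρd _).trans (le_abs_self _))
    -- The factor `1 / δ²` from the cutoff is compensated by the Poincaré inequality on a strip of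
    -- height `δ`, except for the boundary values of `O`, which keep a factor `1 / δ`.
    have h4 : rsq h δ (fun p => M / δ * O p) ≤
        2 * M ^ 2 / δ ^ 2 * rsq h δ (fun p => O p - O (p.1, 0)) +
          2 * M ^ 2 / δ ^ 2 * rsq h δ (fun p => O (p.1, 0)) := by
      refine rsq_le_add (hmem (by fun_prop) δ) (hmem (by fun_prop) δ) (hmem (by fun_prop) δ)
        fun p _ => ?_
      rw [← mul_add, mul_pow, div_pow, mul_comm 2 (M ^ 2), mul_div_right_comm, mul_assoc]
      gcongr
      nlinarith [sq_nonneg ((O p - O (p.1, 0)) - O (p.1, 0))]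
    have h5 := rsq_sub_bottom_le (h := h) hδ hOs
    rw [rsq_comp_fst hδ (fun x => O (x, 0))] at h4
    set P := rsq h δ (pdy O) with hP
    set I := ∫ x in Ioo 0 h, O (x, 0) ^ 2 with hI
    have hI0 : 0 ≤ I := setIntegral_nonneg measurableSet_Ioo fun x _ => sq_nonneg _
    have h6 : 2 * M ^ 2 / δ ^ 2 * rsq h δ (fun p => O p - O (p.1, 0)) ≤ 2 * M ^ 2 * P := by
      calc _ ≤ 2 * M ^ 2 / δ ^ 2 * (δ ^ 2 * P) := by gcongr
        _ = 2 * M ^ 2 * P := by field_simp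
    have h7 : 2 * M ^ 2 / δ ^ 2 * (δ * I) = 2 * M ^ 2 * (1 / δ * I) := by field_simp
    have h8 : 0 ≤ 1 / δ * I := by positivity
    have h9 : 0 ≤ P := rsq_nonneg _ _ _
    nlinarith

/-- The strips decrease to the empty set, so the integrals tend to zero by continuity of the
integral along decreasing sets. -/
theorem tendsto_rsq_strip {h a : ℝ} (ha : 0 < a) {f : ℝ × ℝ → ℝ}
    (hf : MemLp f 2 (volume.restrict (rect h a))) :
    Tendsto (fun n : ℕ => rsq h (a / (n + 1)) f) atTop (𝓝 0) := by
  simp only [rsq_eq]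
  have h1 := tendsto_setIntegral_of_antitone (μ := volume) (f := fun p => f p ^ 2)
    (s := fun n : ℕ => rect h (a / (n + 1))) (fun n => measurableSet_rect _ _)
    (fun m n hmn => rect_mono_height (by gcongr)) ⟨0, by simpa [IntegrableOn] using hf.integrable_sq⟩
  have h2 : ⋂ n : ℕ, rect h (a / (n + 1)) = ∅ := by
    refine eq_empty_iff_forall_notMem.2 fun p hp => ?_
    rw [mem_iInter] at hp
    have hp0 : 0 < p.2 := (hp 0).2.1
    obtain ⟨n, hn⟩ := exists_nat_gt (a / p.2)
    have h3 := (hp n).2.2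
    rw [lt_div_iff₀ (by positivity)] at h3
    rw [div_lt_iff₀ hp0] at hn
    nlinarith
  simpa [h2] using h1

/-- Transfers smallness in the strip from the limit `g` to its approximations `f`, with an error
that does not depend on `δ`. The sign is `-1` for the function and its horizontal derivative, `+1`
for the vertical derivative. -/
theorem rsq_add_reflect_le {h a δ s : ℝ} (hδa : δ ≤ a) (hs : s ^ 2 = 1) {f g : ℝ × ℝ → ℝ}
    (hf : MemLp f 2 (volume.restrict (rect h a))) (hg : MemLp g 2 (volume.restrict (rect h a))) :
    rsq h δ (fun p => f p + s * f (diagAffine 1 0 (-1) a p)) ≤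
      2 * rsq h δ (fun p => g p + s * g (diagAffine 1 0 (-1) a p)) +
        8 * rsq h a (fun p => f p - g p) := by
  set R := diagAffine 1 0 (-1) a with hR
  have hd : MemLp (fun p => f p - g p) 2 (volume.restrict (rect h a)) := hf.sub hg
  have hF : MemLp (fun p => f p + s * f (R p)) 2 (volume.restrict (rect h a)) :=
    hf.add ((memLp_reflect hf).const_mul s)
  have hG : MemLp (fun p => g p + s * g (R p)) 2 (volume.restrict (rect h a)) :=
    hg.add ((memLp_reflect hg).const_mul s)
  have hD : MemLp (fun p => (f p - g p) + s * (f (R p) - g (R p))) 2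
      (volume.restrict (rect h a)) := hd.add ((memLp_reflect hd).const_mul s)
  have hsub := Measure.restrict_mono (μ := volume) (rect_mono_height (h := h) hδa) le_rfl
  have h1 := rsq_le_add (c₁ := 2) (c₂ := 2) (hF.mono_measure hsub) (hG.mono_measure hsub)
    (hD.mono_measure hsub) fun p _ => by
      nlinarith [sq_nonneg ((g p + s * g (R p)) - ((f p - g p) + s * (f (R p) - g (R p))))]
  have h2 := rsq_mono_height hδa hD
  have h3 := rsq_le_add (c₁ := 2) (c₂ := 2) hD hd (memLp_reflect hd) fun p _ => by
      have e : (s * (f (R p) - g (R p))) ^ 2 = (f (R p) - g (R p)) ^ 2 := by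
        rw [mul_pow, hs, one_mul]
      change _ ≤ 2 * (f p - g p) ^ 2 + 2 * (f (R p) - g (R p)) ^ 2
      rw [← e]
      nlinarith [sq_nonneg ((f p - g p) - (s * (f (R p) - g (R p))))]
  have h4 : rsq h a (fun p => f (R p) - g (R p)) = rsq h a (fun p => f p - g p) :=
    wsq_reflect h a (fun _ => 1) (fun p => f p - g p)
  rw [h4] at h3
  linarith

/-- Trace inequality on the bottom side. -/
theorem integral_bottom_sq_le {h a : ℝ} (ha : 0 < a) {f : ℝ × ℝ → ℝ} (hf : ContDiff ℝ ∞ f) :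
    a * ∫ x in Ioo 0 h, f (x, 0) ^ 2 ≤ 2 * rsq h a f + 2 * a ^ 2 * rsq h a (pdy f) := by
  have cf := hf.continuous
  have h1 := rsq_le_add (h := h) (a := a) (c₁ := 2) (c₂ := 2) (f := fun p => f (p.1, 0)) (g := f)
    (k := fun p => f p - f (p.1, 0)) (memLp_rect_of_continuous (by fun_prop))
    (memLp_rect_of_continuous cf) (memLp_rect_of_continuous (by fun_prop)) fun p _ => by
      nlinarith [sq_nonneg (f p + (f p - f (p.1, 0)))]
  have h2 := rsq_sub_bottom_le (h := h) ha hf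
  rw [rsq_comp_fst ha (fun x => f (x, 0))] at h1
  linarith

theorem memLp_interval_of_continuous {h : ℝ} {g : ℝ → ℝ} (hg : Continuous g) :
    MemLp g 2 (volume.restrict (Ioo 0 h)) := by
  obtain ⟨C, hC⟩ := (isCompact_Icc (a := (0 : ℝ)) (b := h)).exists_bound_of_continuousOn
    hg.continuousOn
  exact MemLp.of_bound hg.aestronglyMeasurable C ((ae_restrict_iff' measurableSet_Ioo).2
    (Eventually.of_forall fun y hy => hC y (Ioo_subset_Icc_self hy)))

theorem integral_sq_le_of_sum_three {μ : Measure ℝ} {f f₁ f₂ f₃ : ℝ → ℝ} (h₁ : MemLp f₁ 2 μ)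
    (h₂ : MemLp f₂ 2 μ) (h₃ : MemLp f₃ 2 μ) (he : ∀ x, f x = f₁ x + f₂ x + f₃ x) :
    ∫ x, f x ^ 2 ∂μ ≤ 3 * ((∫ x, f₁ x ^ 2 ∂μ) + (∫ x, f₂ x ^ 2 ∂μ) + ∫ x, f₃ x ^ 2 ∂μ) := by
  have hf : MemLp f 2 μ := by
    rw [show f = fun x => f₁ x + f₂ x + f₃ x from funext he]; exact (h₁.add h₂).add h₃
  have h₁₂ : Integrable (fun x => f₁ x ^ 2 + f₂ x ^ 2) μ := h₁.integrable_sq.add h₂.integrable_sq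
  rw [← integral_add h₁.integrable_sq h₂.integrable_sq, ← integral_add h₁₂ h₃.integrable_sq,
    ← integral_const_mul]
  refine integral_mono hf.integrable_sq ((h₁₂.add h₃.integrable_sq).const_mul 3) fun x => ?_
  simp only [he]
  nlinarith [sq_nonneg (f₁ x - f₂ x), sq_nonneg (f₁ x - f₃ x), sq_nonneg (f₂ x - f₃ x)]

/-- Smooth approximations in `H¹` with quantitative convergence, extracted from a trace. -/
theorem HasTraceOnSide.exists_approx {h a s : ℝ} {u ux uy : ℝ × ℝ → ℝ} {g : ℝ → ℝ}
    (hu : IsSobolevH1 (rect h a) u ux uy) (ht : HasTraceOnSide h a s u ux uy g) :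
    ∃ φ : ℕ → ℝ × ℝ → ℝ, (∀ n, ContDiff ℝ ∞ (φ n)) ∧
      Tendsto (fun n => rsq h a (fun p => φ n p - u p)) atTop (𝓝 0) ∧
      Tendsto (fun n => rsq h a (fun p => pdx (φ n) p - ux p)) atTop (𝓝 0) ∧
      Tendsto (fun n => rsq h a (fun p => pdy (φ n) p - uy p)) atTop (𝓝 0) ∧
      Tendsto (fun n => ∫ x in Ioo 0 h, (φ n (x, s) - g x) ^ 2) atTop (𝓝 0) := by
  obtain ⟨hg, φ, hφ, h0, hx, hy, htr⟩ := ht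
  refine ⟨φ, hφ, ?_, ?_, ?_, ?_⟩
  · simp only [rsq_eq]
    exact tendsto_integral_sq_of_eLpNorm
      (fun n => (memLp_rect_of_continuous (hφ n).continuous).sub hu.memLp) h0
  · simp only [rsq_eq]
    exact tendsto_integral_sq_of_eLpNorm
      (fun n => (memLp_rect_of_continuous (contDiff_fderiv_apply (hφ n) _).continuous).sub
        hu.memLp_dx) hx
  · simp only [rsq_eq]
    exact tendsto_integral_sq_of_eLpNorm
      (fun n => (memLp_rect_of_continuous (contDiff_fderiv_apply (hφ n) _).continuous).sub
        hu.memLp_dy) hy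
  · exact tendsto_integral_sq_of_eLpNorm
      (fun n => (memLp_interval_of_continuous
        ((hφ n).continuous.comp (by fun_prop : Continuous fun x : ℝ => (x, s)))).sub hg) htr

/-- Smooth approximations of a function with equal traces on the two horizontal sides have
boundary values whose difference tends to zero. -/
theorem exists_approx_of_trace_eq {h a : ℝ} (ha : 0 < a) {u ux uy : ℝ × ℝ → ℝ} {g : ℝ → ℝ}
    (hu : IsSobolevH1 (rect h a) u ux uy) (h0 : HasTraceOnSide h a 0 u ux uy g)
    (h1 : HasTraceOnSide h a a u ux uy g) :
    ∃ ψ : ℕ → ℝ × ℝ → ℝ, (∀ n, ContDiff ℝ ∞ (ψ n)) ∧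
      Tendsto (fun n => rsq h a (fun p => ψ n p - u p)) atTop (𝓝 0) ∧
      Tendsto (fun n => rsq h a (fun p => pdx (ψ n) p - ux p)) atTop (𝓝 0) ∧
      Tendsto (fun n => rsq h a (fun p => pdy (ψ n) p - uy p)) atTop (𝓝 0) ∧
      Tendsto (fun n => ∫ x in Ioo 0 h, (ψ n (x, 0) - ψ n (x, a)) ^ 2) atTop (𝓝 0) := by
  obtain ⟨φ, hφ, φ0, -, φy, φt⟩ := h0.exists_approx hu
  obtain ⟨ψ, hψ, ψ0, ψx, ψy, ψt⟩ := h1.exists_approx hu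
  have hg := h0.1
  refine ⟨ψ, hψ, ψ0, ψx, ψy, ?_⟩
  have mφ := fun n => memLp_rect_of_continuous (h := h) (a := a) (q := 2) (hφ n).continuous
  have mψ := fun n => memLp_rect_of_continuous (h := h) (a := a) (q := 2) (hψ n).continuous
  have cφy : ∀ n, Continuous (pdy (φ n)) := fun n => (contDiff_fderiv_apply (hφ n) _).continuous
  have cψy : ∀ n, Continuous (pdy (ψ n)) := fun n => (contDiff_fderiv_apply (hψ n) _).continuous
  -- The traces on the two sides come with two unrelated approximating sequences. The trace
  -- inequality shows that their bottom values have the same limit, so the sequence converging on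
  -- the top also converges to `g` on the bottom.
  have hdiff : ∀ n, a * ∫ x in Ioo 0 h, (ψ n (x, 0) - φ n (x, 0)) ^ 2 ≤
      2 * (2 * rsq h a (fun p => ψ n p - u p) + 2 * rsq h a (fun p => φ n p - u p)) +
      2 * a ^ 2 * (2 * rsq h a (fun p => pdy (ψ n) p - uy p) +
        2 * rsq h a (fun p => pdy (φ n) p - uy p)) := by
    intro n
    refine (integral_bottom_sq_le ha ((hψ n).sub (hφ n))).trans ?_
    have e1 : rsq h a (fun p => ψ n p - φ n p) ≤
        2 * rsq h a (fun p => ψ n p - u p) + 2 * rsq h a (fun p => φ n p - u p) := by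
      refine rsq_le_add ((mψ n).sub (mφ n)) ((mψ n).sub hu.memLp) ((mφ n).sub hu.memLp)
        fun p _ => ?_
      nlinarith [sq_nonneg ((ψ n p - u p) + (φ n p - u p))]
    have e2 : rsq h a (pdy (fun p => ψ n p - φ n p)) ≤
        2 * rsq h a (fun p => pdy (ψ n) p - uy p) + 2 * rsq h a (fun p => pdy (φ n) p - uy p) := by
      have e3 : pdy (fun p => ψ n p - φ n p) = fun p => pdy (ψ n) p - pdy (φ n) p := by
        funext p
        simp [pdy, fderiv_fun_sub ((hψ n).differentiable (by simp) p)
          ((hφ n).differentiable (by simp) p)]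
      rw [e3]
      have m1 := memLp_rect_of_continuous (h := h) (a := a) (q := 2) (cφy n)
      have m2 := memLp_rect_of_continuous (h := h) (a := a) (q := 2) (cψy n)
      refine rsq_le_add (m2.sub m1) (m2.sub hu.memLp_dy) (m1.sub hu.memLp_dy) fun p _ => ?_
      nlinarith [sq_nonneg ((pdy (ψ n) p - uy p) + (pdy (φ n) p - uy p))]
    change 2 * rsq h a (fun p => ψ n p - φ n p) +
      2 * a ^ 2 * rsq h a (pdy (fun p => ψ n p - φ n p)) ≤ _
    gcongr
  have hlim : Tendsto (fun n => ∫ x in Ioo 0 h, (ψ n (x, 0) - φ n (x, 0)) ^ 2) atTop (𝓝 0) := by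
    have hup := ((((ψ0.const_mul 2).add (φ0.const_mul 2)).const_mul 2).add
      (((ψy.const_mul 2).add (φy.const_mul 2)).const_mul (2 * a ^ 2))).const_mul a⁻¹
    simp only [mul_zero, add_zero] at hup
    refine squeeze_zero (fun n => setIntegral_nonneg measurableSet_Ioo fun x _ => sq_nonneg _)
      (fun n => ?_) hup
    rw [le_inv_mul_iff₀ ha]
    exact hdiff n
  have hslice : ∀ (f : ℝ × ℝ → ℝ) (t : ℝ), ContDiff ℝ ∞ f →
      MemLp (fun x => f (x, t)) 2 (volume.restrict (Ioo 0 h)) := fun f t hf =>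
    memLp_interval_of_continuous (hf.continuous.comp (by fun_prop : Continuous fun x : ℝ => (x, t)))
  have hup := ((hlim.add φt).add ψt).const_mul 3
  simp only [mul_zero, add_zero] at hup
  refine squeeze_zero (fun n => setIntegral_nonneg measurableSet_Ioo fun x _ => sq_nonneg _)
    (fun n => ?_) hup
  have := integral_sq_le_of_sum_three (f := fun x => ψ n (x, 0) - ψ n (x, a))
    ((hslice _ 0 (hψ n)).sub (hslice _ 0 (hφ n))) ((hslice _ 0 (hφ n)).sub hg)
    (hg.sub (hslice _ a (hψ n))) (fun x => by simp)
  simp only [Pi.sub_apply] at this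
  simpa only [sub_sq_comm (g _)] using this

/-- An `H¹` function with equal traces on the two horizontal sides is a limit of smooth functions
with equal boundary values there. -/
theorem exists_periodic_approx {h a : ℝ} (ha : 0 < a) {u ux uy : ℝ × ℝ → ℝ} {g : ℝ → ℝ}
    (hu : IsSobolevH1 (rect h a) u ux uy) (h0 : HasTraceOnSide h a 0 u ux uy g)
    (h1 : HasTraceOnSide h a a u ux uy g) {ε : ℝ} (hε : 0 < ε) :
    ∃ φ : ℝ × ℝ → ℝ, ContDiff ℝ ∞ φ ∧ (∀ x, φ (x, 0) = φ (x, a)) ∧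
      rsq h a (fun p => φ p - u p) < ε ∧ rsq h a (fun p => pdx φ p - ux p) < ε ∧
      rsq h a (fun p => pdy φ p - uy p) < ε := by
  obtain ⟨M, hM, hmod⟩ := exists_periodic_modification
  obtain ⟨ψ, hψ, ψ0, ψx, ψy, ψt⟩ := exists_approx_of_trace_eq ha hu h0 h1
  set R := diagAffine 1 0 (-1) a with hR
  have mem : ∀ {f : ℝ × ℝ → ℝ} (s : ℝ), MemLp f 2 (volume.restrict (rect h a)) →
      MemLp (fun p => f p + s * f (R p)) 2 (volume.restrict (rect h a)) := fun s hf =>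
    hf.add ((memLp_reflect hf).const_mul s)
  have strip : ∀ {f : ℝ × ℝ → ℝ} (s : ℝ), MemLp f 2 (volume.restrict (rect h a)) →
      ∀ᶠ n : ℕ in atTop, rsq h (a / (n + 1)) (fun p => f p + s * f (R p)) < ε / (4 * (M + 1)) :=
    fun s hf => (tendsto_rsq_strip ha (mem s hf)).eventually_lt_const (by positivity)
  -- The order of choices matters: the strip is fixed first, from `u` and its derivatives alone, and
  -- only then the index of the approximation. The boundary difference carries `1 / δ` and needs `δ`
  -- fixed to tend to zero.
  obtain ⟨m, ho, hox, hoy⟩ := ((strip (-1) hu.memLp).and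
    ((strip (-1) hu.memLp_dx).and (strip 1 hu.memLp_dy))).exists
  set δ := a / ((m : ℝ) + 1) with hδ
  have hδ0 : 0 < δ := by positivity
  have hδa : δ ≤ a := div_le_self ha.le (by linarith [m.cast_nonneg (α := ℝ)])
  rw [lt_div_iff₀ (by positivity)] at ho hox hoy
  have lx : ∀ {e : ℕ → ℝ} {A : ℝ}, 0 ≤ A → A * (4 * (M + 1)) < ε → Tendsto e atTop (𝓝 0) →
      ∀ᶠ n in atTop, 2 * (2 * A + 8 * e n) + 2 * e n < ε := by
    intro e A hA hlt he
    have := ((((he.const_mul 8).const_add (2 * A)).const_mul 2).add (he.const_mul 2))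
    refine this.eventually_lt_const ?_
    nlinarith [mul_nonneg hA hM.le]
  have ly : ∀ᶠ n in atTop, 2 * (M * ((2 * rsq h δ (fun p => uy p + 1 * uy (R p)) +
      8 * rsq h a (fun p => pdy (ψ n) p - uy p)) +
        1 / δ * ∫ x in Ioo 0 h, (ψ n (x, 0) - ψ n (x, a)) ^ 2)) +
      2 * rsq h a (fun p => pdy (ψ n) p - uy p) < ε := by
    have := (((((ψy.const_mul 8).const_add (2 * rsq h δ (fun p => uy p + 1 * uy (R p)))).add
      (ψt.const_mul (1 / δ))).const_mul M).const_mul 2).add (ψy.const_mul 2)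
    refine this.eventually_lt_const ?_
    have := rsq_nonneg h δ (fun p => uy p + 1 * uy (R p))
    nlinarith
  obtain ⟨n, hn0, hnx, hny⟩ := ((lx (rsq_nonneg _ _ _) ho ψ0).and
    ((lx (rsq_nonneg _ _ _) hox ψx).and ly)).exists
  have hψd := (hψ n).differentiable (by simp)
  have hdR : DifferentiableAt ℝ (fun p => ψ n (R p)) = fun _ => True := by
    funext p
    exact eq_true (((hψ n).comp (contDiff_diagAffine _ _ _ _)).differentiable (by simp) p)
  have cx : Continuous (pdx (ψ n)) := (contDiff_fderiv_apply (hψ n) _).continuous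
  have cy : Continuous (pdy (ψ n)) := (contDiff_fderiv_apply (hψ n) _).continuous
  have eO : (fun p => ψ n p - ψ n (R p)) = fun p => ψ n p + (-1) * ψ n (R p) := by
    funext p; ring
  have ex : pdx (fun p => ψ n p - ψ n (R p)) = fun p => pdx (ψ n) p + (-1) * pdx (ψ n) (R p) := by
    funext p
    have := pdx_comp_diagAffine (σ := 1) (τ := 0) (t := -1) (s := a) (p := p) (hψd (R p))
    simp only [pdx] at this ⊢
    rw [fderiv_fun_sub (hψd p) (by rw [hdR]; trivial), _root_.sub_apply, this]
    ring
  have ey : pdy (fun p => ψ n p - ψ n (R p)) = fun p => pdy (ψ n) p + 1 * pdy (ψ n) (R p) := by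
    funext p
    have := pdy_comp_diagAffine (σ := 1) (τ := 0) (t := -1) (s := a) (p := p) (hψd (R p))
    simp only [pdy] at this ⊢
    rw [fderiv_fun_sub (hψd p) (by rw [hdR]; trivial), _root_.sub_apply, this]
    ring
  obtain ⟨φ, hφ, hper, b0, bx, b_y⟩ := hmod (h := h) hδ0 hδa (hψ n) rfl
  rw [ex] at bx
  rw [ey] at b_y
  rw [← hR] at b0
  rw [eO] at b0
  have cφx : Continuous (pdx φ) := (contDiff_fderiv_apply hφ _).continuous
  have cφy : Continuous (pdy φ) := (contDiff_fderiv_apply hφ _).continuous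
  have tri : ∀ {f k l : ℝ × ℝ → ℝ}, Continuous f → Continuous k →
      MemLp l 2 (volume.restrict (rect h a)) → rsq h a (fun p => f p - l p) ≤
        2 * rsq h a (fun p => f p - k p) + 2 * rsq h a (fun p => k p - l p) := by
    intro f k l hf hk hl
    have mf := memLp_rect_of_continuous (h := h) (a := a) (q := 2) hf
    have mk := memLp_rect_of_continuous (h := h) (a := a) (q := 2) hk
    refine rsq_le_add (mf.sub hl) (mf.sub mk) (mk.sub hl) fun p _ => ?_
    nlinarith [sq_nonneg ((f p - k p) - (k p - l p))]
  have c0 := rsq_add_reflect_le (s := -1) hδa (by norm_num)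
    (memLp_rect_of_continuous (h := h) (hψ n).continuous) hu.memLp
  have c1 := rsq_add_reflect_le (s := -1) hδa (by norm_num)
    (memLp_rect_of_continuous (h := h) cx) hu.memLp_dx
  have c2 := rsq_add_reflect_le (s := 1) hδa (by norm_num)
    (memLp_rect_of_continuous (h := h) cy) hu.memLp_dy
  rw [← hR] at c0 c1 c2
  refine ⟨φ, hφ, hper, ?_, ?_, ?_⟩
  · refine (tri hφ.continuous (hψ n).continuous hu.memLp).trans_lt (lt_of_le_of_lt ?_ hn0)
    linarith
  · refine (tri cφx cx hu.memLp_dx).trans_lt (lt_of_le_of_lt ?_ hnx)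
    linarith
  · refine (tri cφy cy hu.memLp_dy).trans_lt (lt_of_le_of_lt ?_ hny)
    gcongr
    have e : ∀ x : ℝ, diagAffine 1 0 (-1) a (x, 0) = (x, a) := fun x => by simp [diagAffine]
    simp only [e] at b_y
    refine b_y.trans ?_
    gcongr

/-! ### Passing to the limit in the displacement and in the weight -/

theorem tendsto_wsq {h a : ℝ} {W : ℝ → ℝ} (hW : ContinuousOn W (Icc 0 a))
    (hW0 : ∀ y ∈ Icc 0 a, 0 ≤ W y) {φ : ℕ → ℝ × ℝ → ℝ} {f : ℝ × ℝ → ℝ}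
    (hφ : ∀ n, MemLp (φ n) 2 (volume.restrict (rect h a)))
    (hf : MemLp f 2 (volume.restrict (rect h a)))
    (ht : Tendsto (fun n => rsq h a (fun p => φ n p - f p)) atTop (𝓝 0)) :
    Tendsto (fun n => wsq h a W (φ n)) atTop (𝓝 (wsq h a W f)) := by
  obtain ⟨B, hB⟩ := isCompact_Icc.exists_bound_of_continuousOn hW
  have hd : ∀ n, MemLp (fun p => φ n p - f p) 2 (volume.restrict (rect h a)) := fun n =>
    (hφ n).sub hf
  have hWd : Tendsto (fun n => wsq h a W (fun p => φ n p - f p)) atTop (𝓝 0) := by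
    refine squeeze_zero (fun n => wsq_nonneg hW0 _) (fun n => ?_)
      (by simpa using ht.const_mul B)
    rw [rsq_eq, ← integral_const_mul]
    refine setIntegral_mono_on (integrableOn_wsq hW (hd n))
      ((hd n).integrable_sq.const_mul B) (measurableSet_rect h a) fun p hp => ?_
    gcongr
    exact (le_abs_self _).trans (hB _ (rect_subset_Icc h a hp).2)
  have hkey : ∀ n, |wsq h a W (φ n) - wsq h a W f| ≤ wsq h a W (fun p => φ n p - f p) +
      2 * (√(wsq h a W f) * √(wsq h a W (fun p => φ n p - f p))) := by
    intro n
    have hcs := integral_weight_mul_le hW hW0 hf (hd n)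
    have i1 := integrableOn_wsq hW (hφ n)
    have i2 := integrableOn_wsq hW hf
    have i3 := integrableOn_wsq hW (hd n)
    have i4 : IntegrableOn (fun p => W p.2 * (|f p| * |φ n p - f p|)) (rect h a) :=
      integrableOn_rect_continuousOn_mul (continuousOn_comp_snd hW)
        (hf.abs.integrable_mul (hd n).abs)
    calc |wsq h a W (φ n) - wsq h a W f|
        = |∫ p in rect h a, (W p.2 * φ n p ^ 2 - W p.2 * f p ^ 2)| := by
          rw [integral_sub i1 i2]; rfl
      _ ≤ ∫ p in rect h a, |W p.2 * φ n p ^ 2 - W p.2 * f p ^ 2| := abs_integral_le_integral_abs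
      _ ≤ ∫ p in rect h a, (W p.2 * (φ n p - f p) ^ 2 + 2 * (W p.2 * (|f p| * |φ n p - f p|))) := by
          refine setIntegral_mono_on (i1.sub i2).abs (i3.add (i4.const_mul 2))
            (measurableSet_rect h a) fun p hp => ?_
          have hp0 := hW0 _ (rect_subset_Icc h a hp).2
          have e : W p.2 * φ n p ^ 2 - W p.2 * f p ^ 2 =
              W p.2 * (φ n p - f p) ^ 2 + 2 * (W p.2 * (f p * (φ n p - f p))) := by ring
          rw [e]
          refine (abs_add_le _ _).trans ?_
          rw [abs_of_nonneg (mul_nonneg hp0 (sq_nonneg _)), abs_mul, abs_mul, abs_mul,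
            abs_of_nonneg hp0, abs_two]
      _ = wsq h a W (fun p => φ n p - f p) +
          2 * ∫ p in rect h a, W p.2 * (|f p| * |φ n p - f p|) := by
          rw [integral_add i3 (i4.const_mul 2), integral_const_mul]; rfl
      _ ≤ _ := by gcongr; exact hcs
  rw [tendsto_iff_dist_tendsto_zero]
  have hs : Tendsto (fun n => √(wsq h a W (fun p => φ n p - f p))) atTop (𝓝 0) := by
    simpa using hWd.sqrt
  have hup := hWd.add ((hs.const_mul √(wsq h a W f)).const_mul 2)
  simp only [mul_zero, add_zero] at hup
  exact squeeze_zero (fun n => dist_nonneg) (fun n => hkey n) hup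

/-- Dominated convergence; the weights need to converge only on the open interval, so their
behaviour at the degenerate side is irrelevant. -/
theorem tendsto_wsq_weight {h a B : ℝ} {Wn : ℕ → ℝ → ℝ} {W : ℝ → ℝ}
    (hc : ∀ n, ContinuousOn (Wn n) (Icc 0 a)) (hb : ∀ n, ∀ y ∈ Ioo 0 a, |Wn n y| ≤ B)
    (hlim : ∀ y ∈ Ioo 0 a, Tendsto (fun n => Wn n y) atTop (𝓝 (W y))) {f : ℝ × ℝ → ℝ}
    (hf : MemLp f 2 (volume.restrict (rect h a))) :
    Tendsto (fun n => wsq h a (Wn n) f) atTop (𝓝 (wsq h a W f)) := by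
  refine tendsto_integral_of_dominated_convergence (fun p => B * f p ^ 2)
    (fun n => (integrableOn_wsq (hc n) hf).aestronglyMeasurable) (hf.integrable_sq.const_mul B)
    (fun n => ?_) ?_
  · refine (ae_restrict_iff' (measurableSet_rect h a)).2 (Eventually.of_forall fun p hp => ?_)
    rw [Real.norm_eq_abs, abs_mul, abs_of_nonneg (sq_nonneg (f p))]
    gcongr
    exact hb n _ hp.2
  · exact (ae_restrict_iff' (measurableSet_rect h a)).2
      (Eventually.of_forall fun p hp => (hlim _ hp.2).mul_const _)

theorem tendsto_kornBound {h a : ℝ} {Wn : ℕ → ℝ → ℝ} {W : ℝ → ℝ} {un An Dn Bn : ℕ → ℝ × ℝ → ℝ}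
    {u A D B : ℝ × ℝ → ℝ}
    (hu : Tendsto (fun n => wsq h a (Wn n) (un n)) atTop (𝓝 (wsq h a W u)))
    (hA : Tendsto (fun n => wsq h a (Wn n) (An n)) atTop (𝓝 (wsq h a W A)))
    (hD : Tendsto (fun n => wsq h a (Wn n) (Dn n)) atTop (𝓝 (wsq h a W D)))
    (hB : Tendsto (fun n => wsq h a (Wn n) (Bn n)) atTop (𝓝 (wsq h a W B))) :
    Tendsto (fun n => kornBound h a (Wn n) (un n) (An n) (Dn n) (Bn n)) atTop
      (𝓝 (kornBound h a W u A D B)) :=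
  ((hu.sqrt.mul hB.sqrt).div_const h).add ((hA.add hD).add hB)

/-- The Korn inequality passes from smooth functions to `H¹` functions with equal traces. -/
theorem korn_of_smooth_periodic {h a C : ℝ} (ha : 0 < a) {W : ℝ → ℝ} (hW : ContinuousOn W (Icc 0 a))
    (hW0 : ∀ y ∈ Icc 0 a, 0 ≤ W y) {u ux uy F G : ℝ × ℝ → ℝ} {g : ℝ → ℝ}
    (hF : MemLp F 2 (volume.restrict (rect h a)))
    (hsm : ∀ φ : ℝ × ℝ → ℝ, ContDiff ℝ ∞ φ → (∀ x, φ (x, 0) = φ (x, a)) →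
      wsq h a W (pdy φ) ≤ C * kornBound h a W φ (pdx φ) (fun p => pdy φ p + F p) G)
    (hu : IsSobolevH1 (rect h a) u ux uy) (h0 : HasTraceOnSide h a 0 u ux uy g)
    (h1 : HasTraceOnSide h a a u ux uy g) :
    wsq h a W uy ≤ C * kornBound h a W u ux (fun p => uy p + F p) G := by
  have hex := fun n : ℕ => exists_periodic_approx ha hu h0 h1 (ε := 1 / ((n : ℝ) + 1))
    (by positivity)
  choose φ hφ hper b0 bx b_y using hex
  have hz : Tendsto (fun n : ℕ => 1 / ((n : ℝ) + 1)) atTop (𝓝 0) :=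
    tendsto_one_div_add_atTop_nhds_zero_nat
  have m0 := fun n => memLp_rect_of_continuous (h := h) (a := a) (q := 2) (hφ n).continuous
  have mx : ∀ n, MemLp (pdx (φ n)) 2 (volume.restrict (rect h a)) := fun n =>
    memLp_rect_of_continuous (contDiff_fderiv_apply (hφ n) _).continuous
  have my : ∀ n, MemLp (pdy (φ n)) 2 (volume.restrict (rect h a)) := fun n =>
    memLp_rect_of_continuous (contDiff_fderiv_apply (hφ n) _).continuous
  have sq : ∀ {f : ℕ → ℝ × ℝ → ℝ}, (∀ n : ℕ, rsq h a (f n) < 1 / ((n : ℝ) + 1)) →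
      Tendsto (fun n => rsq h a (f n)) atTop (𝓝 0) := fun hf =>
    squeeze_zero (fun n => rsq_nonneg _ _ _) (fun n => (hf n).le) hz
  have t0 := tendsto_wsq hW hW0 m0 hu.memLp (sq b0)
  have tx := tendsto_wsq hW hW0 mx hu.memLp_dx (sq bx)
  have ty := tendsto_wsq hW hW0 my hu.memLp_dy (sq b_y)
  -- The field `(F, G)` stays fixed, so the shear converges together with the vertical derivative.
  have tD := tendsto_wsq hW hW0 (φ := fun n p => pdy (φ n) p + F p) (fun n => (my n).add hF)
    (hu.memLp_dy.add hF) (by simpa using sq b_y)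
  exact le_of_tendsto_of_tendsto' ty ((tendsto_kornBound t0 tx tD tendsto_const_nhds).const_mul C)
    fun n => hsm (φ n) (hφ n) (hper n)

/-! ### Reflection and the inequality for Sobolev functions -/

theorem wsq_neg_one_mul (h a : ℝ) (V : ℝ → ℝ) (f : ℝ × ℝ → ℝ) :
    wsq h a V (fun p => -1 * f p) = wsq h a V f := by
  simp [wsq]

theorem wsq_reflect_left (h a : ℝ) (W : ℝ → ℝ) (f : ℝ × ℝ → ℝ) :
    wsq h a W (fun p => f (diagAffine 1 0 (-1) a p)) = wsq h a (fun y => W (a - y)) f := by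
  simpa using wsq_reflect h a (fun y => W (a - y)) f

/-- Reflecting `y` means replacing `v` by minus its reflection: then the shear only changes sign,
and `v_y` is merely composed with the reflection. -/
theorem KornData.reflect {h a : ℝ} {u F G : ℝ × ℝ → ℝ} (hd : KornData h a u F G) :
    KornData h a (fun p => u (diagAffine 1 0 (-1) a p))
      (fun p => -1 * F (diagAffine 1 0 (-1) a p)) (fun p => G (diagAffine 1 0 (-1) a p)) where
  width_pos := hd.width_pos
  height_pos := hd.height_pos
  smooth := hd.smooth.comp (contDiff_diagAffine _ _ _ _)
  curlFree := by
    have := hd.curlFree.comp_diagAffine one_ne_zero (by norm_num : (-1 : ℝ) ≠ 0) 0 a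
      (mapsTo_reflect h a)
    simpa using this
  memLp_dx := (memLp_reflect hd.memLp_dx).const_mul (-1)
  memLp_dy := memLp_reflect hd.memLp_dy

/-- The weighted Korn inequality for smooth periodic functions, with the weight degenerating on
either side. -/
theorem exists_korn_periodic_reflect {K θ : ℝ} (hK : 0 ≤ K) (hθ0 : 0 < θ) (hθ1 : θ < 1) :
    ∃ C : ℝ, 0 < C ∧ ∀ {h a : ℝ} {W : ℝ → ℝ} {u F G : ℝ × ℝ → ℝ},
      KornData h a u F G → PowerLikeWeight a K θ W → (∀ x, u (x, 0) = u (x, a)) →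
      wsq h a W (pdy u) ≤ C * kornBound h a W u (pdx u) (fun p => pdy u p + F p) G ∧
      wsq h a (fun y => W (a - y)) (pdy u) ≤
        C * kornBound h a (fun y => W (a - y)) u (pdx u) (fun p => pdy u p + F p) G := by
  obtain ⟨C, hC, hk⟩ := exists_korn_periodic hK hθ0 hθ1
  refine ⟨C, hC, fun {h a W u F G} hd hW hper => ⟨hk hd hW hper, ?_⟩⟩
  have hu := hd.smooth.differentiable (by simp)
  have key := hk hd.reflect hW (fun x => by simp [diagAffine, hper x])
  have ex : pdx (fun p => u (diagAffine 1 0 (-1) a p)) =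
      fun p => pdx u (diagAffine 1 0 (-1) a p) := by
    funext p; rw [pdx_comp_diagAffine (hu _), one_mul]
  have ey : pdy (fun p => u (diagAffine 1 0 (-1) a p)) =
      fun p => -1 * pdy u (diagAffine 1 0 (-1) a p) := by
    funext p; rw [pdy_comp_diagAffine (hu _)]
  rw [ex, ey] at key
  simp only [← mul_add] at key
  unfold kornBound at key ⊢
  rw [wsq_neg_one_mul, wsq_neg_one_mul, wsq_reflect_left h a W (pdy u), wsq_reflect_left h a W u,
    wsq_reflect_left h a W G, wsq_reflect_left h a W (pdx u),
    wsq_reflect_left h a W (fun p => pdy u p + F p)] at key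
  exact key

section

variable {k : ℕ} {c α : Fin k → ℝ} {β : ℝ}

theorem tendsto_powSum_sq {r : ℝ} (hr : 0 < r) :
    Tendsto (fun n : ℕ => powSum c α (r + 1 / ((n : ℝ) + 1)) ^ 2) atTop (𝓝 (powSum c α r ^ 2)) := by
  have h1 : Tendsto (fun n : ℕ => r + 1 / ((n : ℝ) + 1)) atTop (𝓝 r) := by
    simpa using (tendsto_one_div_add_atTop_nhds_zero_nat (𝕜 := ℝ)).const_add r
  exact (((contDiffAt_powSum (c := c) (α := α) hr).continuousAt.tendsto).comp h1).pow 2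

/-- The shifts are at most `1`, so monotonicity gives the constant bound that dominates all the
shifted weights. -/
theorem abs_powSum_sq_le (hc : ∀ i, 0 ≤ c i) (hα : ∀ i, 0 ≤ α i ∧ α i ≤ β) {r a : ℝ} (hr : 0 ≤ r)
    (hra : r ≤ a) (n : ℕ) :
    |powSum c α (r + 1 / ((n : ℝ) + 1)) ^ 2| ≤ powSum c α (a + 1) ^ 2 := by
  have h0 : 0 ≤ 1 / ((n : ℝ) + 1) := by positivity
  have h1 : 1 / ((n : ℝ) + 1) ≤ 1 := by
    rw [div_le_one (by positivity)]; linarith [n.cast_nonneg (α := ℝ)]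
  rw [abs_of_nonneg (sq_nonneg _)]
  exact pow_le_pow_left₀ (powSum_nonneg hc (by positivity))
    (powSum_mono hc hα (by positivity) (by linarith)) 2

end

/-- The weighted Korn inequality in `H¹` for the off-diagonal derivative, with a sum of powers of
the distance to either horizontal side as weight. -/
theorem exists_korn_sobolev {β : ℝ} (hβ : β < 1 / 2) :
    ∃ C : ℝ, 0 < C ∧ ∀ {k : ℕ} {c α : Fin k → ℝ} {h a : ℝ} {u ux uy v vx vy : ℝ × ℝ → ℝ} {g : ℝ → ℝ},
      0 < a → 0 < h → (∀ i, 0 ≤ c i) → (∀ i, 0 ≤ α i ∧ α i ≤ β) →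
      IsSobolevH1 (rect h a) u ux uy → IsSobolevH1 (rect h a) v vx vy →
      HasTraceOnSide h a 0 u ux uy g → HasTraceOnSide h a a u ux uy g →
      wsq h a (fun y => powSum c α y ^ 2) uy ≤
        C * kornBound h a (fun y => powSum c α y ^ 2) u ux (fun p => uy p + vx p) vy ∧
      wsq h a (fun y => powSum c α (a - y) ^ 2) uy ≤
        C * kornBound h a (fun y => powSum c α (a - y) ^ 2) u ux (fun p => uy p + vx p) vy := by
  have hθ : (2 : ℝ) ^ (2 * β) < 2 := by
    calc (2 : ℝ) ^ (2 * β) < 2 ^ (1 : ℝ) :=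
          Real.rpow_lt_rpow_of_exponent_lt (by norm_num) (by linarith)
      _ = 2 := Real.rpow_one 2
  obtain ⟨C, hC, hk⟩ := exists_korn_periodic_reflect (K := 1 / (1 - 2 * β))
    (θ := (2 : ℝ) ^ (2 * β) / 2) (by apply div_nonneg <;> linarith) (by positivity) (by linarith)
  refine ⟨C, hC, fun {k c α h a u ux uy v vx vy g} ha hh hc hα hu hv h0 h1 => ?_⟩
  -- One constant `C` serves all shifts, since it depends only on `K` and `θ`. For each fixed shift
  -- the displacement is approximated first; the shift is removed afterwards.
  set ε : ℕ → ℝ := fun n => 1 / ((n : ℝ) + 1) with hε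
  have hε0 : ∀ n, 0 < ε n := fun n => by simp only [hε]; positivity
  have hW := fun n => powerLikeWeight_powSum hβ hc hα ha (hε0 n)
  have hdata : ∀ φ : ℝ × ℝ → ℝ, ContDiff ℝ ∞ φ → KornData h a φ vx vy := fun φ hφ =>
    ⟨hh, ha, hφ, hv.curlFree, hv.memLp_dx, hv.memLp_dy⟩
  have hrefl : MapsTo (fun y : ℝ => a - y) (Icc 0 a) (Icc 0 a) := fun y hy =>
    ⟨by linarith [hy.2], by linarith [hy.1]⟩
  have hcr : ∀ n, ContinuousOn (fun y => powSum c α (a - y + ε n) ^ 2) (Icc 0 a) := fun n =>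
    (hW n).continuousOn.comp (f := fun y : ℝ => a - y) (by fun_prop) hrefl
  have conv : ∀ {Wn : ℕ → ℝ → ℝ} {W : ℝ → ℝ} {B : ℝ}, (∀ n, ContinuousOn (Wn n) (Icc 0 a)) →
      (∀ n, ∀ y ∈ Ioo 0 a, |Wn n y| ≤ B) →
      (∀ y ∈ Ioo 0 a, Tendsto (fun n => Wn n y) atTop (𝓝 (W y))) →
      (∀ n, wsq h a (Wn n) uy ≤ C * kornBound h a (Wn n) u ux (fun p => uy p + vx p) vy) →
      wsq h a W uy ≤ C * kornBound h a W u ux (fun p => uy p + vx p) vy := by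
    intro Wn W B c1 c2 c3 c4
    have t := fun {f : ℝ × ℝ → ℝ} (hf : MemLp f 2 (volume.restrict (rect h a))) =>
      tendsto_wsq_weight c1 c2 c3 hf
    exact le_of_tendsto_of_tendsto' (t hu.memLp_dy)
      ((tendsto_kornBound (t hu.memLp) (t hu.memLp_dx) (t (hu.memLp_dy.add hv.memLp_dx))
        (t hv.memLp_dy)).const_mul C) c4
  constructor
  · refine conv (Wn := fun n y => powSum c α (y + ε n) ^ 2) (fun n => (hW n).continuousOn)
      (fun n y hy => abs_powSum_sq_le hc hα hy.1.le hy.2.le n)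
      (fun y hy => tendsto_powSum_sq hy.1) fun n => ?_
    exact korn_of_smooth_periodic ha (hW n).continuousOn (hW n).nonneg hv.memLp_dx
      (fun φ hφ hper => (hk (hdata φ hφ) (hW n) hper).1) hu h0 h1
  · refine conv (Wn := fun n y => powSum c α (a - y + ε n) ^ 2)
      (B := powSum c α (a + 1) ^ 2) hcr
      (fun n y hy => abs_powSum_sq_le hc hα (sub_nonneg.2 hy.2.le) (by linarith [hy.1]) n)
      (fun y hy => tendsto_powSum_sq (sub_pos.2 hy.2)) fun n => ?_
    exact korn_of_smooth_periodic ha (hcr n) (fun y _ => sq_nonneg _) hv.memLp_dx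
      (fun φ hφ hper => (hk (hdata φ hφ) (hW n) hper).2) hu h0 h1

/-! ### The distance weight, matrix norms and the conclusion -/

/-- The foot `(p.1, s)` of the perpendicular belongs to the segment exactly because `p.1` lies in
`(0, h)`. -/
theorem sideDist_eq {h s : ℝ} {p : ℝ × ℝ} (hp : p.1 ∈ Ioo 0 h) : sideDist h s p = |p.2 - s| := by
  have hmem : WithLp.toLp 2 (p.1, s) ∈ WithLp.toLp 2 '' (Ioo 0 h ×ˢ {s} : Set (ℝ × ℝ)) :=
    mem_image_of_mem _ ⟨hp, rfl⟩
  refine le_antisymm ((Metric.infDist_le_dist_of_mem hmem).trans_eq ?_) ?_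
  · rw [WithLp.prod_dist_eq_of_L2]
    simp [Real.dist_eq, Real.sqrt_sq_eq_abs]
  · refine (Metric.le_infDist ⟨_, hmem⟩).2 ?_
    rintro _ ⟨⟨x, y⟩, ⟨-, hy⟩, rfl⟩
    have hy' : y = s := hy
    rw [WithLp.prod_dist_eq_of_L2]
    refine Real.le_sqrt_of_sq_le ?_
    simp only [Real.dist_eq, hy']
    exact le_add_of_nonneg_left (sq_nonneg _)

theorem sideWeight_zero {k : ℕ} {h a : ℝ} (c α : Fin k → ℝ) {p : ℝ × ℝ} (hp : p ∈ rect h a) :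
    sideWeight h 0 c α p = powSum c α p.2 := by
  simp only [sideWeight, powSum, sideDist_eq hp.1, sub_zero, abs_of_pos hp.2.1]

theorem sideWeight_height {k : ℕ} {h a : ℝ} (c α : Fin k → ℝ) {p : ℝ × ℝ} (hp : p ∈ rect h a) :
    sideWeight h a c α p = powSum c α (a - p.2) := by
  simp only [sideWeight, powSum, sideDist_eq hp.1, abs_sub_comm p.2 a,
    abs_of_pos (sub_pos.2 hp.2.2)]

theorem frob_gradMat_sq (ux uy vx vy : ℝ × ℝ → ℝ) (p : ℝ × ℝ) :
    frob (gradMat ux uy vx vy p) ^ 2 = ux p ^ 2 + uy p ^ 2 + vx p ^ 2 + vy p ^ 2 := by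
  rw [frob, Real.sq_sqrt (by positivity)]
  simp [gradMat, Fin.sum_univ_two]
  ring

theorem frob_symPart_gradMat_sq (ux uy vx vy : ℝ × ℝ → ℝ) (p : ℝ × ℝ) :
    frob (symPart (gradMat ux uy vx vy p)) ^ 2 =
      ux p ^ 2 + (uy p + vx p) ^ 2 / 2 + vy p ^ 2 := by
  rw [frob, Real.sq_sqrt (by positivity)]
  simp [gradMat, symPart, Fin.sum_univ_two]
  ring

theorem l2norm_sq (Ω : Set (ℝ × ℝ)) (f : ℝ × ℝ → ℝ) : l2norm Ω f ^ 2 = ∫ p in Ω, f p ^ 2 :=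
  Real.sq_sqrt (integral_nonneg fun _ => sq_nonneg _)

theorem integrableOn_sq_weight {h a B : ℝ} {w : ℝ → ℝ} (hm : Measurable w)
    (hb : ∀ y ∈ Ioo 0 a, |w y| ≤ B) {f : ℝ × ℝ → ℝ} (hf : MemLp f 2 (volume.restrict (rect h a))) :
    IntegrableOn (fun p => w p.2 ^ 2 * f p ^ 2) (rect h a) := by
  refine Integrable.bdd_mul (c := B ^ 2) hf.integrable_sq
    ((hm.comp measurable_snd).pow_const 2).aestronglyMeasurable ?_
  refine (ae_restrict_iff' (measurableSet_rect h a)).2 (Eventually.of_forall fun p hp => ?_)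
  rw [norm_pow, Real.norm_eq_abs]
  exact pow_le_pow_left₀ (abs_nonneg _) (hb _ hp.2) 2

/-- The bound on one off-diagonal derivative yields the Korn inequality for the full gradient. -/
theorem korn_gradient_of_wsq_le {h a B C : ℝ} (hh : 0 < h) (hC : 0 ≤ C) {w : ℝ → ℝ}
    {wt : ℝ × ℝ → ℝ} (hm : Measurable w) (hb : ∀ y ∈ Ioo 0 a, |w y| ≤ B)
    (hwt : ∀ p ∈ rect h a, wt p = w p.2) {u ux uy v vx vy : ℝ × ℝ → ℝ}
    (hu : IsSobolevH1 (rect h a) u ux uy) (hv : IsSobolevH1 (rect h a) v vx vy)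
    (hk : wsq h a (fun y => w y ^ 2) uy ≤
      C * kornBound h a (fun y => w y ^ 2) u ux (fun p => uy p + vx p) vy) :
    l2norm (rect h a) (fun p => wt p * frob (gradMat ux uy vx vy p)) ^ 2 ≤
      (6 * C + 4) * (l2norm (rect h a) (fun p => wt p * u p) *
        l2norm (rect h a) (fun p => wt p * frob (symPart (gradMat ux uy vx vy p))) / h +
        l2norm (rect h a) (fun p => wt p * frob (symPart (gradMat ux uy vx vy p))) ^ 2) := by
  have hw0 : ∀ y ∈ Icc 0 a, 0 ≤ w y ^ 2 := fun y _ => sq_nonneg _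
  have hD : MemLp (fun p => uy p + vx p) 2 (volume.restrict (rect h a)) :=
    hu.memLp_dy.add hv.memLp_dx
  have ia := integrableOn_sq_weight hm hb hu.memLp_dx
  have ib := integrableOn_sq_weight hm hb hu.memLp_dy
  have id := integrableOn_sq_weight hm hb hD
  have ie := integrableOn_sq_weight hm hb hv.memLp_dy
  have iv := integrableOn_sq_weight hm hb hv.memLp_dx
  have eU : l2norm (rect h a) (fun p => wt p * u p) = √(wsq h a (fun y => w y ^ 2) u) := by
    unfold l2norm wsq
    congr 1
    exact setIntegral_congr_fun (measurableSet_rect h a) fun p hp => by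
      simp only [hwt p hp, mul_pow]
  have eS : l2norm (rect h a) (fun p => wt p * frob (symPart (gradMat ux uy vx vy p))) ^ 2 =
      wsq h a (fun y => w y ^ 2) ux + (1 / 2) * wsq h a (fun y => w y ^ 2) (fun p => uy p + vx p) +
        wsq h a (fun y => w y ^ 2) vy := by
    have i1 : IntegrableOn (fun p => w p.2 ^ 2 * ux p ^ 2 +
        (1 / 2) * (w p.2 ^ 2 * (uy p + vx p) ^ 2)) (rect h a) := ia.add (id.const_mul _)
    rw [l2norm_sq]
    unfold wsq
    rw [← integral_const_mul, ← integral_add ia (id.const_mul _), ← integral_add i1 ie]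
    refine setIntegral_congr_fun (measurableSet_rect h a) fun p hp => ?_
    simp only [hwt p hp, mul_pow, frob_symPart_gradMat_sq]
    ring
  have eG : l2norm (rect h a) (fun p => wt p * frob (gradMat ux uy vx vy p)) ^ 2 ≤
      wsq h a (fun y => w y ^ 2) ux + 2 * wsq h a (fun y => w y ^ 2) (fun p => uy p + vx p) +
        3 * wsq h a (fun y => w y ^ 2) uy + wsq h a (fun y => w y ^ 2) vy := by
    have i1 : IntegrableOn (fun p => w p.2 ^ 2 * ux p ^ 2 +
        2 * (w p.2 ^ 2 * (uy p + vx p) ^ 2)) (rect h a) := ia.add (id.const_mul _)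
    have i2 : IntegrableOn (fun p => w p.2 ^ 2 * ux p ^ 2 +
        2 * (w p.2 ^ 2 * (uy p + vx p) ^ 2) + 3 * (w p.2 ^ 2 * uy p ^ 2)) (rect h a) :=
      i1.add (ib.const_mul _)
    have i3 : IntegrableOn (fun p => w p.2 ^ 2 * ux p ^ 2 + w p.2 ^ 2 * uy p ^ 2 +
        w p.2 ^ 2 * vx p ^ 2 + w p.2 ^ 2 * vy p ^ 2) (rect h a) := ((ia.add ib).add iv).add ie
    have e : ∫ p in rect h a, (wt p * frob (gradMat ux uy vx vy p)) ^ 2 =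
        ∫ p in rect h a, (w p.2 ^ 2 * ux p ^ 2 + w p.2 ^ 2 * uy p ^ 2 +
        w p.2 ^ 2 * vx p ^ 2 + w p.2 ^ 2 * vy p ^ 2) := by
      refine setIntegral_congr_fun (measurableSet_rect h a) fun p hp => ?_
      simp only [hwt p hp, mul_pow, frob_gradMat_sq]
      ring
    rw [l2norm_sq, e]
    unfold wsq
    rw [← integral_const_mul, ← integral_const_mul, ← integral_add ia (id.const_mul _),
      ← integral_add i1 (ib.const_mul _), ← integral_add i2 ie]
    refine setIntegral_mono_on i3 (i2.add ie) (measurableSet_rect h a) fun p _ => ?_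
    -- The other off-diagonal derivative is the doubled shear strain minus `uy`; hence the
    -- coefficient `3` of `uy` above.
    have h1 : vx p ^ 2 ≤ 2 * (uy p + vx p) ^ 2 + 2 * uy p ^ 2 := by
      nlinarith [sq_nonneg ((uy p + vx p) + uy p)]
    nlinarith [mul_le_mul_of_nonneg_left h1 (sq_nonneg (w p.2))]
  set S := l2norm (rect h a) (fun p => wt p * frob (symPart (gradMat ux uy vx vy p))) with hS
  have hS0 : 0 ≤ S := Real.sqrt_nonneg _
  have a0 := wsq_nonneg (h := h) hw0 ux
  have d0 := wsq_nonneg (h := h) hw0 (fun p => uy p + vx p)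
  have v0 := wsq_nonneg (h := h) hw0 vy
  have hvy : √(wsq h a (fun y => w y ^ 2) vy) ≤ S := by
    rw [Real.sqrt_le_left hS0, eS]; linarith
  have hprod : √(wsq h a (fun y => w y ^ 2) u) * √(wsq h a (fun y => w y ^ 2) vy) / h ≤
      √(wsq h a (fun y => w y ^ 2) u) * S / h := by gcongr
  have hb' : kornBound h a (fun y => w y ^ 2) u ux (fun p => uy p + vx p) vy ≤
      √(wsq h a (fun y => w y ^ 2) u) * S / h + 2 * S ^ 2 := by
    unfold kornBound
    linarith
  have hX : 0 ≤ √(wsq h a (fun y => w y ^ 2) u) * S / h := by positivity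
  have hk' := hk.trans (mul_le_mul_of_nonneg_left hb' hC)
  rw [eU]
  have hCX := mul_nonneg hC hX
  have hCS := mul_nonneg hC (sq_nonneg S)
  -- `S ^ 2` contains the squared shear `(uy + vx)²` with weight `1 / 2`, so `2 (uy + vx)²` costs `4
  -- S ^ 2` and the strain part of `kornBound` costs `2 S ^ 2`. This yields `6 C + 4`.
  calc _ ≤ 4 * S ^ 2 + 3 * (C * (√(wsq h a (fun y => w y ^ 2) u) * S / h + 2 * S ^ 2)) := by
        linarith
    _ ≤ _ := by linarith

theorem measurable_powSum {k : ℕ} (c α : Fin k → ℝ) : Measurable (powSum c α) := by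
  unfold powSum
  fun_prop

theorem theorem2p2 (k : ℕ) (β : ℝ) (hβ₀ : 0 ≤ β) (hβ : β < 1 / 2) :
    ∃ C : ℝ, 0 < C ∧
      ∀ (a h : ℝ), 0 < a → 0 < h →
      -- the side `(0,h) × {s}` to which the distance is taken is either horizontal side
      ∀ s : ℝ, s = 0 ∨ s = a →
      ∀ c α : Fin k → ℝ, (∀ i, 0 ≤ c i) → (∀ i, 0 ≤ α i ∧ α i ≤ β) →
      ∀ u ux uy v vx vy : ℝ × ℝ → ℝ,
        IsSobolevH1 (rect h a) u ux uy → IsSobolevH1 (rect h a) v vx vy →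
        (∃ g : ℝ → ℝ, HasTraceOnSide h a 0 u ux uy g ∧ HasTraceOnSide h a a u ux uy g) →
        l2norm (rect h a)
            (fun p => sideWeight h s c α p * frob (gradMat ux uy vx vy p)) ^ 2 ≤
          C * (l2norm (rect h a) (fun p => sideWeight h s c α p * u p) *
                l2norm (rect h a)
                  (fun p => sideWeight h s c α p * frob (symPart (gradMat ux uy vx vy p))) / h +
              l2norm (rect h a)
                  (fun p => sideWeight h s c α p * frob (symPart (gradMat ux uy vx vy p))) ^ 2) := by
  obtain ⟨C, hC, hk⟩ := exists_korn_sobolev hβ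
  refine ⟨6 * C + 4, by positivity, ?_⟩
  rintro a h ha hh s hs c α hc hα u ux uy v vx vy hu hv ⟨g, h0, h1⟩
  obtain ⟨k0, k1⟩ := hk ha hh hc hα hu hv h0 h1
  have hbound : ∀ r ∈ Ioo 0 a, |powSum c α r| ≤ powSum c α a := fun r hr => by
    rw [abs_of_nonneg (powSum_nonneg hc hr.1.le)]
    exact powSum_mono hc hα hr.1.le hr.2.le
  have hmeas := measurable_powSum c α
  rcases hs with rfl | rfl
  · exact korn_gradient_of_wsq_le hh hC.le hmeas hbound (fun p hp => sideWeight_zero c α hp) hu hv k0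
  · exact korn_gradient_of_wsq_le hh hC.le (w := fun y => powSum c α (s - y)) (by fun_prop)
      (fun y hy => hbound _ ⟨by linarith [hy.2], by linarith [hy.1]⟩)
      (fun p hp => sideWeight_height c α hp) hu hv k1
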